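/- **Notation.** Let $\mathcal P^2$ be the set of all (non-empty) convex polytopes in $\mathbb R^2$, i.e. convex hulls of finitely many points, let $o$ be the origin, and write $[A]$ for the convex hull of $A$, in particular $[o,P]$ for the convex hull of $\{o\}\cup P$. A function $Z:\mathcal P^2\to\mathbb R^2$ is a *valuation* if $Z(P)+Z(Q)=Z(P\cup Q)+Z(P\cap Q)$ for all $P,Q\in\mathcal P^2$ with $P\cup Q\in\mathcal P^2$ (then also $P\cap Q\in\mathcal P^2$), and is *$\mathrm{SL}(2)$ contravariant* if $Z(\varphi P)=\varphi^{-t}Z(P)$ for all $P\in\mathcal P^2$ and $\varphi\in \mathrm{SL}(2)$. A solution of Cauchy's functional equation is a function $\zeta:[0,\infty)\to\mathbb R$ with $\zeta(x+y)=\zeta(x)+\zeta(y)$ for all $x,y\ge 0$. Let $\rho_{\pi/2}$ be the counter-clockwise rotation of $\mathbb R^2$ by the angle $\pi/2$. For $P\in\mathcal P^2$ and a unit vector $u$ let $h_P(u)=\max_{x\in P}\langle x,u\rangle$ and $F(P,u)=\{x\in P:\langle x,u\rangle=h_P(u)\}$. Let $\mathcal N(P)$ be the set of unit vectors $u$ for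 which $F(P,u)$ is one-dimensional (so a segment has both of its unit normals in $\mathcal N(P)$), let $\mathcal N_o(P)$ be the set of those $u\in\mathcal N(P)$ for which $o$ lies in the affine hull of $F(P,u)$, and let $V(P,u)$ be the area of $[o,F(P,u)]$. The *facet vector* of $P$ is $$\mathrm{fv}_\zeta(P)=\sum_{u\in\mathcal N(P)\setminus\mathcal N_o(P)}\frac{\zeta(V(P,u))}{|h_P(u)|}\,u ,$$ and the *moment vector* of $P$ is $m(P)=\int_P x\,dx$. For a polytope $P$ containing $o$, let $e(P)=v+w$ if $\dim P=2$ and $P$ has two edges $[o,v]$ and $[o,w]$, or $\dim P=2$ and $P$ has an edge $[v,w]$ that contains $o$ in its relative interior; let $e(P)=2(v+w)$ if $\dim P=1$ and $P=[v,w]$; and let $e(P)=0$ otherwise. A vertex $v$ of $P$ is *visible* from the origin if $P\cap\operatorname{relint}[o,v]=\varnothing$ (where $\operatorname{relint}\{o\}=\{o\}$). **Theorem 1.4.** A function $Z:\mathcal P^2\to\mathbb R^2$ is an $\mathrm{SL}(2)$ contravariant valuation if and only if there exist constants $c_1,c_2,\tilde c_1,\tilde c_2\in\mathbb R$ and solutions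 of Cauchy's functional equation $\zeta_1,\zeta_2:[0,\infty)\to\mathbb R$ such that $$\begin{aligned}Z(P)={}&\mathrm{fv}_{\zeta_1}(P)+\mathrm{fv}_{\zeta_2}([o,P])+c_1\,\rho_{\pi/2}\,m(P)+\tilde c_1\,\rho_{\pi/2}\,m([o,P])\\&+c_2\,\rho_{\pi/2}\,e([o,P])+\tilde c_2\,\rho_{\pi/2}\,e([o,v_1,\ldots,v_r])\end{aligned}$$ for every $P\in\mathcal P^2$, where $v_1,\ldots,v_r$ are the vertices of $P$ visible from the origin. (If there are none, which happens exactly when $o\in P$, then $[o,v_1,\ldots,v_r]=\{o\}$ and the last term is $0$.) -/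

import Mathlib

open scoped NNReal

noncomputable section

namespace SLVal

/-- Euclidean space `ℝⁿ`. -/
abbrev E (n : ℕ) : Type := EuclideanSpace ℝ (Fin n)

/-- A polytope is the convex hull of finitely many points (at least one). -/
def IsPolytope {n : ℕ} (P : Set (E n)) : Prop :=
  ∃ s : Set (E n), s.Finite ∧ s.Nonempty ∧ P = convexHull ℝ s

/-- The space of all polytopes in `ℝⁿ`. -/
def Polytope (n : ℕ) : Type := {P : Set (E n) // IsPolytope P}

instance (n : ℕ) : CoeOut (Polytope n) (Set (E n)) := ⟨Subtype.val⟩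

theorem IsPolytope.image {n : ℕ} {P : Set (E n)} (hP : IsPolytope P) (f : E n →ₗ[ℝ] E n) :
    IsPolytope (f '' P) := by
  obtain ⟨s, hs, hne, rfl⟩ := hP
  exact ⟨f '' s, hs.image f, hne.image f, f.image_convexHull s⟩

/-- The image `φ P` of a polytope under `φ ∈ SL(n)`. -/
def Polytope.map {n : ℕ} (φ : Matrix.SpecialLinearGroup (Fin n) ℝ) (P : Polytope n) : Polytope n :=
  ⟨Matrix.toEuclideanLin φ.1 '' P.1, P.2.image _⟩

/-- `Z (P) + Z (Q) = Z (P ∪ Q) + Z (P ∩ Q)` whenever all four sets are polytopes. -/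
def IsValuation {n : ℕ} (Z : Polytope n → E n) : Prop :=
  ∀ P Q U I : Polytope n, U.1 = P.1 ∪ Q.1 → I.1 = P.1 ∩ Q.1 →
    Z P + Z Q = Z U + Z I

/-- `Z (φ P) = φ^{-t} Z (P)` for all `φ ∈ SL(n)` and all polytopes `P`. -/
def IsSLContravariant {n : ℕ} (Z : Polytope n → E n) : Prop :=
  ∀ (φ : Matrix.SpecialLinearGroup (Fin n) ℝ) (P : Polytope n),
    Z (P.map φ) = Matrix.toEuclideanLin (φ⁻¹).1.transpose (Z P)

/-- Solutions of Cauchy's functional equation on `[0, ∞)`; no regularity is required. -/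
def IsCauchySolution (ζ : ℝ≥0 → ℝ) : Prop :=
  ∀ x y : ℝ≥0, ζ (x + y) = ζ x + ζ y

/-- The dimension of a set: the dimension of its affine hull. -/
def dim {n : ℕ} (P : Set (E n)) : ℕ := Module.finrank ℝ (vectorSpan ℝ P)

/-- The support function `h_P(u)`; the supremum is a maximum for a polytope. -/
def supportFun {n : ℕ} (P : Set (E n)) (u : E n) : ℝ :=
  sSup ((fun x => inner ℝ x u) '' P)

/-- The face `F(P, u)` of `P` in direction `u`. -/
def face {n : ℕ} (P : Set (E n)) (u : E n) : Set (E n) :=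
  {x | x ∈ P ∧ inner ℝ x u = supportFun P u}

/-- The set `N(P)` of outer unit normals of facets, i.e. of `(n-1)`-dimensional faces. An
`(n-1)`-dimensional polytope is its own facet, for both of its unit normals. -/
def facetNormals {n : ℕ} (P : Set (E n)) : Set (E n) :=
  {u | ‖u‖ = 1 ∧ dim (face P u) + 1 = n}

/-- The set `N_o(P)` of outer unit normals of facets with the origin in their affine hulls. -/
def facetNormalsO {n : ℕ} (P : Set (E n)) : Set (E n) :=
  {u | u ∈ facetNormals P ∧ (0 : E n) ∈ affineSpan ℝ (face P u)}

/-- The convex hull `[o, P]` of the origin and `P`. -/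
def convO {n : ℕ} (P : Set (E n)) : Set (E n) := convexHull ℝ (insert 0 P)

/-- `V(P, u)`: the `n`-dimensional volume of the cone `[o, F(P, u)]`. -/
def coneVolume {n : ℕ} (P : Set (E n)) (u : E n) : ℝ≥0 :=
  (MeasureTheory.volume (convO (face P u))).toNNReal

/-- The facet vector `fv_ζ(P)`; the sum is over the finite set `N(P) \ N_o(P)`. -/
def facetVector {n : ℕ} (ζ : ℝ≥0 → ℝ) (P : Set (E n)) : E n :=
  ∑ᶠ u ∈ facetNormals P \ facetNormalsO P, (ζ (coneVolume P u) / |supportFun P u|) • u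

/-- The moment vector `m(P) = ∫_P x dx`. -/
def momentVector {n : ℕ} (P : Set (E n)) : E n := ∫ x in P, x

/-- Counter-clockwise rotation of the plane by the angle `π / 2`. -/
def rot (x : E 2) : E 2 := !₂[-x 1, x 0]

/-- `F` is an edge (a one-dimensional face) of `P`. -/
def IsEdge {n : ℕ} (P F : Set (E n)) : Prop := IsExposed ℝ P F ∧ dim F = 1

/-- `P` is two-dimensional and either has the two edges `[o, v]` and `[o, w]`, or has the edge
`[v, w]` with the origin in its relative interior. -/
def EdgeCase (P : Set (E 2)) (v w : E 2) : Prop :=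
  dim P = 2 ∧
    ((v ≠ w ∧ IsEdge P (segment ℝ 0 v) ∧ IsEdge P (segment ℝ 0 w)) ∨
      (IsEdge P (segment ℝ v w) ∧ (0 : E 2) ∈ openSegment ℝ v w))

/-- `P` is the one-dimensional segment `[v, w]` and contains the origin. -/
def SegmentCase (P : Set (E 2)) (v w : E 2) : Prop :=
  dim P = 1 ∧ P = segment ℝ v w ∧ (0 : E 2) ∈ P

open Classical in
/-- The vector `e(P)`: it is `v + w` in the case `EdgeCase P v w`, `2 (v + w)` in the case
`SegmentCase P v w`, and `0` otherwise. For a polytope containing the origin the unordered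
pair `{v, w}` is unique, so that the choice is irrelevant. -/
def eVector (P : Set (E 2)) : E 2 :=
  if h : ∃ p : E 2 × E 2, EdgeCase P p.1 p.2 then h.choose.1 + h.choose.2
  else if h : ∃ p : E 2 × E 2, SegmentCase P p.1 p.2 then (2 : ℝ) • (h.choose.1 + h.choose.2)
  else 0

/-- The vertices `v` of `P` visible from the origin: `P` is disjoint from the relative interior
of `[o, v]` (which is `{o}` when `v = o`). -/
def visibleVertices {n : ℕ} (P : Set (E n)) : Set (E n) :=
  {v | v ∈ Set.extremePoints ℝ P ∧ P ∩ openSegment ℝ 0 v = ∅}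

end SLVal

end

/-!
Rotation by `π / 2` intertwines the contragredient and the standard action of `SL(2)`, and
everything is organized by directions: a function of the form `P ↦ ∑ T(h_P(u), F(P, u)) u`, summed
over all unit vectors `u`, is a valuation as soon as `T(h, ·)` is additive on collinear segments.
The reason is that, if `P ∪ Q` is convex, then in every direction either the faces of `P ∪ Q` and
`P ∩ Q` are those of `Q` and `P` (or vice versa), or they are the union and the intersection of the
two faces (`add_of_face_add`).

*The functions on the right-hand side are contravariant valuations.* The facet vector is such a
sum, since `ζ` and the area of `[o, F]` are additive. The cones `[o, P ∪ Q]` and `[o, P ∩ Q]` are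
the union and the intersection of `[o, P]` and `[o, Q]` (`convexHull_insert_union`,
`convexHull_insert_inter`), so that `P` may be replaced by `[o, P]` in every valuation. The sum
`edgeSum P` of the endpoints of all faces on supporting lines through the origin is of the same
form. It equals `e(P)` if `o ∈ P` (`eVector_eq_edgeSum`), and `e([o, v₁, …, vᵣ])` is the difference
`edgeSum P - edgeSum [o, P]` (`eVector_visibleVertices`): on a supporting line through the origin
an edge `[a, b]` of `P` with nearer endpoint `a` becomes `[o, b]` in `[o, P]` and `[o, a]` in
`[o, v₁, …, vᵣ]`.

*There are no others.* A valuation that vanishes on points, segments and triangles with a vertex at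
the origin vanishes everywhere (`eq_zero_of_vanish`): a polygon is cut along diagonals into
triangles, a triangle is cut by a line through the origin and a vertex, and a triangle with an edge
on a line through the origin is the difference of two triangles with a vertex at the origin. On
points `a` and segments `[o, a]` an equivariant function is a multiple of `a`. On segments `[a, b]`
and triangles `[o, a, b]` it is a combination of `a` and `b` whose coefficients depend on the
determinant only, and subdividing `[a, b]` leads to Cauchy's functional equation
(`exists_cauchySolution`). The resulting constants and additive functions are matched by those of
the right-hand side (`exists_eq_candidate`).
-/

noncomputable section

namespace SLVal

/-! ### Cones over convex sets -/

section Convexity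

variable {V : Type*} [NormedAddCommGroup V] [NormedSpace ℝ V]

theorem exists_mem_segment_inter {P Q : Set V} (hPc : IsClosed P) (hQc : IsClosed Q)
    (hU : Convex ℝ (P ∪ Q)) {p q : V} (hp : p ∈ P) (hq : q ∈ Q) :
    ∃ r ∈ segment ℝ p q, r ∈ P ∩ Q := by
  have hconn : IsPreconnected (segment ℝ p q) := (convex_segment p q).isPreconnected
  have hsub : segment ℝ p q ⊆ P ∪ Q := hU.segment_subset (Or.inl hp) (Or.inr hq)
  obtain ⟨r, hr, hr'⟩ := isPreconnected_closed_iff.1 hconn P Q hPc hQc hsub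
    ⟨p, left_mem_segment ℝ p q, hp⟩ ⟨q, right_mem_segment ℝ p q, hq⟩
  exact ⟨r, hr, hr'⟩

theorem mem_convexHull_insert_iff {P : Set V} (hP : Convex ℝ P) (hne : P.Nonempty) {b x : V} :
    x ∈ convexHull ℝ (insert b P) ↔
      ∃ p ∈ P, ∃ t : ℝ, 0 ≤ t ∧ t ≤ 1 ∧ x = b + t • (p - b) := by
  rw [convexHull_insert hne, hP.convexHull_eq, convexJoin_singleton_left]
  simp only [Set.mem_iUnion, segment_eq_image', Set.mem_image, Set.mem_Icc, exists_prop]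
  constructor
  · rintro ⟨p, hp, t, ⟨h0, h1⟩, rfl⟩
    exact ⟨p, hp, t, h0, h1, rfl⟩
  · rintro ⟨p, hp, t, h0, h1, rfl⟩
    exact ⟨p, hp, t, ⟨h0, h1⟩, rfl⟩

theorem convexHull_insert_union {P Q : Set V} (hP : Convex ℝ P) (hQ : Convex ℝ Q)
    (hPn : P.Nonempty) (hQn : Q.Nonempty) (hU : Convex ℝ (P ∪ Q)) (b : V) :
    convexHull ℝ (insert b (P ∪ Q)) = convexHull ℝ (insert b P) ∪ convexHull ℝ (insert b Q) := by
  ext x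
  rw [Set.mem_union, mem_convexHull_insert_iff hU hPn.inl, mem_convexHull_insert_iff hP hPn,
    mem_convexHull_insert_iff hQ hQn]
  constructor
  · rintro ⟨p, hp | hp, h⟩
    exacts [Or.inl ⟨p, hp, h⟩, Or.inr ⟨p, hp, h⟩]
  · rintro (⟨p, hp, h⟩ | ⟨p, hp, h⟩)
    exacts [⟨p, Or.inl hp, h⟩, ⟨p, Or.inr hp, h⟩]

/-- Two points `p ∈ P` and `q ∈ Q` on a ray from `b` have a point of `P ∩ Q` between them. -/
theorem exists_mem_inter_of_mem_ray {P Q : Set V} (hPc : IsClosed P)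
    (hQc : IsClosed Q) (hU : Convex ℝ (P ∪ Q)) {p q b : V} (hp : p ∈ P) (hq : q ∈ Q) {s t : ℝ}
    (hs : 0 < s) (hst : s ≤ t) (ht : t ≤ 1) (h : s • (q - b) = t • (p - b)) :
    ∃ r ∈ P ∩ Q, ∃ c : ℝ, 0 ≤ c ∧ c ≤ 1 ∧ t • (p - b) = c • (r - b) := by
  obtain ⟨r, hr, hr'⟩ := exists_mem_segment_inter hPc hQc hU hp hq
  rw [segment_eq_image'] at hr
  obtain ⟨l, ⟨hl0, hl1⟩, rfl⟩ := hr
  have hqb : q - b = (t / s) • (p - b) := by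
    rw [div_eq_inv_mul, mul_smul, ← h, smul_smul, inv_mul_cancel₀ hs.ne', one_smul]
  have hts : 1 ≤ t / s := by rwa [le_div_iff₀ hs, one_mul]
  -- the point `r` is at `μ ≥ 1` times the position of `p` on the ray
  set μ : ℝ := 1 + l * (t / s - 1) with hμ
  have hμ1 : 1 ≤ μ := by nlinarith
  have hμr : p + l • (q - p) - b = μ • (p - b) := by
    have : q - p = (t / s - 1) • (p - b) := by
      rw [sub_smul, one_smul, ← hqb]; abel
    rw [this, hμ, add_smul, one_smul, mul_smul]; abel
  refine ⟨_, hr', t / μ, div_nonneg (hs.le.trans hst) (by linarith), ?_, ?_⟩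
  · rw [div_le_one (by linarith)]; linarith
  · rw [hμr, smul_smul, div_mul_cancel₀ _ (by linarith)]

theorem convexHull_insert_inter {P Q : Set V} (hP : Convex ℝ P) (hQ : Convex ℝ Q)
    (hPc : IsClosed P) (hQc : IsClosed Q)
    (hPn : P.Nonempty) (hQn : Q.Nonempty) (hU : Convex ℝ (P ∪ Q)) (b : V) :
    convexHull ℝ (insert b (P ∩ Q)) = convexHull ℝ (insert b P) ∩ convexHull ℝ (insert b Q) := by
  obtain ⟨p₀, hp₀⟩ := hPn
  obtain ⟨q₀, hq₀⟩ := hQn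
  obtain ⟨r₀, -, hr₀⟩ := exists_mem_segment_inter hPc hQc hU hp₀ hq₀
  apply Set.Subset.antisymm
  · exact Set.subset_inter (convexHull_mono (Set.insert_subset_insert Set.inter_subset_left))
      (convexHull_mono (Set.insert_subset_insert Set.inter_subset_right))
  rintro x ⟨hxP, hxQ⟩
  rw [mem_convexHull_insert_iff (hP.inter hQ) ⟨r₀, hr₀⟩]
  obtain ⟨p, hp, t, ht0, ht1, rfl⟩ := (mem_convexHull_insert_iff hP ⟨p₀, hp₀⟩).1 hxP
  obtain ⟨q, hq, s, hs0, hs1, hx⟩ := (mem_convexHull_insert_iff hQ ⟨q₀, hq₀⟩).1 hxQ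
  have hx' : t • (p - b) = s • (q - b) := add_left_cancel hx
  rcases ht0.eq_or_lt with rfl | ht
  · exact ⟨r₀, hr₀, 0, le_rfl, zero_le_one, by simp⟩
  rcases hs0.eq_or_lt with rfl | hs
  · exact ⟨r₀, hr₀, 0, le_rfl, zero_le_one, by rw [hx']; simp⟩
  rcases le_total s t with hst | hst
  · obtain ⟨r, hr, c, hc0, hc1, hc⟩ :=
      exists_mem_inter_of_mem_ray hPc hQc hU hp hq hs hst ht1 hx'.symm
    exact ⟨r, hr, c, hc0, hc1, by rw [hc]⟩
  · obtain ⟨r, hr, c, hc0, hc1, hc⟩ :=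
      exists_mem_inter_of_mem_ray hQc hPc (by rwa [Set.union_comm]) hq hp ht hst hs1 hx'
    exact ⟨r, ⟨hr.2, hr.1⟩, c, hc0, hc1, by rw [hx', hc]⟩

end Convexity

/-! ### Polytopes -/

section Polytopes

variable {n : ℕ} {P Q : Set (E n)}

theorem IsPolytope.isCompact (h : IsPolytope P) : IsCompact P := by
  obtain ⟨s, hs, -, rfl⟩ := h
  exact Set.Finite.isCompact_convexHull ℝ hs

theorem IsPolytope.isClosed (h : IsPolytope P) : IsClosed P := h.isCompact.isClosed

theorem IsPolytope.convex (h : IsPolytope P) : Convex ℝ P := by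
  obtain ⟨s, -, -, rfl⟩ := h
  exact convex_convexHull ℝ s

theorem IsPolytope.nonempty (h : IsPolytope P) : P.Nonempty := by
  obtain ⟨s, -, hs, rfl⟩ := h
  exact hs.mono (subset_convexHull ℝ s)

theorem isPolytope_convexHull {s : Set (E n)} (hs : s.Finite) (hne : s.Nonempty) :
    IsPolytope (convexHull ℝ s) := ⟨s, hs, hne, rfl⟩

theorem IsPolytope.convexHull_insert (h : IsPolytope P) (b : E n) :
    IsPolytope (convexHull ℝ (insert b P)) := by
  obtain ⟨s, hs, -, rfl⟩ := h
  refine ⟨insert b s, hs.insert b, Set.insert_nonempty _ _, ?_⟩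
  rw [Set.insert_eq, Set.insert_eq, convexHull_convexHull_union_right]

theorem IsPolytope.convO (h : IsPolytope P) : IsPolytope (convO P) := h.convexHull_insert 0

/-- The polytope `[o, P]`. -/
def Polytope.convO (P : Polytope n) : Polytope n := ⟨SLVal.convO P.1, P.2.convO⟩

theorem zero_mem_convO (P : Set (E n)) : (0 : E n) ∈ convO P :=
  subset_convexHull ℝ _ (Set.mem_insert _ _)

theorem subset_convO (P : Set (E n)) : P ⊆ convO P :=
  (Set.subset_insert _ _).trans (subset_convexHull ℝ _)

theorem convO_eq_self (hP : Convex ℝ P) (h0 : (0 : E n) ∈ P) : convO P = P := by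
  rw [convO, Set.insert_eq_of_mem h0, hP.convexHull_eq]

theorem mem_convO_iff (hP : Convex ℝ P) (hne : P.Nonempty) {x : E n} :
    x ∈ convO P ↔ ∃ p ∈ P, ∃ t : ℝ, 0 ≤ t ∧ t ≤ 1 ∧ x = t • p := by
  rw [convO, mem_convexHull_insert_iff hP hne]
  simp

theorem image_convO (f : E n →ₗ[ℝ] E n) (P : Set (E n)) : convO (f '' P) = f '' convO P := by
  rw [convO, convO, f.image_convexHull, Set.image_insert_eq, map_zero]

theorem Polytope.convO_map (φ : Matrix.SpecialLinearGroup (Fin n) ℝ) (P : Polytope n) :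
    (P.map φ).convO = P.convO.map φ :=
  Subtype.ext (image_convO _ _)

theorem IsValuation.comp_convO {Z : Polytope n → E n} (hZ : IsValuation Z) :
    IsValuation fun P => Z P.convO := by
  intro P Q U I hU hI
  have hUc : Convex ℝ (P.1 ∪ Q.1) := hU ▸ U.2.convex
  refine hZ _ _ _ _ ?_ ?_
  · change convO U.1 = convO P.1 ∪ convO Q.1
    rw [hU]
    exact convexHull_insert_union P.2.convex Q.2.convex P.2.nonempty Q.2.nonempty hUc 0
  · change convO I.1 = convO P.1 ∩ convO Q.1
    rw [hI]
    exact convexHull_insert_inter P.2.convex Q.2.convex P.2.isClosed Q.2.isClosed P.2.nonempty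
      Q.2.nonempty hUc 0

theorem IsSLContravariant.comp_convO {Z : Polytope n → E n} (hZ : IsSLContravariant Z) :
    IsSLContravariant fun P => Z P.convO := by
  intro φ P
  change Z (P.map φ).convO = _
  rw [Polytope.convO_map, hZ]

/-! ### Support functions and faces -/

theorem bddAbove_inner (hP : IsCompact P) (u : E n) :
    BddAbove ((fun x => inner ℝ x u) '' P) :=
  (hP.image (by fun_prop)).bddAbove

theorem inner_le_supportFun (hP : IsCompact P) {x : E n} (hx : x ∈ P) (u : E n) :
    inner ℝ x u ≤ supportFun P u :=
  le_csSup (bddAbove_inner hP u) ⟨x, hx, rfl⟩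

theorem supportFun_eq {x u : E n} (hx : x ∈ P) (h : ∀ y ∈ P, inner ℝ y u ≤ inner ℝ x u) :
    supportFun P u = inner ℝ x u :=
  IsGreatest.csSup_eq ⟨⟨x, hx, rfl⟩, by rintro _ ⟨y, hy, rfl⟩; exact h y hy⟩

theorem face_nonempty (hP : IsCompact P) (hne : P.Nonempty) (u : E n) : (face P u).Nonempty := by
  obtain ⟨x, hx, hmax⟩ := hP.exists_isMaxOn hne (f := fun x => inner ℝ x u)
    (by fun_prop)
  exact ⟨x, hx, (supportFun_eq hx hmax).symm⟩

theorem face_subset (P : Set (E n)) (u : E n) : face P u ⊆ P := fun _ h => h.1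

theorem mem_face_iff {x u : E n} (hP : IsCompact P) :
    x ∈ face P u ↔ x ∈ P ∧ ∀ y ∈ P, inner ℝ y u ≤ inner ℝ x u := by
  constructor
  · rintro ⟨hx, h⟩
    exact ⟨hx, fun y hy => h ▸ inner_le_supportFun hP hy u⟩
  · rintro ⟨hx, h⟩
    exact ⟨hx, (supportFun_eq hx h).symm⟩

theorem face_isCompact (hP : IsCompact P) (u : E n) : IsCompact (face P u) :=
  hP.inter_right (isClosed_eq (by fun_prop) continuous_const)

theorem face_convex (hP : Convex ℝ P) (u : E n) : Convex ℝ (face P u) := by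
  intro x hx y hy a b ha hb hab
  refine ⟨hP hx.1 hy.1 ha hb hab, ?_⟩
  rw [inner_add_left, inner_smul_left, inner_smul_left, hx.2, hy.2]
  simp only [conj_trivial]
  rw [← add_mul, hab, one_mul]

theorem supportFun_union (hP : IsCompact P) (hQ : IsCompact Q) (hPn : P.Nonempty)
    (hQn : Q.Nonempty) (u : E n) :
    supportFun (P ∪ Q) u = max (supportFun P u) (supportFun Q u) := by
  rw [supportFun, Set.image_union,
    csSup_union (bddAbove_inner hP u) (hPn.image _) (bddAbove_inner hQ u) (hQn.image _)]
  rfl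

theorem face_union_of_lt (hP : IsCompact P) (hQ : IsCompact Q) (hPn : P.Nonempty)
    (hQn : Q.Nonempty) {u : E n} (h : supportFun P u < supportFun Q u) :
    face (P ∪ Q) u = face Q u := by
  ext x
  simp only [face, Set.mem_ofPred_eq, supportFun_union hP hQ hPn hQn, max_eq_right h.le]
  constructor
  · rintro ⟨hx | hx, h'⟩
    · exact absurd (inner_le_supportFun hP hx u) (by rw [h']; exact not_le.2 h)
    · exact ⟨hx, h'⟩
  · rintro ⟨hx, h'⟩
    exact ⟨Or.inr hx, h'⟩

theorem face_union_of_eq (hP : IsCompact P) (hQ : IsCompact Q) (hPn : P.Nonempty)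
    (hQn : Q.Nonempty) {u : E n} (h : supportFun P u = supportFun Q u) :
    face (P ∪ Q) u = face P u ∪ face Q u := by
  ext x
  simp only [face, Set.mem_ofPred_eq, supportFun_union hP hQ hPn hQn, h, max_self, Set.mem_union]
  tauto

/-- If `P` has the smaller support number, then the face of `P` lies in `Q`: the segments from a
point of this face to a point of `face Q u` leave `P` at once. -/
theorem face_inter_of_lt (hP : IsCompact P) (hQ : IsCompact Q) (hPn : P.Nonempty)
    (hQn : Q.Nonempty) (hU : Convex ℝ (P ∪ Q)) {u : E n}
    (h : supportFun P u < supportFun Q u) :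
    supportFun (P ∩ Q) u = supportFun P u ∧ face (P ∩ Q) u = face P u := by
  have key : face P u ⊆ Q := by
    intro x hx
    obtain ⟨y, hy⟩ := face_nonempty hQ hQn u
    obtain ⟨r, hr, hrP, hrQ⟩ := exists_mem_segment_inter hP.isClosed hQ.isClosed hU hx.1 hy.1
    rw [segment_eq_image'] at hr
    obtain ⟨l, ⟨hl0, hl1⟩, rfl⟩ := hr
    have h1 := inner_le_supportFun hP hrP u
    simp only [inner_add_left, inner_smul_left, inner_sub_left, conj_trivial, hx.2, hy.2] at h1
    have hl : l = 0 := by nlinarith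
    simpa [hl] using hrQ
  obtain ⟨x, hx⟩ := face_nonempty hP hPn u
  have hs : supportFun (P ∩ Q) u = supportFun P u := by
    rw [supportFun_eq (P := P ∩ Q) (x := x) ⟨hx.1, key hx⟩, hx.2]
    rintro y ⟨hy, -⟩
    rw [hx.2]
    exact inner_le_supportFun hP hy u
  refine ⟨hs, ?_⟩
  ext y
  simp only [face, Set.mem_ofPred_eq, hs, Set.mem_inter_iff]
  exact ⟨fun h => ⟨h.1.1, h.2⟩, fun h => ⟨⟨h.1, key h⟩, h.2⟩⟩

theorem face_inter_of_eq (hP : IsCompact P) (hQ : IsCompact Q) (hPn : P.Nonempty)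
    (hQn : Q.Nonempty) (hU : Convex ℝ (P ∪ Q)) {u : E n}
    (h : supportFun P u = supportFun Q u) :
    supportFun (P ∩ Q) u = supportFun P u ∧ face (P ∩ Q) u = face P u ∩ face Q u := by
  have hF : Convex ℝ (face P u ∪ face Q u) := by
    rw [← face_union_of_eq hP hQ hPn hQn h]
    exact face_convex hU u
  obtain ⟨x, hx⟩ := face_nonempty hP hPn u
  obtain ⟨y, hy⟩ := face_nonempty hQ hQn u
  obtain ⟨r, -, hrP, hrQ⟩ := exists_mem_segment_inter (face_isCompact hP u).isClosed
    (face_isCompact hQ u).isClosed hF hx hy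
  have hs : supportFun (P ∩ Q) u = supportFun P u := by
    rw [supportFun_eq (P := P ∩ Q) (x := r) ⟨hrP.1, hrQ.1⟩, hrP.2]
    rintro y ⟨hy, -⟩
    rw [hrP.2]
    exact inner_le_supportFun hP hy u
  refine ⟨hs, ?_⟩
  ext y
  simp only [face, Set.mem_ofPred_eq, hs, Set.mem_inter_iff, ← h]
  tauto

theorem supportFun_inter (hP : IsCompact P) (hQ : IsCompact Q) (hPn : P.Nonempty)
    (hQn : Q.Nonempty) (hU : Convex ℝ (P ∪ Q)) (u : E n) :
    supportFun (P ∩ Q) u = min (supportFun P u) (supportFun Q u) := by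
  rcases lt_trichotomy (supportFun P u) (supportFun Q u) with h | h | h
  · rw [(face_inter_of_lt hP hQ hPn hQn hU h).1, min_eq_left h.le]
  · rw [(face_inter_of_eq hP hQ hPn hQn hU h).1, h, min_self]
  · rw [Set.inter_comm, (face_inter_of_lt hQ hP hQn hPn (Set.union_comm P Q ▸ hU) h).1,
      min_eq_right h.le]

/-- A quantity that depends only on the support number and the face in one direction is additive
as soon as it is additive on faces with the same support number. -/
theorem add_of_face_add {M : Type*} [AddCommMonoid M] (G : ℝ → Set (E n) → M) (u : E n)
    (hG : ∀ (h : ℝ) (F₁ F₂ : Set (E n)), IsCompact F₁ → IsCompact F₂ → F₁.Nonempty →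
      F₂.Nonempty → Convex ℝ F₁ → Convex ℝ F₂ → Convex ℝ (F₁ ∪ F₂) →
      (∀ x ∈ F₁ ∪ F₂, inner ℝ x u = h) → G h F₁ + G h F₂ = G h (F₁ ∪ F₂) + G h (F₁ ∩ F₂))
    (hP : IsPolytope P) (hQ : IsPolytope Q) (hU : Convex ℝ (P ∪ Q)) :
    G (supportFun P u) (face P u) + G (supportFun Q u) (face Q u) =
      G (supportFun (P ∪ Q) u) (face (P ∪ Q) u) + G (supportFun (P ∩ Q) u) (face (P ∩ Q) u) := by
  have hPk := hP.isCompact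
  have hQk := hQ.isCompact
  rw [supportFun_union hPk hQk hP.nonempty hQ.nonempty]
  rcases lt_trichotomy (supportFun P u) (supportFun Q u) with h | h | h
  · obtain ⟨h1, h2⟩ := face_inter_of_lt hPk hQk hP.nonempty hQ.nonempty hU h
    rw [h1, h2, face_union_of_lt hPk hQk hP.nonempty hQ.nonempty h, max_eq_right h.le, add_comm]
  · obtain ⟨h1, h2⟩ := face_inter_of_eq hPk hQk hP.nonempty hQ.nonempty hU h
    have h3 := face_union_of_eq hPk hQk hP.nonempty hQ.nonempty h
    rw [h1, h2, h3, ← h, max_self]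
    refine hG _ _ _ (face_isCompact hPk u) (face_isCompact hQk u)
      (face_nonempty hPk hP.nonempty u) (face_nonempty hQk hQ.nonempty u)
      (face_convex hP.convex u) (face_convex hQ.convex u) (h3 ▸ face_convex hU u) ?_
    rintro x (hx | hx)
    exacts [hx.2, hx.2.trans h.symm]
  · have hU' : Convex ℝ (Q ∪ P) := Set.union_comm P Q ▸ hU
    obtain ⟨h1, h2⟩ := face_inter_of_lt hQk hPk hQ.nonempty hP.nonempty hU' h
    rw [Set.inter_comm, h1, h2, Set.union_comm,
      face_union_of_lt hQk hPk hQ.nonempty hP.nonempty h, max_eq_left h.le]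

end Polytopes

/-! ### The plane: rotation, determinant and the action of `SL(2)` -/

section Plane

/-- The special linear group of the plane. -/
abbrev SL2 : Type := Matrix.SpecialLinearGroup (Fin 2) ℝ

/-- The action of `φ ∈ SL(2)` on the plane. -/
abbrev act (φ : SL2) : E 2 →ₗ[ℝ] E 2 := Matrix.toEuclideanLin φ.1

/-- The contragredient action `φ^{-t}` of `φ ∈ SL(2)` on the plane. -/
abbrev coact (φ : SL2) : E 2 →ₗ[ℝ] E 2 := Matrix.toEuclideanLin (φ⁻¹).1.transpose

/-- The determinant of two vectors of the plane, i.e. their oriented area. -/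
def cross (a b : E 2) : ℝ := a 0 * b 1 - a 1 * b 0

theorem E2_ext {x y : E 2} (h0 : x 0 = y 0) (h1 : x 1 = y 1) : x = y := by
  ext i; fin_cases i
  exacts [h0, h1]

theorem inner_E2 (x y : E 2) : inner ℝ x y = x 0 * y 0 + x 1 * y 1 := by
  simp [PiLp.inner_apply, Fin.sum_univ_two]; ring

theorem norm_sq_E2 (x : E 2) : ‖x‖ ^ 2 = x 0 ^ 2 + x 1 ^ 2 := by
  simp [EuclideanSpace.norm_sq_eq, Fin.sum_univ_two]

theorem sq_add_sq_of_norm_eq_one {u : E 2} (hu : ‖u‖ = 1) : u 0 ^ 2 + u 1 ^ 2 = 1 := by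
  rw [← norm_sq_E2, hu, one_pow]

theorem ne_zero_of_norm_eq_one {u : E 2} (hu : ‖u‖ = 1) : u ≠ 0 := by
  rintro rfl; simp at hu

@[simp] theorem rot_zero_apply (x : E 2) : rot x 0 = -x 1 := rfl
@[simp] theorem rot_one_apply (x : E 2) : rot x 1 = x 0 := rfl

theorem rot_add (x y : E 2) : rot (x + y) = rot x + rot y :=
  E2_ext (by simp; ring) (by simp)

theorem rot_smul (c : ℝ) (x : E 2) : rot (c • x) = c • rot x :=
  E2_ext (by simp) (by simp)

theorem rot_neg (x : E 2) : rot (-x) = -rot x :=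
  E2_ext (by simp) (by simp)

theorem rot_sub (x y : E 2) : rot (x - y) = rot x - rot y := by
  rw [sub_eq_add_neg, rot_add, rot_neg, ← sub_eq_add_neg]

@[simp] theorem rot_zero : rot 0 = 0 := E2_ext (by simp) (by simp)

theorem rot_rot (x : E 2) : rot (rot x) = -x := E2_ext (by simp) (by simp)

theorem rot_injective : Function.Injective rot := fun x y h => by
  rw [← neg_inj, ← rot_rot, ← rot_rot, h]

theorem norm_rot (x : E 2) : ‖rot x‖ = ‖x‖ := by
  rw [← sq_eq_sq₀ (norm_nonneg _) (norm_nonneg _), norm_sq_E2, norm_sq_E2]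
  simp; ring

theorem inner_rot_self (x : E 2) : inner ℝ x (rot x) = 0 := by
  rw [inner_E2]; simp; ring

theorem cross_eq_inner_rot (a b : E 2) : cross a b = inner ℝ b (rot a) := by
  rw [inner_E2, cross]; simp; ring

theorem cross_self (a : E 2) : cross a a = 0 := by simp [cross]; ring
theorem cross_swap (a b : E 2) : cross b a = -cross a b := by simp [cross]; ring
@[simp] theorem cross_zero_left (a : E 2) : cross 0 a = 0 := by simp [cross]
@[simp] theorem cross_zero_right (a : E 2) : cross a 0 = 0 := by simp [cross]

theorem act_zero_apply (φ : SL2) (x : E 2) : act φ x 0 = φ.1 0 0 * x 0 + φ.1 0 1 * x 1 := by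
  simp [Matrix.mulVec, dotProduct, Fin.sum_univ_two]

theorem act_one_apply (φ : SL2) (x : E 2) : act φ x 1 = φ.1 1 0 * x 0 + φ.1 1 1 * x 1 := by
  simp [Matrix.mulVec, dotProduct, Fin.sum_univ_two]

theorem SL2_coe_inv (φ : SL2) :
    (φ⁻¹).1 = !![φ.1 1 1, -φ.1 0 1; -φ.1 1 0, φ.1 0 0] := by
  rw [Matrix.SpecialLinearGroup.coe_inv, Matrix.adjugate_fin_two]

theorem coact_zero_apply (φ : SL2) (x : E 2) :
    coact φ x 0 = φ.1 1 1 * x 0 - φ.1 1 0 * x 1 := by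
  rw [coact, SL2_coe_inv]
  simp [Matrix.mulVec, dotProduct, Fin.sum_univ_two]
  ring

theorem coact_one_apply (φ : SL2) (x : E 2) :
    coact φ x 1 = -φ.1 0 1 * x 0 + φ.1 0 0 * x 1 := by
  rw [coact, SL2_coe_inv]
  simp [Matrix.mulVec, dotProduct, Fin.sum_univ_two]

theorem SL2_det (φ : SL2) : φ.1 0 0 * φ.1 1 1 - φ.1 0 1 * φ.1 1 0 = 1 := by
  rw [← Matrix.det_fin_two, φ.2]

theorem inner_act_coact (φ : SL2) (x u : E 2) :
    inner ℝ (act φ x) (coact φ u) = inner ℝ x u := by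
  rw [inner_E2, inner_E2, act_zero_apply, act_one_apply, coact_zero_apply, coact_one_apply]
  linear_combination (x 0 * u 0 + x 1 * u 1) * SL2_det φ

theorem coact_rot (φ : SL2) (x : E 2) : coact φ (rot x) = rot (act φ x) := by
  apply E2_ext
  · rw [coact_zero_apply, rot_zero_apply, rot_zero_apply, rot_one_apply, act_one_apply]; ring
  · rw [coact_one_apply, rot_one_apply, rot_zero_apply, rot_one_apply, act_zero_apply]; ring

theorem coact_inv_coact (φ : SL2) (x : E 2) : coact φ⁻¹ (coact φ x) = x := by
  have h := SL2_det φ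
  apply E2_ext
  · rw [coact_zero_apply, coact_zero_apply, coact_one_apply]
    rw [SL2_coe_inv]
    simp
    linear_combination x 0 * h
  · rw [coact_one_apply, coact_zero_apply, coact_one_apply]
    rw [SL2_coe_inv]
    simp
    linear_combination x 1 * h

theorem coact_ne_zero (φ : SL2) {x : E 2} (hx : x ≠ 0) : coact φ x ≠ 0 := fun h => hx <| by
  rw [← coact_inv_coact φ x, h, map_zero]

/-- Two vectors `a`, `b` with positive determinant `d` are the image of the standard pair
`(1, 0)`, `(0, d)` under an element of `SL(2)`. -/
theorem exists_act_eq {a b : E 2} (h : 0 < cross a b) :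
    ∃ φ : SL2, act φ !₂[1, 0] = a ∧ act φ !₂[0, cross a b] = b := by
  have h' := h.ne'
  have hdet : Matrix.det !![a 0, b 0 / cross a b; a 1, b 1 / cross a b] = 1 := by
    rw [Matrix.det_fin_two_of, ← div_self h']
    nth_rewrite 3 [cross]
    ring
  refine ⟨⟨_, hdet⟩, E2_ext ?_ ?_, E2_ext ?_ ?_⟩ <;> simp <;> field_simp

/-- In the plane a vector orthogonal to the unit vector `u` is a multiple of `rot u`. -/
theorem eq_smul_rot_of_inner_eq_zero {u x : E 2} (hu : ‖u‖ = 1) (h : inner ℝ x u = 0) :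
    x = inner ℝ x (rot u) • rot u := by
  have h1 := sq_add_sq_of_norm_eq_one hu
  rw [inner_E2] at h
  apply E2_ext
  · simp only [inner_E2, PiLp.smul_apply, rot_zero_apply, rot_one_apply, smul_eq_mul]
    linear_combination (-x 0) * h1 + u 0 * h
  · simp only [inner_E2, PiLp.smul_apply, rot_zero_apply, rot_one_apply, smul_eq_mul]
    linear_combination (-x 1) * h1 + u 1 * h

theorem finite_unit_orthogonal {a : E 2} (ha : a ≠ 0) :
    {u : E 2 | ‖u‖ = 1 ∧ inner ℝ a u = 0}.Finite := by
  have hn : 0 < ‖a‖ := norm_pos_iff.2 ha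
  refine (Set.toFinite {‖a‖⁻¹ • rot a, -(‖a‖⁻¹ • rot a)}).subset ?_
  rintro u ⟨hu, hau⟩
  have h1 : u = inner ℝ u (rot a) • (‖a‖⁻¹ ^ 2) • rot a := by
    have h2 : inner ℝ u (‖a‖⁻¹ • a) = 0 := by
      rw [inner_smul_right, real_inner_comm, hau, mul_zero]
    have := eq_smul_rot_of_inner_eq_zero
      (by rw [norm_smul, norm_inv, norm_norm, inv_mul_cancel₀ hn.ne']) h2
    rw [rot_smul, inner_smul_right, smul_smul] at this
    nth_rewrite 1 [this]
    rw [smul_smul]; ring_nf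
  have h3 : (inner ℝ u (rot a) : ℝ) ^ 2 = ‖a‖ ^ 2 := by
    have := sq_add_sq_of_norm_eq_one hu
    rw [inner_E2] at hau
    rw [inner_E2, norm_sq_E2, rot_zero_apply, rot_one_apply]
    linear_combination (a 0 ^ 2 + a 1 ^ 2) * this - (a 0 * u 0 + a 1 * u 1) * hau
  rcases sq_eq_sq_iff_eq_or_eq_neg.1 h3 with h | h
  · left
    rw [h1, h, smul_smul]; congr 1; field_simp
  · right
    rw [Set.mem_singleton_iff, h1, h, smul_smul, ← neg_smul]; congr 1; field_simp

end Plane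

/-! ### Sums over the unit circle -/

section SphereSum

/-- The sum of the values of `T` over all unit vectors; meaningful if almost all are zero. -/
def sphereSum (T : E 2 → E 2) : E 2 := ∑ᶠ u ∈ {u : E 2 | ‖u‖ = 1}, T u

theorem sphereSum_congr {T T' : E 2 → E 2} (h : ∀ u, ‖u‖ = 1 → T u = T' u) :
    sphereSum T = sphereSum T' :=
  finsum_mem_congr rfl h

theorem sphereSum_add {T T' : E 2 → E 2} (h : {u | ‖u‖ = 1 ∧ T u ≠ 0}.Finite)
    (h' : {u | ‖u‖ = 1 ∧ T' u ≠ 0}.Finite) :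
    sphereSum (fun u => T u + T' u) = sphereSum T + sphereSum T' :=
  finsum_mem_add_distrib' h h'

theorem sphereSum_map {T : E 2 → E 2} (f : E 2 →ₗ[ℝ] E 2)
    (h : {u | ‖u‖ = 1 ∧ T u ≠ 0}.Finite) :
    sphereSum (fun u => f (T u)) = f (sphereSum T) :=
  (AddMonoidHom.map_finsum_mem' f.toAddMonoidHom h).symm

/-- The unit vector in the direction of `x`. -/
def unit (x : E 2) : E 2 := ‖x‖⁻¹ • x

theorem norm_unit {x : E 2} (hx : x ≠ 0) : ‖unit x‖ = 1 := by
  rw [unit, norm_smul, norm_inv, norm_norm, inv_mul_cancel₀ (norm_ne_zero_iff.2 hx)]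

theorem unit_smul {c : ℝ} (hc : 0 < c) (x : E 2) : unit (c • x) = unit x := by
  rw [unit, unit, norm_smul, Real.norm_of_nonneg hc.le, smul_smul, mul_inv, mul_right_comm,
    inv_mul_cancel₀ hc.ne', one_mul]

theorem unit_of_norm {x : E 2} (hx : ‖x‖ = 1) : unit x = x := by
  rw [unit, hx, inv_one, one_smul]

/-- After normalization the contragredient action permutes the unit vectors. -/
theorem bijOn_unit_coact (φ : SL2) :
    Set.BijOn (fun u => unit (coact φ u)) {u : E 2 | ‖u‖ = 1} {u : E 2 | ‖u‖ = 1} := by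
  have hmaps : ∀ φ : SL2, Set.MapsTo (fun u => unit (coact φ u)) {u : E 2 | ‖u‖ = 1}
      {u : E 2 | ‖u‖ = 1} := fun φ u hu =>
    norm_unit (coact_ne_zero φ (ne_zero_of_norm_eq_one hu))
  have hinv : ∀ φ : SL2, ∀ u : E 2, ‖u‖ = 1 →
      unit (coact φ⁻¹ (unit (coact φ u))) = u := by
    intro φ u hu
    have h0 := coact_ne_zero φ (ne_zero_of_norm_eq_one hu)
    nth_rewrite 2 [unit]
    rw [map_smul, unit_smul (inv_pos.2 (norm_pos_iff.2 h0)), coact_inv_coact, unit_of_norm hu]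
  refine Set.InvOn.bijOn (f' := fun u => unit (coact φ⁻¹ u)) ⟨fun u hu => hinv φ u hu, ?_⟩
    (hmaps φ) (hmaps φ⁻¹)
  intro u hu
  simpa using hinv φ⁻¹ u hu

theorem sphereSum_coact {T T' : E 2 → E 2} (φ : SL2) (f : E 2 →ₗ[ℝ] E 2)
    (hfin : {u | ‖u‖ = 1 ∧ T u ≠ 0}.Finite)
    (h : ∀ u, ‖u‖ = 1 → T' (unit (coact φ u)) = f (T u)) :
    sphereSum T' = f (sphereSum T) := by
  rw [← sphereSum_map f hfin]
  exact (finsum_mem_eq_of_bijOn _ (bijOn_unit_coact φ) fun u hu => (h u hu).symm).symm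

end SphereSum

/-! ### Faces of planar polytopes -/

section Faces

variable {P : Set (E 2)}

open Pointwise in
theorem supportFun_smul {n : ℕ} (P : Set (E n)) {c : ℝ} (hc : 0 ≤ c) (u : E n) :
    supportFun P (c • u) = c * supportFun P u := by
  have : (fun x : E n => (inner ℝ x (c • u) : ℝ)) '' P = c • ((fun x => inner ℝ x u) '' P) := by
    ext y
    simp [Set.mem_smul_set, inner_smul_right]
  rw [supportFun, this, Real.sSup_smul_of_nonneg hc, smul_eq_mul, supportFun]

theorem face_smul {n : ℕ} (P : Set (E n)) {c : ℝ} (hc : 0 < c) (u : E n) :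
    face P (c • u) = face P u := by
  ext x
  simp [face, supportFun_smul P hc.le, inner_smul_right, hc.ne']

theorem supportFun_image_act (φ : SL2) (P : Set (E 2)) (u : E 2) :
    supportFun (act φ '' P) (coact φ u) = supportFun P u := by
  simp only [supportFun, Set.image_image, inner_act_coact]

theorem face_image_act (φ : SL2) (P : Set (E 2)) (u : E 2) :
    face (act φ '' P) (coact φ u) = act φ '' face P u := by
  ext y
  simp only [face, Set.mem_ofPred_eq, supportFun_image_act, Set.mem_image]
  constructor
  · rintro ⟨⟨x, hx, rfl⟩, h⟩
    exact ⟨x, ⟨hx, by rw [← h, inner_act_coact]⟩, rfl⟩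
  · rintro ⟨x, ⟨hx, h⟩, rfl⟩
    exact ⟨⟨x, hx, rfl⟩, by rw [inner_act_coact, h]⟩

theorem supportFun_image_unit (φ : SL2) (P : Set (E 2)) {u : E 2} :
    supportFun (act φ '' P) (unit (coact φ u)) = ‖coact φ u‖⁻¹ * supportFun P u := by
  rw [unit, supportFun_smul _ (by positivity), supportFun_image_act]

theorem face_image_unit (φ : SL2) (P : Set (E 2)) {u : E 2} (hu : u ≠ 0) :
    face (act φ '' P) (unit (coact φ u)) = act φ '' face P u := by
  rw [unit, face_smul _ (inv_pos.2 (norm_pos_iff.2 (coact_ne_zero φ hu))), face_image_act]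

theorem isExposed_face {n : ℕ} {P : Set (E n)} (hP : IsCompact P) (u : E n) :
    IsExposed ℝ P (face P u) := by
  intro _
  refine ⟨innerSL ℝ u, ?_⟩
  ext x
  simp only [mem_face_iff hP, Set.mem_ofPred_eq, innerSL_apply_apply, real_inner_comm]

theorem extremePoints_face_subset {n : ℕ} {P : Set (E n)} (hP : IsCompact P) (u : E n) :
    (face P u).extremePoints ℝ ⊆ P.extremePoints ℝ :=
  (isExposed_face hP u).isExtreme.extremePoints_subset_extremePoints

theorem IsPolytope.finite_extremePoints {n : ℕ} {P : Set (E n)} (hP : IsPolytope P) :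
    (P.extremePoints ℝ).Finite := by
  obtain ⟨s, hs, -, rfl⟩ := hP
  exact hs.subset extremePoints_convexHull_subset

theorem IsPolytope.convexHull_extremePoints {n : ℕ} {P : Set (E n)} (hP : IsPolytope P) :
    convexHull ℝ (P.extremePoints ℝ) = P := by
  have := closure_convexHull_extremePoints hP.isCompact hP.convex
  rwa [(Set.Finite.isClosed_convexHull ℝ hP.finite_extremePoints).closure_eq] at this

theorem subset_singleton_of_extremePoints {n : ℕ} {F : Set (E n)} (hF : IsCompact F)
    (hFc : Convex ℝ F) {a : E n} (h : F.extremePoints ℝ ⊆ {a}) : F ⊆ {a} := by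
  rw [← closure_convexHull_extremePoints hF hFc]
  exact closure_minimal ((convexHull_mono h).trans (by rw [convexHull_singleton]))
    isClosed_singleton

end Faces

/-! ### The facet vector -/

section FacetVector

open MeasureTheory

variable {P : Set (E 2)} {ζ : ℝ≥0 → ℝ}

theorem IsCauchySolution.map_zero (hζ : IsCauchySolution ζ) : ζ 0 = 0 := by
  have := hζ 0 0
  rw [add_zero] at this
  linarith

theorem volume_eq_zero_of_inner {S : Set (E 2)} {u : E 2} (hu : u ≠ 0)
    (h : ∀ x ∈ S, inner ℝ x u = 0) : volume S = 0 := by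
  have hne : (ℝ ∙ u)ᗮ ≠ ⊤ := fun htop => hu <| by
    have : u ∈ (ℝ ∙ u)ᗮ := htop ▸ Submodule.mem_top
    rw [Submodule.mem_orthogonal_singleton_iff_inner_right] at this
    exact inner_self_eq_zero.1 this
  refine measure_mono_null (fun x hx => ?_) (Measure.addHaar_submodule volume _ hne)
  rw [SetLike.mem_coe, Submodule.mem_orthogonal_singleton_iff_inner_left]
  exact h x hx

theorem convO_inner_eq_zero {n : ℕ} {F : Set (E n)} {u : E n} (h : ∀ x ∈ F, inner ℝ x u = 0) :
    ∀ x ∈ convO F, inner ℝ x u = 0 := by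
  have hc : Convex ℝ {x : E n | inner ℝ x u = 0} := by
    intro x hx y hy a b _ _ _
    simp only [Set.mem_ofPred_eq] at hx hy ⊢
    simp [inner_add_left, inner_smul_left, hx, hy]
  refine convexHull_min (s := insert 0 F) ?_ hc
  rintro x (rfl | hx)
  exacts [inner_zero_left u, h x hx]

theorem exists_unit_orthogonal (a : E 2) : ∃ u : E 2, ‖u‖ = 1 ∧ inner ℝ a u = 0 := by
  by_cases ha : a = 0
  · exact ⟨!₂[1, 0], by simp [EuclideanSpace.norm_eq], by simp [ha]⟩
  · refine ⟨unit (rot a), norm_unit fun h => ha ?_, ?_⟩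
    · rw [← norm_eq_zero, ← norm_rot, h, norm_zero]
    · rw [unit, inner_smul_right, inner_rot_self, mul_zero]

theorem volume_convO_subset_singleton {F : Set (E 2)} {a : E 2} (h : F ⊆ {a}) :
    volume (convO F) = 0 := by
  obtain ⟨u, hu, hau⟩ := exists_unit_orthogonal a
  refine volume_eq_zero_of_inner (ne_zero_of_norm_eq_one hu) (convO_inner_eq_zero ?_)
  intro x hx
  rw [Set.mem_singleton_iff.1 (h hx), hau]

/-- The contribution of the direction `u` to the facet vector. It vanishes unless `u` is the
normal of an edge whose line avoids the origin: the cone over a single point has no area, and if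
the support number is `0`, the quotient is `0`. -/
def facetTerm (ζ : ℝ≥0 → ℝ) (P : Set (E 2)) (u : E 2) : E 2 :=
  (ζ (coneVolume P u) / |supportFun P u|) • u

theorem coneVolume_ne_zero_of_facetTerm (hζ : IsCauchySolution ζ) {u : E 2}
    (h : facetTerm ζ P u ≠ 0) : volume (convO (face P u)) ≠ 0 := by
  intro h0
  apply h
  rw [facetTerm, coneVolume, h0, ENNReal.toNNReal_zero, hζ.map_zero, zero_div, zero_smul]

theorem exists_pair_of_facetTerm_ne_zero (hζ : IsCauchySolution ζ) (hP : IsPolytope P) {u : E 2}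
    (h : facetTerm ζ P u ≠ 0) : ∃ a ∈ P.extremePoints ℝ, ∃ b ∈ P.extremePoints ℝ,
      a ≠ b ∧ inner ℝ a u = supportFun P u ∧ inner ℝ b u = supportFun P u := by
  have hF := face_isCompact hP.isCompact u
  obtain ⟨a, ha⟩ : ((face P u).extremePoints ℝ).Nonempty :=
    hF.extremePoints_nonempty (face_nonempty hP.isCompact hP.nonempty u)
  obtain ⟨b, hb, hba⟩ : ∃ b ∈ (face P u).extremePoints ℝ, b ≠ a := by
    by_contra! hall
    exact coneVolume_ne_zero_of_facetTerm hζ h (volume_convO_subset_singleton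
      (subset_singleton_of_extremePoints hF (face_convex hP.convex u) hall))
  exact ⟨a, extremePoints_face_subset hP.isCompact u ha, b,
    extremePoints_face_subset hP.isCompact u hb, hba.symm, (extremePoints_subset ha).2,
    (extremePoints_subset hb).2⟩

theorem finite_support_facetTerm (hζ : IsCauchySolution ζ) (hP : IsPolytope P) :
    {u | ‖u‖ = 1 ∧ facetTerm ζ P u ≠ 0}.Finite := by
  have hX := hP.finite_extremePoints
  refine ((hX.prod hX).biUnion' (t := fun p _ =>
    {u : E 2 | p.1 ≠ p.2 ∧ ‖u‖ = 1 ∧ inner ℝ (p.2 - p.1) u = 0}) ?_).subset ?_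
  · rintro ⟨a, b⟩ -
    by_cases hab : a = b
    · simp [hab]
    · exact (finite_unit_orthogonal (sub_ne_zero.2 (Ne.symm hab))).subset fun u hu => hu.2
  · rintro u ⟨hu, hne⟩
    obtain ⟨a, ha, b, hb, hab, hau, hbu⟩ := exists_pair_of_facetTerm_ne_zero hζ hP hne
    simp only [Set.mem_iUnion]
    exact ⟨(a, b), ⟨ha, hb⟩, hab, hu, by rw [inner_sub_left, hau, hbu, sub_self]⟩

theorem inner_eq_of_mem_affineSpan {n : ℕ} {F : Set (E n)} {u x : E n} {h : ℝ}
    (hF : ∀ y ∈ F, inner ℝ y u = h) (hx : x ∈ affineSpan ℝ F) : inner ℝ x u = h := by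
  refine affineSpan_induction hx hF fun c x y z hx hy hz => ?_
  simp [inner_add_left, inner_smul_left, inner_sub_left, hx, hy, hz]

theorem dim_le_one_of_inner_eq {S : Set (E 2)} {u : E 2} {h : ℝ} (hu : ‖u‖ = 1)
    (hS : ∀ x ∈ S, inner ℝ x u = h) : dim S ≤ 1 := by
  have hle : vectorSpan ℝ S ≤ ℝ ∙ rot u := by
    rw [vectorSpan_def, Submodule.span_le]
    rintro _ ⟨x, hx, y, hy, rfl⟩
    rw [SetLike.mem_coe, Submodule.mem_span_singleton]
    refine ⟨_, (eq_smul_rot_of_inner_eq_zero hu ?_).symm⟩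
    simp [inner_sub_left, hS x hx, hS y hy]
  refine (Submodule.finrank_mono hle).trans ?_
  rw [finrank_span_singleton (ne_zero_of_norm_eq_one ((norm_rot u).trans hu))]

theorem dim_eq_zero_iff {n : ℕ} {F : Set (E n)} : dim F = 0 ↔ F.Subsingleton := by
  rw [dim, Submodule.finrank_eq_zero, vectorSpan_eq_bot_iff_subsingleton]

theorem mem_facetNormals_of_volume_ne_zero {u : E 2} (hu : ‖u‖ = 1)
    (hv : volume (convO (face P u)) ≠ 0) : u ∈ facetNormals P := by
  refine ⟨hu, ?_⟩
  have hle : dim (face P u) ≤ 1 := dim_le_one_of_inner_eq hu fun x hx => hx.2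
  have hne : dim (face P u) ≠ 0 := by
    intro h0
    rw [dim_eq_zero_iff] at h0
    apply hv
    rcases (face P u).eq_empty_or_nonempty with he | ⟨a, ha⟩
    · exact volume_convO_subset_singleton (a := 0) (by simp [he])
    · exact volume_convO_subset_singleton (a := a) fun x hx => h0 hx ha
  omega

theorem facetVector_eq_sphereSum (hζ : IsCauchySolution ζ) :
    facetVector ζ P = sphereSum (facetTerm ζ P) := by
  refine finsum_mem_inter_support_eq' _ _ _ fun u hu => ?_
  constructor
  · exact fun h => h.1.1
  · intro hu1
    refine ⟨mem_facetNormals_of_volume_ne_zero hu1 (coneVolume_ne_zero_of_facetTerm hζ hu), ?_⟩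
    rintro ⟨-, h0⟩
    have := inner_eq_of_mem_affineSpan (fun y hy => hy.2) h0
    rw [inner_zero_left] at this
    apply hu
    change facetTerm ζ P u = 0
    rw [facetTerm, ← this, abs_zero, div_zero, zero_smul]

theorem isCompact_convO {n : ℕ} {F : Set (E n)} (hF : IsCompact F) (hc : Convex ℝ F)
    (hne : F.Nonempty) : IsCompact (convO F) := by
  have : convO F = (fun p : ℝ × E n => p.1 • p.2) '' (Set.Icc 0 1 ×ˢ F) := by
    ext x
    rw [mem_convO_iff hc hne]
    constructor
    · rintro ⟨p, hp, t, h0, h1, rfl⟩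
      exact ⟨(t, p), ⟨⟨h0, h1⟩, hp⟩, rfl⟩
    · rintro ⟨⟨t, p⟩, ⟨⟨h0, h1⟩, hp⟩, rfl⟩
      exact ⟨p, hp, t, h0, h1, rfl⟩
  rw [this]
  exact (isCompact_Icc.prod hF).image (by fun_prop)

theorem facetVector_isValuation (hζ : IsCauchySolution ζ) :
    IsValuation fun P : Polytope 2 => facetVector ζ P.1 := by
  intro P Q U I hU hI
  have hUc : Convex ℝ (P.1 ∪ Q.1) := hU ▸ U.2.convex
  simp only [facetVector_eq_sphereSum hζ]
  rw [← sphereSum_add (finite_support_facetTerm hζ P.2) (finite_support_facetTerm hζ Q.2),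
    ← sphereSum_add (finite_support_facetTerm hζ U.2) (finite_support_facetTerm hζ I.2), hU, hI]
  refine sphereSum_congr fun u _ => ?_
  refine add_of_face_add
    (fun h F => (ζ (volume (convO F)).toNNReal / |h|) • u) u ?_ P.2 Q.2 hUc
  intro h F₁ F₂ hF₁ hF₂ hn₁ hn₂ hc₁ hc₂ hc _
  have hK₁ := isCompact_convO hF₁ hc₁ hn₁
  have hK₂ := isCompact_convO hF₂ hc₂ hn₂
  have hU : convO (F₁ ∪ F₂) = convO F₁ ∪ convO F₂ :=
    convexHull_insert_union hc₁ hc₂ hn₁ hn₂ hc 0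
  have hI : convO (F₁ ∩ F₂) = convO F₁ ∩ convO F₂ :=
    convexHull_insert_inter hc₁ hc₂ hF₁.isClosed hF₂.isClosed hn₁ hn₂ hc 0
  have hvol : volume (convO (F₁ ∪ F₂)) + volume (convO (F₁ ∩ F₂)) =
      volume (convO F₁) + volume (convO F₂) := by
    rw [hU, hI, measure_union_add_inter _ hK₂.measurableSet]
  have h1 := hK₁.measure_lt_top (μ := volume) |>.ne
  have h2 := hK₂.measure_lt_top (μ := volume) |>.ne
  have h3 : volume (convO (F₁ ∪ F₂)) ≠ ⊤ := hU ▸ (hK₁.union hK₂).measure_lt_top.ne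
  have h4 : volume (convO (F₁ ∩ F₂)) ≠ ⊤ :=
    hI ▸ (hK₁.inter_right hK₂.isClosed).measure_lt_top.ne
  rw [← add_smul, ← add_smul, ← add_div, ← add_div, ← hζ, ← hζ, ← ENNReal.toNNReal_add h1 h2,
    ← ENNReal.toNNReal_add h3 h4, hvol]

theorem det_act (φ : SL2) : LinearMap.det (act φ) = 1 := by
  rw [act, Matrix.toEuclideanLin_eq_toLin_orthonormal, LinearMap.det_toLin, φ.2]

theorem volume_image_act (φ : SL2) (S : Set (E 2)) : volume (act φ '' S) = volume S := by
  rw [Measure.addHaar_image_linearMap, det_act]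
  simp

theorem facetVector_isSLContravariant (hζ : IsCauchySolution ζ) :
    IsSLContravariant fun P : Polytope 2 => facetVector ζ P.1 := by
  intro φ P
  simp only [facetVector_eq_sphereSum hζ]
  refine sphereSum_coact φ (coact φ) (finite_support_facetTerm hζ P.2) fun u hu => ?_
  have hu0 := ne_zero_of_norm_eq_one hu
  have hpos : 0 < ‖coact φ u‖ := norm_pos_iff.2 (coact_ne_zero φ hu0)
  change facetTerm ζ (act φ '' P.1) _ = _
  rw [facetTerm, facetTerm, coneVolume, coneVolume, face_image_unit φ P.1 hu0, image_convO,
    volume_image_act, supportFun_image_unit, map_smul, unit, smul_smul, abs_mul, abs_inv,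
    abs_norm]
  congr 1
  field_simp

end FacetVector

/-! ### The moment vector -/

section MomentVector

open MeasureTheory

theorem integrableOn_id {P : Set (E 2)} (hP : IsCompact P) :
    IntegrableOn (fun x : E 2 => x) P volume :=
  continuous_id.continuousOn.integrableOn_compact hP

theorem momentVector_isValuation : IsValuation fun P : Polytope 2 => rot (momentVector P.1) := by
  intro P Q U I hU hI
  simp only [momentVector]
  have hP := integrableOn_id P.2.isCompact
  have hQ := integrableOn_id Q.2.isCompact
  have hPm := P.2.isCompact.measurableSet
  have hQm := Q.2.isCompact.measurableSet
  rw [← rot_add, ← rot_add, hU, hI, ← Set.union_sdiff_self,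
    setIntegral_union Set.disjoint_sdiff_right (hQm.diff hPm) hP (hQ.mono_set Set.sdiff_subset),
    ← integral_inter_add_sdiff hPm hQ, Set.inter_comm P.1]
  congr 1
  abel

theorem momentVector_image (f : E 2 →ₗ[ℝ] E 2) (hf : LinearMap.det f ≠ 0) {P : Set (E 2)}
    (hP : IsCompact P) : momentVector (f '' P) = |LinearMap.det f| • f (momentVector P) := by
  let g : E 2 →L[ℝ] E 2 := LinearMap.toContinuousLinearMap f
  have hinj : Function.Injective f := (LinearEquiv.ofIsUnitDet
    (v := (EuclideanSpace.basisFun (Fin 2) ℝ).toBasis)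
    (v' := (EuclideanSpace.basisFun (Fin 2) ℝ).toBasis)
    (f := f) (by simpa using hf)).injective
  have h := integral_image_eq_integral_abs_det_fderiv_smul volume hP.measurableSet
    (fun x _ => g.hasFDerivWithinAt (x := x) (s := P)) hinj.injOn fun x => x
  have h2 : ∫ x in P, g x = g (∫ x in P, x) := g.integral_comp_comm (integrableOn_id hP)
  change ∫ x in g '' P, x = |LinearMap.det f| • g (∫ x in P, x)
  rw [h, integral_smul, h2]
  rfl

theorem momentVector_isSLContravariant :
    IsSLContravariant fun P : Polytope 2 => rot (momentVector P.1) := by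
  intro φ P
  change rot (momentVector (act φ '' P.1)) = coact φ (rot _)
  rw [momentVector_image _ (by simp) P.2.isCompact, det_act, abs_one, one_smul, coact_rot]

end MomentVector

/-! ### The edges on lines through the origin -/

section EdgeSum

variable {P : Set (E 2)}

/-- The contribution of the direction `u`: if the supporting line of `P` with outer normal `u`
passes through the origin, it is the sum of the two endpoints of the face `F(P, u)` (twice the
point, if the face is a single point), and otherwise it is `0`. -/
def edgeTerm (P : Set (E 2)) (u : E 2) : E 2 :=
  if supportFun P u = 0 then
    (supportFun (face P u) (rot u) - supportFun (face P u) (-rot u)) • rot u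
  else 0

/-- The sum of the endpoints of all faces of `P` on supporting lines through the origin. -/
def edgeSum (P : Set (E 2)) : E 2 := sphereSum (edgeTerm P)

theorem supportFun_segment {n : ℕ} (a b u : E n) :
    supportFun (segment ℝ a b) u = max (inner ℝ a u) (inner ℝ b u) := by
  have key : ∀ y ∈ segment ℝ a b, inner ℝ y u ≤ max (inner ℝ a u) (inner ℝ b u : ℝ) := by
    rintro y ⟨s, t, hs, ht, hst, rfl⟩
    rw [inner_add_left, inner_smul_left, inner_smul_left]
    simp only [conj_trivial]
    have h1 := mul_le_mul_of_nonneg_left (le_max_left (inner ℝ a u) (inner ℝ b u : ℝ)) hs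
    have h2 := mul_le_mul_of_nonneg_left (le_max_right (inner ℝ a u) (inner ℝ b u : ℝ)) ht
    refine (add_le_add h1 h2).trans ?_
    rw [← add_mul, hst, one_mul]
  rcases le_total (inner ℝ a u : ℝ) (inner ℝ b u) with h | h
  · rw [max_eq_right h] at key ⊢
    exact supportFun_eq (right_mem_segment ℝ a b) key
  · rw [max_eq_left h] at key ⊢
    exact supportFun_eq (left_mem_segment ℝ a b) key

theorem edgeTerm_eq_add {a b u : E 2} (hu : ‖u‖ = 1) (h : supportFun P u = 0)
    (hF : face P u = segment ℝ a b) : edgeTerm P u = a + b := by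
  have ha : a ∈ face P u := hF ▸ left_mem_segment ℝ a b
  have hb : b ∈ face P u := hF ▸ right_mem_segment ℝ a b
  rw [edgeTerm, if_pos h, hF, supportFun_segment, supportFun_segment, inner_neg_right,
    inner_neg_right, max_neg_neg, sub_neg_eq_add, max_add_min, add_smul,
    ← eq_smul_rot_of_inner_eq_zero hu (ha.2.trans h),
    ← eq_smul_rot_of_inner_eq_zero hu (hb.2.trans h)]

theorem edgeTerm_eq_zero_of_ne {u : E 2} (h : supportFun P u ≠ 0) : edgeTerm P u = 0 := if_neg h

theorem edgeTerm_eq_zero_of_face {u : E 2} (hu : ‖u‖ = 1) (h : face P u = {0}) :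
    edgeTerm P u = 0 := by
  have h0 : (0 : E 2) ∈ face P u := h ▸ rfl
  have hs : supportFun P u = 0 := by rw [← h0.2, inner_zero_left]
  rw [edgeTerm_eq_add hu hs (h.trans (segment_same ℝ 0).symm), add_zero]

theorem exists_eq_segment {F : Set (E 2)} {u : E 2} (hu : ‖u‖ = 1) (hF : IsCompact F)
    (hc : Convex ℝ F) (hne : F.Nonempty) (h : ∀ x ∈ F, inner ℝ x u = 0) :
    ∃ a b, F = segment ℝ a b := by
  obtain ⟨a, ha, hmin⟩ := hF.exists_isMinOn hne (f := fun x => inner ℝ x (rot u)) (by fun_prop)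
  obtain ⟨b, hb, hmax⟩ := hF.exists_isMaxOn hne (f := fun x => inner ℝ x (rot u)) (by fun_prop)
  refine ⟨a, b, Set.Subset.antisymm (fun x hx => ?_) (hc.segment_subset ha hb)⟩
  have hx' : (inner ℝ x (rot u) : ℝ) ∈ segment ℝ (inner ℝ a (rot u)) (inner ℝ b (rot u)) := by
    rw [segment_eq_Icc ((hmin hx).trans (hmax hx))]
    exact ⟨hmin hx, hmax hx⟩
  obtain ⟨s, t, hs, ht, hst, hxe⟩ := hx'
  refine ⟨s, t, hs, ht, hst, ?_⟩
  rw [eq_smul_rot_of_inner_eq_zero hu (h x hx), ← hxe, add_smul, smul_eq_mul, smul_eq_mul,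
    mul_smul, mul_smul, ← eq_smul_rot_of_inner_eq_zero hu (h a ha),
    ← eq_smul_rot_of_inner_eq_zero hu (h b hb)]

theorem IsPolytope.exists_face_eq_segment (hP : IsPolytope P) {u : E 2} (hu : ‖u‖ = 1)
    (h : supportFun P u = 0) : ∃ a b, face P u = segment ℝ a b :=
  exists_eq_segment hu (face_isCompact hP.isCompact u) (face_convex hP.convex u)
    (face_nonempty hP.isCompact hP.nonempty u) fun _ hx => hx.2.trans h

theorem finite_support_edgeTerm (hP : IsPolytope P) :
    {u | ‖u‖ = 1 ∧ edgeTerm P u ≠ 0}.Finite := by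
  refine (hP.finite_extremePoints.biUnion' (t := fun a _ =>
    {u : E 2 | a ≠ 0 ∧ ‖u‖ = 1 ∧ inner ℝ a u = 0}) ?_).subset ?_
  · rintro a -
    by_cases ha : a = 0
    · simp [ha]
    · exact (finite_unit_orthogonal ha).subset fun u hu => hu.2
  · rintro u ⟨hu, hne⟩
    have hF := face_isCompact hP.isCompact u
    have hFn := face_nonempty hP.isCompact hP.nonempty u
    obtain ⟨a, ha, ha0⟩ : ∃ a ∈ (face P u).extremePoints ℝ, a ≠ 0 := by
      by_contra! hall
      exact hne (edgeTerm_eq_zero_of_face hu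
        ((subset_singleton_of_extremePoints hF (face_convex hP.convex u) hall).antisymm
          (by
            obtain ⟨b, hb⟩ := hFn
            have := subset_singleton_of_extremePoints hF (face_convex hP.convex u) hall hb
            rw [Set.mem_singleton_iff] at this
            simpa [this] using hb)))
    have hs : supportFun P u = 0 := by
      by_contra hs
      exact hne (edgeTerm_eq_zero_of_ne hs)
    simp only [Set.mem_iUnion]
    exact ⟨a, extremePoints_face_subset hP.isCompact u ha, ha0, hu,
      (extremePoints_subset ha).2.trans hs⟩

theorem edgeSum_isValuation : IsValuation fun P : Polytope 2 => rot (edgeSum P.1) := by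
  intro P Q U I hU hI
  have hUc : Convex ℝ (P.1 ∪ Q.1) := hU ▸ U.2.convex
  simp only [edgeSum]
  rw [← rot_add, ← rot_add,
    ← sphereSum_add (finite_support_edgeTerm P.2) (finite_support_edgeTerm Q.2),
    ← sphereSum_add (finite_support_edgeTerm U.2) (finite_support_edgeTerm I.2), hU, hI]
  congr 1
  refine sphereSum_congr fun u _ => ?_
  refine add_of_face_add (fun h F => if h = 0 then
    (supportFun F (rot u) - supportFun F (-rot u)) • rot u else 0) u ?_ P.2 Q.2 hUc
  intro h F₁ F₂ hF₁ hF₂ hn₁ hn₂ _ _ hc _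
  split_ifs
  · rw [← add_smul, ← add_smul]
    simp only [supportFun_union hF₁ hF₂ hn₁ hn₂, supportFun_inter hF₁ hF₂ hn₁ hn₂ hc]
    congr 1
    linarith [max_add_min (supportFun F₁ (rot u)) (supportFun F₂ (rot u)),
      max_add_min (supportFun F₁ (-rot u)) (supportFun F₂ (-rot u))]
  · rfl

theorem edgeSum_isSLContravariant :
    IsSLContravariant fun P : Polytope 2 => rot (edgeSum P.1) := by
  intro φ P
  change rot (edgeSum (act φ '' P.1)) = coact φ (rot (edgeSum P.1))
  rw [coact_rot]
  congr 1
  refine sphereSum_coact φ (act φ) (finite_support_edgeTerm P.2) fun u hu => ?_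
  have hu0 := ne_zero_of_norm_eq_one hu
  have hpos : 0 < ‖coact φ u‖ := norm_pos_iff.2 (coact_ne_zero φ hu0)
  by_cases hs : supportFun P.1 u = 0
  · obtain ⟨a, b, hab⟩ := P.2.exists_face_eq_segment hu hs
    rw [edgeTerm_eq_add hu hs hab, edgeTerm_eq_add (a := act φ a) (b := act φ b)
      (norm_unit (coact_ne_zero φ hu0)), map_add]
    · rw [supportFun_image_unit, hs, mul_zero]
    · rw [face_image_unit φ P.1 hu0, hab]
      exact image_segment ℝ (act φ).toAffineMap a b
  · rw [edgeTerm_eq_zero_of_ne hs, edgeTerm_eq_zero_of_ne, map_zero]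
    rw [supportFun_image_unit]
    exact mul_ne_zero (inv_ne_zero hpos.ne') hs

end EdgeSum

/-! ### The vector `e(P)` as a sum over directions -/

section EVector

variable {P K : Set (E 2)}

theorem supportFun_eq_zero_iff {n : ℕ} {K : Set (E n)} (hK : IsCompact K) (h0 : (0 : E n) ∈ K)
    {u : E n} : supportFun K u = 0 ↔ ∀ x ∈ K, inner ℝ x u ≤ 0 := by
  constructor
  · intro h x hx
    exact h ▸ inner_le_supportFun hK hx u
  · intro h
    rw [supportFun_eq h0 (by simpa using h), inner_zero_left]

theorem unit_ne_neg {u : E 2} (hu : ‖u‖ = 1) : u ≠ -u := fun h =>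
  ne_zero_of_norm_eq_one hu <| by
    have h2 : (2 : ℝ) • u = 0 := by
      rw [two_smul]
      nth_rewrite 2 [h]
      rw [add_neg_cancel]
    exact (smul_eq_zero.1 h2).resolve_left two_ne_zero

theorem eq_cross_smul_add {a b : E 2} (h : cross a b ≠ 0) (x : E 2) :
    x = (cross x b / cross a b) • a + (cross a x / cross a b) • b := by
  apply E2_ext
  · simp only [PiLp.add_apply, PiLp.smul_apply, smul_eq_mul]
    field_simp
    simp only [cross]; ring
  · simp only [PiLp.add_apply, PiLp.smul_apply, smul_eq_mul]
    field_simp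
    simp only [cross]; ring

theorem eq_zero_of_inner_eq_zero {a b x : E 2} (h : cross a b ≠ 0) (ha : inner ℝ x a = 0)
    (hb : inner ℝ x b = 0) : x = 0 := by
  have : (inner ℝ x x : ℝ) = 0 := by
    nth_rewrite 2 [eq_cross_smul_add h x]
    rw [inner_add_right, inner_smul_right, inner_smul_right, ha, hb]
    simp
  exact inner_self_eq_zero.1 this

theorem eq_or_eq_neg_of_cross_eq_zero {u v : E 2} (hu : ‖u‖ = 1) (hv : ‖v‖ = 1)
    (h : cross u v = 0) : v = u ∨ v = -u := by
  have h1 := eq_smul_rot_of_inner_eq_zero (u := rot u) (x := v) ((norm_rot u).trans hu)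
    (by rw [← cross_eq_inner_rot, h])
  rw [rot_rot] at h1
  set c : ℝ := inner ℝ v (-u)
  have h2 : |c| = 1 := by
    have := congrArg norm h1
    rwa [hv, norm_smul, norm_neg, hu, mul_one, eq_comm] at this
  rcases eq_or_eq_neg_of_abs_eq h2 with h3 | h3
  · right; rw [h1, h3, one_smul]
  · left; rw [h1, h3, neg_smul, one_smul, neg_neg]

theorem sphereSum_eq_single {T : E 2 → E 2} {u : E 2} (hu : ‖u‖ = 1)
    (h : ∀ v, ‖v‖ = 1 → v ≠ u → T v = 0) : sphereSum T = T u := by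
  have : sphereSum T = ∑ᶠ v ∈ ({u} : Set (E 2)), T v := by
    refine finsum_mem_inter_support_eq' _ _ _ fun v hv => ⟨fun hv1 => ?_, ?_⟩
    · by_contra hne
      exact hv (h v hv1 hne)
    · rintro rfl
      exact hu
  rw [this, finsum_mem_singleton]

theorem sphereSum_eq_pair {T : E 2 → E 2} {u u' : E 2} (hu : ‖u‖ = 1) (hu' : ‖u'‖ = 1)
    (hne : u ≠ u') (h : ∀ v, ‖v‖ = 1 → v ≠ u → v ≠ u' → T v = 0) :
    sphereSum T = T u + T u' := by
  have : sphereSum T = ∑ᶠ v ∈ ({u, u'} : Set (E 2)), T v := by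
    refine finsum_mem_inter_support_eq' _ _ _ fun v hv => ⟨fun hv1 => ?_, ?_⟩
    · by_contra hne
      rw [Set.mem_insert_iff, Set.mem_singleton_iff, not_or] at hne
      exact hv (h v hv1 hne.1 hne.2)
    · rintro (rfl | rfl)
      exacts [hu, hu']
  rw [this, finsum_mem_pair hne]

theorem edgeTerm_eq_zero_of_forall (hK : IsCompact K) (h0 : (0 : E 2) ∈ K) {u : E 2}
    (hu : ‖u‖ = 1) (h : (∀ x ∈ K, inner ℝ x u ≤ 0) → ∀ x ∈ K, inner ℝ x u = 0 → x = 0) :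
    edgeTerm K u = 0 := by
  by_cases hs : supportFun K u = 0
  · refine edgeTerm_eq_zero_of_face hu (Set.Subset.antisymm ?_ ?_)
    · exact fun x hx => h ((supportFun_eq_zero_iff hK h0).1 hs) x hx.1 (hx.2.trans hs)
    · rintro _ rfl
      exact ⟨h0, by rw [hs, inner_zero_left]⟩
  · exact edgeTerm_eq_zero_of_ne hs

/-- The outer unit normal of an edge that contains the origin. -/
theorem IsEdge.exists_normal {F : Set (E 2)} (hK : IsCompact K) (hd : dim K = 2) (hF : IsEdge K F)
    (h0 : (0 : E 2) ∈ F) : ∃ u, ‖u‖ = 1 ∧ supportFun K u = 0 ∧ face K u = F := by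
  obtain ⟨l, hl⟩ := hF.1 ⟨0, h0⟩
  set m : E 2 := (InnerProductSpace.toDual ℝ (E 2)).symm l
  have hlm : ∀ x, l x = inner ℝ x m := fun x => by
    rw [real_inner_comm, InnerProductSpace.toDual_symm_apply]
  have hm : m ≠ 0 := by
    intro hm
    have hKF : F = K := by
      rw [hl]; ext x; simp [hlm, hm]
    have := hF.2
    rw [hKF, hd] at this
    omega
  have hface : face K m = F := by
    ext x
    rw [mem_face_iff hK, hl]
    simp [hlm]
  have hu : face K (unit m) = F := by
    rw [unit, face_smul _ (inv_pos.2 (norm_pos_iff.2 hm)), hface]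
  refine ⟨unit m, norm_unit hm, ?_, hu⟩
  rw [← hu] at h0
  rw [← h0.2, inner_zero_left]

theorem dim_segment {n : ℕ} {a b : E n} (h : a ≠ b) : dim (segment ℝ a b) = 1 := by
  rw [dim, vectorSpan_segment, vsub_eq_sub, finrank_span_singleton (sub_ne_zero.2 h.symm)]

theorem ne_of_dim_segment {n : ℕ} {a b : E n} (h : dim (segment ℝ a b) = 1) : a ≠ b := by
  rintro rfl
  rw [segment_same, dim_eq_zero_iff.2 Set.subsingleton_singleton] at h
  omega

theorem exists_inner_neg {u : E 2} (hu : ‖u‖ = 1) (hd : dim K = 2)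
    (h : ∀ x ∈ K, inner ℝ x u ≤ 0) : ∃ x ∈ K, inner ℝ x u < 0 := by
  by_contra! hcon
  have := dim_le_one_of_inner_eq hu fun x hx => le_antisymm (h x hx) (hcon x hx)
  omega

/-- Two edges `[o, v]` and `[o, w]` at the origin: every other supporting line at the origin meets
the polytope in the origin only, as its normal is in the interior of the normal cone. -/
theorem edgeSum_of_two_edges (hK : IsCompact K) (h0 : (0 : E 2) ∈ K) (hd : dim K = 2) {v w : E 2}
    (hvw : v ≠ w) (hv : IsEdge K (segment ℝ 0 v)) (hw : IsEdge K (segment ℝ 0 w)) :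
    edgeSum K = v + w := by
  have hv0 : v ≠ 0 := (ne_of_dim_segment hv.2).symm
  have hw0 : w ≠ 0 := (ne_of_dim_segment hw.2).symm
  obtain ⟨n₁, hn₁, hs₁, hF₁⟩ := hv.exists_normal hK hd (left_mem_segment ℝ 0 v)
  obtain ⟨n₂, hn₂, hs₂, hF₂⟩ := hw.exists_normal hK hd (left_mem_segment ℝ 0 w)
  have hK₁ := (supportFun_eq_zero_iff hK h0).1 hs₁
  have hK₂ := (supportFun_eq_zero_iff hK h0).1 hs₂
  have hvF : v ∈ face K n₁ := hF₁ ▸ right_mem_segment ℝ 0 v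
  have hwF : w ∈ face K n₂ := hF₂ ▸ right_mem_segment ℝ 0 w
  have hv1 : inner ℝ v n₁ = 0 := hvF.2.trans hs₁
  have hw2 : inner ℝ w n₂ = 0 := hwF.2.trans hs₂
  have hne : n₁ ≠ n₂ := by
    rintro rfl
    have hseg : segment ℝ 0 v = segment ℝ 0 w := hF₁.symm.trans hF₂
    have h1 := edgeTerm_eq_add hn₁ hs₁ hF₁
    have h2 := edgeTerm_eq_add hn₁ hs₁ hF₂
    rw [zero_add] at h1 h2
    exact hvw (h1.symm.trans h2)
  have hcross : cross n₁ n₂ ≠ 0 := by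
    intro hc
    rcases eq_or_eq_neg_of_cross_eq_zero hn₁ hn₂ hc with h | h
    · exact hne h.symm
    · obtain ⟨x, hx, hx1⟩ := exists_inner_neg hn₁ hd hK₁
      have := hK₂ x hx
      rw [h, inner_neg_right] at this
      linarith
  have hv2 : (inner ℝ v n₂ : ℝ) < 0 :=
    (hK₂ v hvF.1).lt_of_ne fun h => hv0 (eq_zero_of_inner_eq_zero hcross hv1 h)
  have hw1 : (inner ℝ w n₁ : ℝ) < 0 :=
    (hK₁ w hwF.1).lt_of_ne fun h => hw0 (eq_zero_of_inner_eq_zero hcross h hw2)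
  rw [edgeSum, sphereSum_eq_pair hn₁ hn₂ hne, edgeTerm_eq_add hn₁ hs₁ hF₁,
    edgeTerm_eq_add hn₂ hs₂ hF₂, zero_add, zero_add]
  intro u hu hu1 hu2
  refine edgeTerm_eq_zero_of_forall hK h0 hu fun hle x hx hxu => ?_
  have hue := eq_cross_smul_add hcross u
  set α := cross u n₂ / cross n₁ n₂
  set β := cross n₁ u / cross n₁ n₂
  have hunit : ∀ (c : ℝ) (n : E 2), 0 ≤ c → ‖n‖ = 1 → u = c • n → u = n := by
    intro c n hc hn h
    have h3 := congrArg norm h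
    rw [hu, norm_smul, hn, mul_one, Real.norm_of_nonneg hc] at h3
    rw [h, ← h3, one_smul]
  have hβ : 0 ≤ β := by
    have := hle v hvF.1
    rw [hue, inner_add_right, inner_smul_right, inner_smul_right, hv1] at this
    nlinarith
  have hα : 0 ≤ α := by
    have := hle w hwF.1
    rw [hue, inner_add_right, inner_smul_right, inner_smul_right, hw2] at this
    nlinarith
  have hα' : 0 < α := hα.lt_of_ne fun h => hu2 <| hunit β n₂ hβ hn₂ <| by
    rw [hue, ← h, zero_smul, zero_add]
  have hβ' : 0 < β := hβ.lt_of_ne fun h => hu1 <| hunit α n₁ hα hn₁ <| by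
    rw [hue, ← h, zero_smul, add_zero]
  rw [hue, inner_add_right, inner_smul_right, inner_smul_right] at hxu
  have hx1 := hK₁ x hx
  have hx2 := hK₂ x hx
  have h1 := mul_nonpos_of_nonneg_of_nonpos hα hx1
  have h2 := mul_nonpos_of_nonneg_of_nonpos hβ hx2
  refine eq_zero_of_inner_eq_zero hcross ?_ ?_
  · exact (mul_eq_zero.1 (by linarith : α * inner ℝ x n₁ = 0)).resolve_left hα'.ne'
  · exact (mul_eq_zero.1 (by linarith : β * inner ℝ x n₂ = 0)).resolve_left hβ'.ne'

theorem inner_eq_zero_of_zero_mem_openSegment {n : ℕ} {a b u : E n}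
    (h : (0 : E n) ∈ openSegment ℝ a b) (ha : inner ℝ a u ≤ 0) (hb : inner ℝ b u ≤ 0) :
    inner ℝ a u = 0 ∧ inner ℝ b u = 0 := by
  obtain ⟨s, t, hs, ht, -, hst⟩ := h
  have := congrArg (fun x => (inner ℝ x u : ℝ)) hst
  simp only [inner_add_left, inner_smul_left, inner_zero_left, conj_trivial] at this
  constructor
  · nlinarith
  · nlinarith

theorem edgeSum_of_edge (hK : IsCompact K) (h0 : (0 : E 2) ∈ K) (hd : dim K = 2) {v w : E 2}
    (hvw : IsEdge K (segment ℝ v w)) (h0' : (0 : E 2) ∈ openSegment ℝ v w) :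
    edgeSum K = v + w := by
  have hne := ne_of_dim_segment hvw.2
  obtain ⟨n, hn, hs, hF⟩ := hvw.exists_normal hK hd (openSegment_subset_segment ℝ v w h0')
  have hKn := (supportFun_eq_zero_iff hK h0).1 hs
  have hvF : v ∈ face K n := hF ▸ left_mem_segment ℝ v w
  have hwF : w ∈ face K n := hF ▸ right_mem_segment ℝ v w
  have hv0 : v ≠ 0 := by
    rintro rfl
    obtain ⟨s, t, -, ht, -, hst⟩ := h0'
    rw [smul_zero, zero_add, smul_eq_zero] at hst
    exact hne (hst.resolve_left ht.ne').symm
  rw [edgeSum, sphereSum_eq_single hn, edgeTerm_eq_add hn hs hF]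
  intro u hu hun
  refine edgeTerm_eq_zero_of_forall hK h0 hu fun hle => ?_
  obtain ⟨h1, -⟩ := inner_eq_zero_of_zero_mem_openSegment h0' (hle v hvF.1) (hle w hwF.1)
  exfalso
  have hc : cross n u = 0 := by
    by_contra hc
    exact hv0 (eq_zero_of_inner_eq_zero hc (hvF.2.trans hs) h1)
  rcases eq_or_eq_neg_of_cross_eq_zero hn hu hc with rfl | rfl
  · exact hun rfl
  · obtain ⟨x, hx, hxn⟩ := exists_inner_neg hn hd hKn
    have := hle x hx
    rw [inner_neg_right] at this
    linarith

theorem edgeSum_of_segment {v w : E 2} (h0 : (0 : E 2) ∈ segment ℝ v w) :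
    edgeSum (segment ℝ v w) = (2 : ℝ) • (v + w) := by
  have hK : IsCompact (segment ℝ v w) := by
    rw [← convexHull_pair]
    exact Set.Finite.isCompact_convexHull ℝ (Set.toFinite _)
  obtain ⟨n, hn, hwn⟩ := exists_unit_orthogonal (w - v)
  obtain ⟨s, t, -, -, hst, hz⟩ := id h0
  have hvw : inner ℝ w n = (inner ℝ v n : ℝ) := by
    rwa [inner_sub_left, sub_eq_zero] at hwn
  have hv : inner ℝ v n = (0 : ℝ) := by
    have := congrArg (fun x => (inner ℝ x n : ℝ)) hz
    simp only [inner_add_left, inner_smul_left, inner_zero_left, conj_trivial, hvw] at this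
    rwa [← add_mul, hst, one_mul] at this
  have hall : ∀ x ∈ segment ℝ v w, inner ℝ x n = (0 : ℝ) := by
    rintro _ ⟨a, b, -, -, -, rfl⟩
    simp [inner_add_left, inner_smul_left, hvw, hv]
  have hs : supportFun (segment ℝ v w) n = 0 :=
    (supportFun_eq_zero_iff hK h0).2 fun x hx => (hall x hx).le
  have hs' : supportFun (segment ℝ v w) (-n) = 0 :=
    (supportFun_eq_zero_iff hK h0).2 fun x hx => by rw [inner_neg_right, hall x hx, neg_zero]
  have hF : face (segment ℝ v w) n = segment ℝ v w := by
    ext x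
    simp only [face, hs, Set.mem_ofPred_eq, and_iff_left_iff_imp]
    exact hall x
  have hF' : face (segment ℝ v w) (-n) = segment ℝ v w := by
    ext x
    simp only [face, hs', Set.mem_ofPred_eq, and_iff_left_iff_imp, inner_neg_right, neg_eq_zero]
    exact hall x
  have hn' : ‖-n‖ = 1 := by rw [norm_neg, hn]
  rw [edgeSum, sphereSum_eq_pair hn hn' (unit_ne_neg hn), edgeTerm_eq_add hn hs hF,
    edgeTerm_eq_add hn' hs' hF', two_smul]
  intro u hu h1 h2
  refine edgeTerm_eq_zero_of_forall hK h0 hu fun _ x hx hxu => ?_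
  refine eq_zero_of_inner_eq_zero (fun hc => ?_) (hall x hx) hxu
  rcases eq_or_eq_neg_of_cross_eq_zero hn hu hc with h | h
  exacts [h1 h, h2 h]

theorem exists_of_zero_mem_segment {a b : E 2} (h : (0 : E 2) ∈ segment ℝ a b)
    (h' : (0 : E 2) ∉ openSegment ℝ a b) : ∃ v, segment ℝ a b = segment ℝ 0 v ∧ a + b = v := by
  rw [← insert_endpoints_openSegment] at h
  rcases h with h | h | h
  · exact ⟨b, by rw [← h], by rw [← h, zero_add]⟩
  · exact ⟨a, by rw [← h, segment_symm], by rw [← h, add_zero]⟩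
  · exact absurd h h'

theorem isEdge_of_face (hK : IsCompact K) {u a b : E 2} (hF : face K u = segment ℝ a b)
    (hab : a ≠ b) : IsEdge K (segment ℝ a b) :=
  ⟨hF ▸ isExposed_face hK u, dim_segment hab⟩

theorem IsPolytope.inner_nonpos_of_extremePoints (hK : IsPolytope K) {u : E 2}
    (h : ∀ x ∈ K.extremePoints ℝ, inner ℝ x u ≤ 0) : ∀ x ∈ K, inner ℝ x u ≤ 0 := by
  have hc : Convex ℝ {x : E 2 | inner ℝ x u ≤ 0} := by
    intro x hx y hy a b ha hb _
    simp only [Set.mem_ofPred_eq] at hx hy ⊢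
    simp only [inner_add_left, inner_smul_left, conj_trivial]
    exact add_nonpos (mul_nonpos_of_nonneg_of_nonpos ha hx) (mul_nonpos_of_nonneg_of_nonpos hb hy)
  intro x hx
  rw [← hK.convexHull_extremePoints] at hx
  exact convexHull_min (s := K.extremePoints ℝ) h hc hx

/-- If `[o, v]` is an edge of a polygon, the polygon has a second edge `[o, w]` at the origin. It is
found by turning the supporting line of the first edge about the origin until it hits a vertex. -/
theorem exists_second_edge (hK : IsPolytope K) (h0 : (0 : E 2) ∈ K) (hd : dim K = 2) {u v : E 2}
    (hu : ‖u‖ = 1) (hs : supportFun K u = 0) (hF : face K u = segment ℝ 0 v) (hv : v ≠ 0) :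
    ∃ w, v ≠ w ∧ IsEdge K (segment ℝ 0 w) := by
  have hKu := (supportFun_eq_zero_iff hK.isCompact h0).1 hs
  have hvF : v ∈ face K u := hF ▸ right_mem_segment ℝ 0 v
  have hvu : inner ℝ v u = (0 : ℝ) := hvF.2.trans hs
  set X : Set (E 2) := {x ∈ K.extremePoints ℝ | (inner ℝ x u : ℝ) < 0}
  have hXne : X.Nonempty := by
    by_contra! hX
    obtain ⟨x, hx, hxu⟩ := exists_inner_neg hu hd hKu
    have := hK.inner_nonpos_of_extremePoints (u := -u) (fun y hy => by
      rw [inner_neg_right, neg_nonpos]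
      by_contra! hlt
      have : y ∈ X := ⟨hy, hlt⟩
      rw [hX] at this
      exact this) x hx
    rw [inner_neg_right] at this
    linarith
  have hXfin : X.Finite := hK.finite_extremePoints.subset fun x hx => hx.1
  obtain ⟨x₀, hx₀, hmax⟩ := Set.exists_max_image X
    (fun x => (inner ℝ x v : ℝ) / inner ℝ x u) hXfin hXne
  set M : ℝ := inner ℝ x₀ v / inner ℝ x₀ u with hM
  set m : E 2 := M • u - v with hm
  have hm_inner : ∀ x : E 2, inner ℝ x m = M * inner ℝ x u - (inner ℝ x v : ℝ) := fun x => by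
    rw [hm, inner_sub_right, inner_smul_right]
  have hm0 : m ≠ 0 := by
    intro h
    have h1 := hm_inner v
    rw [h, inner_zero_right, hvu, mul_zero, zero_sub, eq_comm, neg_eq_zero] at h1
    exact hv (inner_self_eq_zero.1 h1)
  have hx₀m : inner ℝ x₀ m = (0 : ℝ) := by
    rw [hm_inner, hM, div_mul_cancel₀ _ hx₀.2.ne, sub_self]
  have hKm : ∀ x ∈ K, inner ℝ x m ≤ 0 := by
    refine hK.inner_nonpos_of_extremePoints fun x hx => ?_
    have hxK := extremePoints_subset hx
    rw [hm_inner]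
    rcases (hKu x hxK).lt_or_eq with hlt | heq
    · have := hmax x ⟨hx, hlt⟩
      rw [div_le_iff_of_neg hlt] at this
      linarith
    · have hxF : x ∈ face K u := ⟨hxK, heq.trans hs.symm⟩
      rw [hF] at hxF
      obtain ⟨a, b, -, hb, -, rfl⟩ := hxF
      have : (inner ℝ (a • (0 : E 2) + b • v) v : ℝ) = b * inner ℝ v v := by
        simp [inner_smul_left]
      rw [heq, this, mul_zero, zero_sub, neg_nonpos]
      exact mul_nonneg hb real_inner_self_nonneg
  have hpos : 0 < ‖m‖⁻¹ := inv_pos.2 (norm_pos_iff.2 hm0)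
  have hs' : supportFun K (unit m) = 0 := by
    rw [unit, supportFun_smul _ hpos.le,
      (supportFun_eq_zero_iff hK.isCompact h0).2 hKm, mul_zero]
  obtain ⟨a, b, hab⟩ := hK.exists_face_eq_segment (norm_unit hm0) hs'
  have hx₀F : x₀ ∈ segment ℝ a b := by
    rw [← hab]
    exact ⟨extremePoints_subset hx₀.1, by rw [hs', unit, inner_smul_right, hx₀m, mul_zero]⟩
  have h0F : (0 : E 2) ∈ segment ℝ a b := by
    rw [← hab]
    exact ⟨h0, by rw [hs', inner_zero_left]⟩
  have haK : a ∈ K := face_subset K (unit m) (hab ▸ left_mem_segment ℝ a b)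
  have hbK : b ∈ K := face_subset K (unit m) (hab ▸ right_mem_segment ℝ a b)
  have h0' : (0 : E 2) ∉ openSegment ℝ a b := by
    intro h
    obtain ⟨h1, h2⟩ := inner_eq_zero_of_zero_mem_openSegment h (hKu a haK) (hKu b hbK)
    obtain ⟨p, q, -, -, -, rfl⟩ := hx₀F
    have := hx₀.2
    simp [inner_add_left, inner_smul_left, h1, h2] at this
  obtain ⟨w, hw, -⟩ := exists_of_zero_mem_segment h0F h0'
  have hwu : inner ℝ w u ≠ (0 : ℝ) := by
    intro h
    rw [hw] at hx₀F
    obtain ⟨p, q, -, -, -, rfl⟩ := hx₀F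
    have := hx₀.2
    simp [inner_smul_left, h] at this
  refine ⟨w, fun h => hwu (h ▸ hvu), isEdge_of_face hK.isCompact (hab.trans hw) ?_⟩
  rintro rfl
  exact hwu (inner_zero_left u)

theorem inner_eq_zero_of_dim_eq_one (hd : dim K = 1) (h0 : (0 : E 2) ∈ K) {a u : E 2} (ha : a ∈ K)
    (ha0 : a ≠ 0) (hau : inner ℝ a u = 0) : ∀ x ∈ K, inner ℝ x u = 0 := by
  intro x hx
  have hmem : ∀ y ∈ K, y ∈ vectorSpan ℝ K := fun y hy => by
    simpa using vsub_mem_vectorSpan ℝ hy h0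
  obtain ⟨c, hc⟩ := (finrank_eq_one_iff_of_nonzero' (⟨a, hmem a ha⟩ : vectorSpan ℝ K)
    (by simpa using ha0)).1 hd ⟨x, hmem x hx⟩
  have hc' : c • a = x := congrArg Subtype.val hc
  rw [← hc', inner_smul_left, hau, mul_zero]

/-- The vector `e(K)` of a polytope that contains the origin is the sum of the endpoints of all
faces on supporting lines through the origin. -/
theorem eVector_eq_edgeSum (hK : IsPolytope K) (h0 : (0 : E 2) ∈ K) : eVector K = edgeSum K := by
  rw [eVector]
  split_ifs with h₁ h₂
  · obtain ⟨hd, ⟨hne, hv, hw⟩ | ⟨hvw, h0'⟩⟩ := h₁.choose_spec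
    · exact (edgeSum_of_two_edges hK.isCompact h0 hd hne hv hw).symm
    · exact (edgeSum_of_edge hK.isCompact h0 hd hvw h0').symm
  · obtain ⟨-, hseg, -⟩ := h₂.choose_spec
    have := edgeSum_of_segment (hseg ▸ h0)
    rw [← hseg] at this
    exact this.symm
  · rw [edgeSum, sphereSum]
    refine (finsum_mem_of_eqOn_zero fun u hu => ?_).symm
    by_contra hT
    have hs : supportFun K u = 0 := by
      by_contra hs
      exact hT (edgeTerm_eq_zero_of_ne hs)
    obtain ⟨a, b, hab⟩ := hK.exists_face_eq_segment hu hs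
    have h0F : (0 : E 2) ∈ segment ℝ a b := hab ▸ ⟨h0, by rw [hs, inner_zero_left]⟩
    have haF : a ∈ face K u := hab ▸ left_mem_segment ℝ a b
    have hbF : b ∈ face K u := hab ▸ right_mem_segment ℝ a b
    have hT' : a + b ≠ 0 := fun h => hT ((edgeTerm_eq_add hu hs hab).trans h)
    have hne : a ≠ b := by
      rintro rfl
      rw [segment_same, Set.mem_singleton_iff] at h0F
      rw [← h0F, add_zero] at hT'
      exact hT' rfl
    have hdle : dim K ≤ 2 := (Submodule.finrank_le _).trans (by simp)
    have hdne : dim K ≠ 0 := fun h => hne (dim_eq_zero_iff.1 h haF.1 hbF.1)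
    rcases (by omega : dim K = 1 ∨ dim K = 2) with hd | hd
    · apply h₂
      refine ⟨(a, b), hd, ?_, h0⟩
      obtain ⟨c, hc, hc0⟩ : ∃ c ∈ face K u, c ≠ 0 := by
        by_cases ha : a = 0
        · exact ⟨b, hbF, fun hb => hne (ha.trans hb.symm)⟩
        · exact ⟨a, haF, ha⟩
      have hall := inner_eq_zero_of_dim_eq_one hd h0 hc.1 hc0 (hc.2.trans hs)
      rw [← hab]
      ext x
      simp only [face, hs, Set.mem_ofPred_eq]
      exact ⟨fun hx => ⟨hx, hall x hx⟩, fun hx => hx.1⟩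
    · apply h₁
      by_cases h0' : (0 : E 2) ∈ openSegment ℝ a b
      · exact ⟨(a, b), hd, Or.inr ⟨isEdge_of_face hK.isCompact hab hne, h0'⟩⟩
      · obtain ⟨v, hv, hv'⟩ := exists_of_zero_mem_segment h0F h0'
        have hv0 : v ≠ 0 := hv' ▸ hT'
        obtain ⟨w, hvw, hw⟩ := exists_second_edge hK h0 hd hu hs (hab.trans hv) hv0
        exact ⟨(v, w), hd, Or.inl ⟨hvw, isEdge_of_face hK.isCompact (hab.trans hv) hv0.symm, hw⟩⟩

end EVector

/-! ### Visible vertices -/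

section Visible

variable {P : Set (E 2)}

theorem visibleVertices_eq_empty (hP : Convex ℝ P) (h0 : (0 : E 2) ∈ P) :
    visibleVertices P = ∅ := by
  refine Set.eq_empty_of_forall_notMem fun v hv => ?_
  have hsub : openSegment ℝ 0 v ⊆ P :=
    (openSegment_subset_segment ℝ 0 v).trans (hP.segment_subset h0 hv.1.1)
  obtain ⟨x, hx⟩ : (openSegment ℝ (0 : E 2) v).Nonempty :=
    ⟨_, 1 / 2, 1 / 2, by norm_num, by norm_num, by norm_num, rfl⟩
  have : x ∈ P ∩ openSegment ℝ 0 v := ⟨hsub hx, hx⟩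
  rw [hv.2] at this
  exact this

theorem visibleVertices_subset (P : Set (E 2)) : visibleVertices P ⊆ P :=
  fun _ h => extremePoints_subset h.1

theorem isPolytope_convO_visibleVertices (hP : IsPolytope P) :
    IsPolytope (convO (visibleVertices P)) :=
  isPolytope_convexHull ((hP.finite_extremePoints.subset fun _ h => h.1).insert 0)
    (Set.insert_nonempty _ _)

/-- If the origin is not in `P`, the face of `P` on a supporting line through the origin is
`[a, s a]` with `s ≥ 1`, and `a` is its only visible vertex. -/
theorem exists_visible_face (hP : IsPolytope P) (h0 : (0 : E 2) ∉ P) {u : E 2} (hu : ‖u‖ = 1)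
    (hs : supportFun P u = 0) :
    ∃ (a : E 2) (s : ℝ), 1 ≤ s ∧ face P u = segment ℝ a (s • a) ∧ a ∈ visibleVertices P ∧
      ∀ c ∈ visibleVertices P, inner ℝ c u = 0 → c = a := by
  -- the endpoint nearer to the origin is called `a`
  obtain ⟨a, b, hab, hle⟩ : ∃ a b, face P u = segment ℝ a b ∧ ‖a‖ ≤ ‖b‖ := by
    obtain ⟨a, b, hab⟩ := hP.exists_face_eq_segment hu hs
    rcases le_total ‖a‖ ‖b‖ with h | h
    · exact ⟨a, b, hab, h⟩
    · exact ⟨b, a, hab.trans (segment_symm ℝ a b), h⟩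
  have h0F : (0 : E 2) ∉ segment ℝ a b := fun h => h0 (face_subset P u (hab ▸ h))
  have haF : a ∈ face P u := hab ▸ left_mem_segment ℝ a b
  have hbF : b ∈ face P u := hab ▸ right_mem_segment ℝ a b
  have ha0 : a ≠ 0 := by
    rintro rfl
    exact h0 haF.1
  have hb0 : b ≠ 0 := by
    rintro rfl
    exact h0 hbF.1
  have ha1 := eq_smul_rot_of_inner_eq_zero hu (haF.2.trans hs)
  have hb1 := eq_smul_rot_of_inner_eq_zero hu (hbF.2.trans hs)
  set α : ℝ := inner ℝ a (rot u)
  set β : ℝ := inner ℝ b (rot u)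
  have hα : α ≠ 0 := by
    intro h
    rw [h, zero_smul] at ha1
    exact ha0 ha1
  obtain ⟨s, hbs⟩ : ∃ s : ℝ, b = s • a := by
    refine ⟨β / α, ?_⟩
    rw [hb1]
    nth_rewrite 1 [ha1]
    rw [smul_smul, div_mul_cancel₀ _ hα]
  have hs0 : 0 < s := by
    by_contra! hneg
    refine h0F ⟨-s / (1 - s), 1 / (1 - s), div_nonneg (by linarith) (by linarith),
      div_nonneg (by linarith) (by linarith), ?_, ?_⟩
    · rw [← add_div, div_eq_one_iff_eq (by linarith)]; ring
    · rw [hbs, smul_smul, ← add_smul]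
      have : -s / (1 - s) + 1 / (1 - s) * s = 0 := by ring
      rw [this, zero_smul]
  have hs1 : 1 ≤ s := by
    rw [hbs, norm_smul, Real.norm_of_nonneg hs0.le] at hle
    have : 0 < ‖a‖ := norm_pos_iff.2 ha0
    by_contra! h
    nlinarith
  have hmem : ∀ x, x ∈ face P u → ∃ p : ℝ, 1 ≤ p ∧ x = p • a := by
    intro x hx
    rw [hab, hbs] at hx
    obtain ⟨p, q, hp, hq, hpq, rfl⟩ := hx
    refine ⟨p + q * s, by nlinarith, ?_⟩
    rw [add_smul, mul_smul]
  have hinj : ∀ p q : ℝ, p • a = q • a → p = q := fun p q h => smul_left_injective ℝ ha0 h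
  have hface : ∀ x ∈ P, inner ℝ x u = (0 : ℝ) → x ∈ face P u := fun x hx hxu =>
    ⟨hx, hxu.trans hs.symm⟩
  have hext : a ∈ P.extremePoints ℝ := by
    refine extremePoints_face_subset hP.isCompact u ⟨haF, ?_⟩
    rintro x hx y hy ⟨l, m, hl, hm, hlm, hxy⟩
    obtain ⟨p, hp, rfl⟩ := hmem x hx
    obtain ⟨q, hq, rfl⟩ := hmem y hy
    have h1 : l * p + m * q = 1 := by
      apply hinj
      rw [add_smul, mul_smul, mul_smul, hxy, one_smul]
    have h2 : p = 1 := by nlinarith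
    rw [h2, one_smul]
  have hinner : ∀ (c : ℝ), inner ℝ (c • a) u = (0 : ℝ) := fun c => by
    rw [inner_smul_left, haF.2, hs, mul_zero]
  refine ⟨a, s, hs1, hbs ▸ hab, ⟨hext, ?_⟩, ?_⟩
  · refine Set.eq_empty_of_forall_notMem ?_
    rintro _ ⟨hx, l, m, hl, hm, hlm, rfl⟩
    rw [smul_zero, zero_add] at hx
    obtain ⟨p, hp, hpe⟩ := hmem _ (hface _ hx (hinner m))
    have := hinj _ _ hpe
    linarith
  · intro c hc hcu
    obtain ⟨p, hp, rfl⟩ := hmem c (hface c (visibleVertices_subset P hc) hcu)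
    rcases hp.eq_or_lt with rfl | hp'
    · rw [one_smul]
    · exfalso
      have : a ∈ P ∩ openSegment ℝ 0 (p • a) := by
        refine ⟨haF.1, 1 - p⁻¹, p⁻¹, ?_, by positivity, by ring, ?_⟩
        · rw [sub_pos]; exact inv_lt_one_of_one_lt₀ hp'
        · rw [smul_zero, zero_add, smul_smul, inv_mul_cancel₀ (by linarith), one_smul]
      rw [hc.2] at this
      exact this

/-- If `P` lies in the open half-plane `⟨x, w⟩ > 0`, every direction `v` that is not a multiple of
`w` is maximized, after central projection to a line `⟨x, w⟩ = const`, at a visible vertex. -/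
theorem exists_visible_max (hP : IsPolytope P) {w v : E 2}
    (hw : ∀ x ∈ P, (0 : ℝ) < inner ℝ x w) (hv : ∀ c : ℝ, v ≠ c • w) :
    ∃ c ∈ visibleVertices P, ∀ x ∈ P,
      (inner ℝ x v * inner ℝ c w : ℝ) ≤ inner ℝ c v * inner ℝ x w := by
  have h0 : (0 : E 2) ∉ P := fun h => by
    have := hw 0 h
    rw [inner_zero_left] at this
    exact this.false
  obtain ⟨x₀, hx₀, hmax⟩ := hP.isCompact.exists_isMaxOn hP.nonempty
    (f := fun x => (inner ℝ x v : ℝ) / inner ℝ x w)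
    (ContinuousOn.div (by fun_prop) (by fun_prop) fun x hx => (hw x hx).ne')
  set M : ℝ := inner ℝ x₀ v / inner ℝ x₀ w with hM
  set m : E 2 := v - M • w with hm
  have hm0 : m ≠ 0 := sub_ne_zero.2 (hv M)
  have hm_inner : ∀ x : E 2, inner ℝ x m = (inner ℝ x v : ℝ) - M * inner ℝ x w := fun x => by
    rw [hm, inner_sub_right, inner_smul_right]
  have hle : ∀ x ∈ P, (inner ℝ x v : ℝ) ≤ M * inner ℝ x w := fun x hx => by
    have := hmax hx
    rwa [Set.mem_ofPred_eq, div_le_iff₀ (hw x hx)] at this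
  have hx₀m : inner ℝ x₀ m = (0 : ℝ) := by
    rw [hm_inner, hM, div_mul_cancel₀ _ (hw x₀ hx₀).ne', sub_self]
  have hs : supportFun P m = 0 := by
    rw [supportFun_eq hx₀, hx₀m]
    intro y hy
    rw [hx₀m, hm_inner]
    linarith [hle y hy]
  have hpos : 0 < ‖m‖⁻¹ := inv_pos.2 (norm_pos_iff.2 hm0)
  obtain ⟨c, s, -, hF, hc, -⟩ := exists_visible_face hP h0 (norm_unit hm0)
    (by rw [unit, supportFun_smul _ hpos.le, hs, mul_zero])
  refine ⟨c, hc, fun x hx => ?_⟩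
  have hcF : c ∈ face P m := by
    rw [← face_smul P hpos]
    exact hF ▸ left_mem_segment ℝ c (s • c)
  have hcm := hcF.2
  rw [hs, hm_inner] at hcm
  have hcw := hw c hcF.1
  have : (inner ℝ c v : ℝ) = M * inner ℝ c w := by linarith
  rw [this]
  nlinarith [hle x hx]

theorem exists_visible_inner_pos (hP : IsPolytope P) (h0 : (0 : E 2) ∉ P) {u x : E 2}
    (hx : x ∈ P) (hxu : (0 : ℝ) < inner ℝ x u) :
    ∃ c ∈ visibleVertices P, (0 : ℝ) < inner ℝ c u := by
  obtain ⟨f, r, hf0, hf⟩ := geometric_hahn_banach_point_closed hP.convex hP.isClosed h0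
  set w : E 2 := (InnerProductSpace.toDual ℝ (E 2)).symm f
  have hfw : ∀ y, f y = inner ℝ y w := fun y => by
    rw [real_inner_comm, InnerProductSpace.toDual_symm_apply]
  have hw : ∀ y ∈ P, (0 : ℝ) < inner ℝ y w := fun y hy => by
    have := hf y hy
    rw [map_zero] at hf0
    rw [← hfw]
    linarith
  by_cases hu : ∃ c : ℝ, u = c • w
  · obtain ⟨c, rfl⟩ := hu
    have hw0 : w ≠ 0 := by
      intro h
      have := hw x hx
      rw [h, inner_zero_right] at this
      exact this.false
    rw [inner_smul_right] at hxu
    have hc : 0 < c := (pos_iff_pos_of_mul_pos hxu).2 (hw x hx)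
    obtain ⟨y, hy, -⟩ := exists_visible_max (v := rot w) hP hw (by
      intro d hd
      have h1 : (inner ℝ w (rot w) : ℝ) = d * inner ℝ w w := by rw [hd, inner_smul_right]
      rw [inner_rot_self, eq_comm, mul_eq_zero, inner_self_eq_zero] at h1
      rw [h1.resolve_right hw0, zero_smul, ← norm_eq_zero, norm_rot, norm_eq_zero] at hd
      exact hw0 hd)
    refine ⟨y, hy, ?_⟩
    rw [inner_smul_right]
    exact mul_pos hc (hw y (visibleVertices_subset P hy))
  · push Not at hu
    obtain ⟨c, hc, hcx⟩ := exists_visible_max hP hw hu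
    refine ⟨c, hc, ?_⟩
    have h1 := mul_pos hxu (hw c (visibleVertices_subset P hc))
    exact (pos_iff_pos_of_mul_pos (h1.trans_le (hcx x hx))).2 (hw x hx)

theorem convO_visibleVertices_subset (P : Set (E 2)) : convO (visibleVertices P) ⊆ convO P :=
  convexHull_mono (Set.insert_subset_insert (visibleVertices_subset P))

/-- On a supporting line through the origin the edge `[a, b]` of `P`, with `a` nearer to the origin,
becomes `[o, b]` in `[o, P]`, and `[o, a]` if only the visible vertices are retained. -/
theorem edgeTerm_eq_add_visible (hP : IsPolytope P) {u : E 2} (hu : ‖u‖ = 1) :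
    edgeTerm P u = edgeTerm (convO P) u + edgeTerm (convO (visibleVertices P)) u := by
  have hK := hP.convO
  have hV := isPolytope_convO_visibleVertices hP
  have hK0 := zero_mem_convO P
  have hV0 := zero_mem_convO (visibleVertices P)
  by_cases h0 : (0 : E 2) ∈ P
  · rw [convO_eq_self hP.convex h0, visibleVertices_eq_empty hP.convex h0,
      edgeTerm_eq_zero_of_forall (K := convO ∅), add_zero]
    · simp [convO]
    · exact zero_mem_convO ∅
    · exact hu
    · intro _ x hx _
      simpa [convO] using hx
  rcases lt_trichotomy (supportFun P u) 0 with hlt | heq | hgt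
  · have hzero : ∀ x ∈ convO P, inner ℝ x u = 0 → x = 0 := by
      intro x hx hxu
      obtain ⟨p, hp, t, -, -, rfl⟩ := (mem_convO_iff hP.convex hP.nonempty).1 hx
      have hpu := inner_le_supportFun hP.isCompact hp u
      rw [inner_smul_left, conj_trivial, mul_eq_zero] at hxu
      rw [hxu.resolve_right (by linarith), zero_smul]
    rw [edgeTerm_eq_zero_of_ne hlt.ne,
      edgeTerm_eq_zero_of_forall hK.isCompact hK0 hu fun _ => hzero,
      edgeTerm_eq_zero_of_forall hV.isCompact hV0 hu fun _ x hx =>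
        hzero x (convO_visibleVertices_subset P hx), add_zero]
  · obtain ⟨a, s, hs, hF, haV, huniq⟩ := exists_visible_face hP h0 hu heq
    have haF : a ∈ face P u := hF ▸ left_mem_segment ℝ a (s • a)
    have hsaF : s • a ∈ face P u := hF ▸ right_mem_segment ℝ a (s • a)
    have hKle : ∀ x ∈ convO P, inner ℝ x u ≤ 0 := by
      intro x hx
      obtain ⟨p, hp, t, ht, -, rfl⟩ := (mem_convO_iff hP.convex hP.nonempty).1 hx
      have hpu := inner_le_supportFun hP.isCompact hp u
      rw [heq] at hpu
      rw [inner_smul_left, conj_trivial]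
      exact mul_nonpos_of_nonneg_of_nonpos ht hpu
    have hKs := (supportFun_eq_zero_iff hK.isCompact hK0).2 hKle
    have hVs := (supportFun_eq_zero_iff hV.isCompact hV0).2 fun x hx =>
      hKle x (convO_visibleVertices_subset P hx)
    have hK0F : (0 : E 2) ∈ face (convO P) u := ⟨hK0, by rw [hKs, inner_zero_left]⟩
    have hV0F : (0 : E 2) ∈ face (convO (visibleVertices P)) u :=
      ⟨hV0, by rw [hVs, inner_zero_left]⟩
    have hKF : face (convO P) u = segment ℝ 0 (s • a) := by
      apply Set.Subset.antisymm
      · rintro x ⟨hx, hxu⟩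
        obtain ⟨p, hp, t, ht0, ht1, rfl⟩ := (mem_convO_iff hP.convex hP.nonempty).1 hx
        rcases ht0.eq_or_lt with rfl | ht
        · rw [zero_smul]; exact left_mem_segment ℝ _ _
        rw [hKs, inner_smul_left, conj_trivial, mul_eq_zero] at hxu
        have hpF : p ∈ face P u := ⟨hp, (hxu.resolve_left ht.ne').trans heq.symm⟩
        rw [hF] at hpF
        have ha : a ∈ segment ℝ 0 (s • a) := by
          refine ⟨1 - s⁻¹, s⁻¹, ?_, by positivity, by ring, ?_⟩
          · rw [sub_nonneg]; exact inv_le_one_of_one_le₀ hs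
          · rw [smul_zero, zero_add, smul_smul, inv_mul_cancel₀ (by linarith), one_smul]
        have hpS : p ∈ segment ℝ 0 (s • a) :=
          (convex_segment 0 (s • a)).segment_subset ha (right_mem_segment ℝ _ _) hpF
        have := (convex_segment 0 (s • a)) (left_mem_segment ℝ _ _) hpS
          (sub_nonneg.2 ht1) ht0 (by ring)
        rwa [smul_zero, zero_add] at this
      · exact (face_convex hK.convex u).segment_subset hK0F
          ⟨subset_convO P hsaF.1, by rw [hKs, hsaF.2, heq]⟩
    have hVF : face (convO (visibleVertices P)) u = segment ℝ 0 a := by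
      apply Set.Subset.antisymm
      · have hFk := face_isCompact hV.isCompact u
        rw [← closure_convexHull_extremePoints hFk (face_convex hV.convex u),
          ← convexHull_pair]
        refine closure_minimal (convexHull_mono ?_)
          (Set.Finite.isClosed_convexHull ℝ (Set.toFinite _))
        intro x hx
        have hxu : inner ℝ x u = (0 : ℝ) := (extremePoints_subset hx).2.trans hVs
        rcases extremePoints_convexHull_subset
          (extremePoints_face_subset hV.isCompact u hx) with rfl | hxV
        · exact Or.inl rfl
        · exact Or.inr (huniq x hxV hxu)
      · exact (face_convex hV.convex u).segment_subset hV0F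
          ⟨subset_convO _ haV, by rw [hVs, haF.2, heq]⟩
    rw [edgeTerm_eq_add hu heq hF, edgeTerm_eq_add hu hKs hKF, edgeTerm_eq_add hu hVs hVF]
    abel
  · obtain ⟨x, hx⟩ := face_nonempty hP.isCompact hP.nonempty u
    have hxu : (0 : ℝ) < inner ℝ x u := by rwa [hx.2]
    obtain ⟨c, hc, hcu⟩ := exists_visible_inner_pos hP h0 hx.1 hxu
    rw [edgeTerm_eq_zero_of_ne hgt.ne', edgeTerm_eq_zero_of_ne, edgeTerm_eq_zero_of_ne, add_zero]
    · exact (hcu.trans_le (inner_le_supportFun hV.isCompact (subset_convO _ hc) u)).ne'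
    · exact (hxu.trans_le (inner_le_supportFun hK.isCompact (subset_convO _ hx.1) u)).ne'

/-- The vector `e([o, v₁, …, vᵣ])` as a difference of two valuations. -/
theorem eVector_visibleVertices (hP : IsPolytope P) :
    eVector (convO (visibleVertices P)) = edgeSum P - edgeSum (convO P) := by
  have hV := isPolytope_convO_visibleVertices hP
  rw [eVector_eq_edgeSum hV (zero_mem_convO _), eq_sub_iff_add_eq', edgeSum, edgeSum, edgeSum,
    ← sphereSum_add (finite_support_edgeTerm hP.convO) (finite_support_edgeTerm hV)]
  exact (sphereSum_congr fun u hu => edgeTerm_eq_add_visible hP hu).symm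

end Visible

/-! ### The functions in the classification are contravariant valuations -/

section Candidate

/-- The function on the right-hand side of the classification. -/
def candidate (c₁ c₂ d₁ d₂ : ℝ) (ζ₁ ζ₂ : ℝ≥0 → ℝ) (P : Polytope 2) : E 2 :=
  facetVector ζ₁ (P : Set (E 2)) + facetVector ζ₂ (convO (P : Set (E 2)))
    + c₁ • rot (momentVector (P : Set (E 2))) + d₁ • rot (momentVector (convO (P : Set (E 2))))
    + c₂ • rot (eVector (convO (P : Set (E 2))))
    + d₂ • rot (eVector (convO (visibleVertices (P : Set (E 2)))))

theorem IsValuation.add {n : ℕ} {Z Z' : Polytope n → E n} (h : IsValuation Z)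
    (h' : IsValuation Z') : IsValuation fun P => Z P + Z' P := by
  intro P Q U I hU hI
  have h1 := h P Q U I hU hI
  have h2 := h' P Q U I hU hI
  dsimp only
  rw [add_add_add_comm, h1, h2, add_add_add_comm]

theorem IsValuation.smul {n : ℕ} {Z : Polytope n → E n} (h : IsValuation Z) (c : ℝ) :
    IsValuation fun P => c • Z P := by
  intro P Q U I hU hI
  dsimp only
  rw [← smul_add, h P Q U I hU hI, smul_add]

theorem IsSLContravariant.add {n : ℕ} {Z Z' : Polytope n → E n} (h : IsSLContravariant Z)
    (h' : IsSLContravariant Z') : IsSLContravariant fun P => Z P + Z' P := by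
  intro φ P
  dsimp only
  rw [h, h', map_add]

theorem IsSLContravariant.smul {n : ℕ} {Z : Polytope n → E n} (h : IsSLContravariant Z) (c : ℝ) :
    IsSLContravariant fun P => c • Z P := by
  intro φ P
  dsimp only
  rw [h, map_smul]

theorem candidate_eq (c₁ c₂ d₁ d₂ : ℝ) (ζ₁ ζ₂ : ℝ≥0 → ℝ) :
    candidate c₁ c₂ d₁ d₂ ζ₁ ζ₂ = fun P : Polytope 2 =>
      facetVector ζ₁ P.1 + facetVector ζ₂ P.convO.1
        + c₁ • rot (momentVector P.1) + d₁ • rot (momentVector P.convO.1)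
        + (c₂ - d₂) • rot (edgeSum P.convO.1) + d₂ • rot (edgeSum P.1) := by
  funext P
  rw [candidate, eVector_eq_edgeSum P.2.convO (zero_mem_convO _), eVector_visibleVertices P.2,
    rot_sub, smul_sub, sub_smul]
  simp only [Polytope.convO]
  abel

theorem candidate_isValuation (c₁ c₂ d₁ d₂ : ℝ) {ζ₁ ζ₂ : ℝ≥0 → ℝ} (h₁ : IsCauchySolution ζ₁)
    (h₂ : IsCauchySolution ζ₂) : IsValuation (candidate c₁ c₂ d₁ d₂ ζ₁ ζ₂) := by
  rw [candidate_eq]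
  exact (((((facetVector_isValuation h₁).add (facetVector_isValuation h₂).comp_convO).add
    (momentVector_isValuation.smul c₁)).add (momentVector_isValuation.comp_convO.smul d₁)).add
    (edgeSum_isValuation.comp_convO.smul (c₂ - d₂))).add (edgeSum_isValuation.smul d₂)

theorem candidate_isSLContravariant (c₁ c₂ d₁ d₂ : ℝ) {ζ₁ ζ₂ : ℝ≥0 → ℝ}
    (h₁ : IsCauchySolution ζ₁) (h₂ : IsCauchySolution ζ₂) :
    IsSLContravariant (candidate c₁ c₂ d₁ d₂ ζ₁ ζ₂) := by
  rw [candidate_eq]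
  exact (((((facetVector_isSLContravariant h₁).add
    (facetVector_isSLContravariant h₂).comp_convO).add
    (momentVector_isSLContravariant.smul c₁)).add
    (momentVector_isSLContravariant.comp_convO.smul d₁)).add
    (edgeSum_isSLContravariant.comp_convO.smul (c₂ - d₂))).add (edgeSum_isSLContravariant.smul d₂)

end Candidate

/-! ### Valuations that vanish on simple polygons -/

section Uniqueness

open Classical in
/-- A function of polytopes as a function of sets, with the value `0` on other sets. -/
def onSet (Z : Polytope 2 → E 2) (S : Set (E 2)) : E 2 :=
  if h : IsPolytope S then Z ⟨S, h⟩ else 0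

theorem onSet_coe (Z : Polytope 2 → E 2) (P : Polytope 2) : onSet Z P.1 = Z P := dif_pos P.2

theorem onSet_of_isPolytope (Z : Polytope 2 → E 2) {S : Set (E 2)} (h : IsPolytope S) :
    onSet Z S = Z ⟨S, h⟩ := dif_pos h

theorem IsValuation.onSet_add {Z : Polytope 2 → E 2} (hZ : IsValuation Z) {P Q U I : Set (E 2)}
    (hP : IsPolytope P) (hQ : IsPolytope Q) (hU : IsPolytope U) (hI : IsPolytope I)
    (hU' : U = P ∪ Q) (hI' : I = P ∩ Q) :
    onSet Z P + onSet Z Q = onSet Z U + onSet Z I := by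
  rw [onSet_of_isPolytope Z hP, onSet_of_isPolytope Z hQ, onSet_of_isPolytope Z hU,
    onSet_of_isPolytope Z hI]
  exact hZ _ _ _ _ hU' hI'

theorem isPolytope_singleton (a : E 2) : IsPolytope ({a} : Set (E 2)) :=
  ⟨{a}, Set.toFinite _, Set.singleton_nonempty a, by simp⟩

theorem isPolytope_segment (a b : E 2) : IsPolytope (segment ℝ a b) :=
  ⟨{a, b}, Set.toFinite _, Set.insert_nonempty _ _, (convexHull_pair a b).symm⟩

theorem isPolytope_triangle (a b c : E 2) : IsPolytope (convexHull ℝ {a, b, c}) :=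
  ⟨{a, b, c}, Set.toFinite _, Set.insert_nonempty _ _, rfl⟩

theorem segment_eq_union_and_inter {V : Type*} [AddCommGroup V] [Module ℝ V] {x y z : V}
    (hy : y ∈ segment ℝ x z) :
    segment ℝ x z = segment ℝ x y ∪ segment ℝ y z ∧
      ({y} : Set V) = segment ℝ x y ∩ segment ℝ y z := by
  by_cases hxz : x = z
  · subst hxz
    rw [segment_same, Set.mem_singleton_iff] at hy
    subst hy
    simp
  have hinj : Function.Injective (AffineMap.lineMap x z : ℝ →ᵃ[ℝ] V) :=
    AffineMap.lineMap_injective ℝ hxz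
  rw [segment_eq_image_lineMap] at hy
  obtain ⟨t, ⟨ht0, ht1⟩, rfl⟩ := hy
  have h1 : segment ℝ x (AffineMap.lineMap x z t) =
      (AffineMap.lineMap x z : ℝ →ᵃ[ℝ] V) '' Set.Icc 0 t := by
    rw [← segment_eq_Icc ht0, image_segment, AffineMap.lineMap_apply_zero]
  have h2 : segment ℝ (AffineMap.lineMap x z t) z =
      (AffineMap.lineMap x z : ℝ →ᵃ[ℝ] V) '' Set.Icc t 1 := by
    rw [← segment_eq_Icc ht1, image_segment, AffineMap.lineMap_apply_one]
  constructor
  · rw [h1, h2, ← Set.image_union, Set.Icc_union_Icc_eq_Icc ht0 ht1, segment_eq_image_lineMap]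
  · rw [h1, h2, ← Set.image_inter hinj, Set.Icc_inter_Icc_eq_singleton ht0 ht1,
      Set.image_singleton]

theorem convexHull_insert_segment {V : Type*} [AddCommGroup V] [Module ℝ V] (b x y : V) :
    convexHull ℝ (insert b (segment ℝ x y)) = convexHull ℝ {b, x, y} := by
  rw [← convexHull_pair, Set.insert_eq, convexHull_convexHull_union_right, ← Set.insert_eq]

theorem convexHull_triple_of_mem_segment {V : Type*} [AddCommGroup V] [Module ℝ V] {x y z : V}
    (hy : y ∈ segment ℝ x z) : convexHull ℝ {x, y, z} = segment ℝ x z := by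
  apply Set.Subset.antisymm
  · refine convexHull_min ?_ (convex_segment x z)
    rintro w (rfl | rfl | rfl)
    exacts [left_mem_segment ℝ _ _, hy, right_mem_segment ℝ _ _]
  · rw [← convexHull_pair]
    refine convexHull_mono ?_
    rintro w (rfl | rfl) <;> simp

variable {Z : Polytope 2 → E 2}

theorem IsValuation.onSet_segment_add (hZ : IsValuation Z) {x y z : E 2}
    (hy : y ∈ segment ℝ x z) :
    onSet Z (segment ℝ x y) + onSet Z (segment ℝ y z) =
      onSet Z (segment ℝ x z) + onSet Z {y} := by
  obtain ⟨h1, h2⟩ := segment_eq_union_and_inter hy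
  exact hZ.onSet_add (isPolytope_segment _ _) (isPolytope_segment _ _) (isPolytope_segment _ _)
    (isPolytope_singleton y) h1 h2

theorem IsValuation.onSet_triangle_add (hZ : IsValuation Z) (b : E 2) {x y z : E 2}
    (hy : y ∈ segment ℝ x z) :
    onSet Z (convexHull ℝ {b, x, y}) + onSet Z (convexHull ℝ {b, y, z}) =
      onSet Z (convexHull ℝ {b, x, z}) + onSet Z (segment ℝ b y) := by
  obtain ⟨h1, h2⟩ := segment_eq_union_and_inter hy
  have hc : Convex ℝ (segment ℝ x y ∪ segment ℝ y z) := h1 ▸ convex_segment x z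
  refine hZ.onSet_add (isPolytope_triangle _ _ _) (isPolytope_triangle _ _ _)
    (isPolytope_triangle _ _ _) (isPolytope_segment _ _) ?_ ?_
  · rw [← convexHull_insert_segment, ← convexHull_insert_segment, ← convexHull_insert_segment, h1]
    exact convexHull_insert_union (convex_segment x y) (convex_segment y z)
      ⟨x, left_mem_segment ℝ _ _⟩ ⟨y, left_mem_segment ℝ _ _⟩ hc b
  · rw [← convexHull_insert_segment, ← convexHull_insert_segment, ← convexHull_pair, h2]
    exact convexHull_insert_inter (convex_segment x y) (convex_segment y z)
      (isPolytope_segment x y).isClosed (isPolytope_segment y z).isClosed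
      ⟨x, left_mem_segment ℝ _ _⟩ ⟨y, left_mem_segment ℝ _ _⟩ hc b

/-- Of three collinear points, one of them the origin, one lies between the other two. -/
theorem mem_segment_of_cross_eq_zero {a b : E 2} (h : cross a b = 0) :
    (0 : E 2) ∈ segment ℝ a b ∨ a ∈ segment ℝ 0 b ∨ b ∈ segment ℝ 0 a := by
  by_cases ha : a = 0
  · exact Or.inl (ha ▸ left_mem_segment ℝ _ _)
  have hn : 0 < a 0 ^ 2 + a 1 ^ 2 := by
    rw [← norm_sq_E2]
    have := norm_pos_iff.2 ha
    positivity
  obtain ⟨s, rfl⟩ : ∃ s : ℝ, b = s • a := by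
    rw [cross] at h
    refine ⟨(a 0 * b 0 + a 1 * b 1) / (a 0 ^ 2 + a 1 ^ 2), E2_ext ?_ ?_⟩
    · rw [PiLp.smul_apply, smul_eq_mul]
      field_simp
      linear_combination -a 1 * h
    · rw [PiLp.smul_apply, smul_eq_mul]
      field_simp
      linear_combination a 0 * h
  rcases lt_or_ge s 0 with hs | hs
  · refine Or.inl ⟨-s / (1 - s), 1 / (1 - s), div_nonneg (by linarith) (by linarith),
      div_nonneg (by linarith) (by linarith), ?_, ?_⟩
    · rw [← add_div, div_eq_one_iff_eq (by linarith)]; ring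
    · rw [smul_smul, ← add_smul]
      have : -s / (1 - s) + 1 / (1 - s) * s = 0 := by ring
      rw [this, zero_smul]
  rcases le_or_gt s 1 with hs1 | hs1
  · exact Or.inr (Or.inr ⟨1 - s, s, by linarith, hs, by ring, by simp⟩)
  · refine Or.inr (Or.inl ⟨1 - s⁻¹, s⁻¹, ?_, by positivity, by ring, ?_⟩)
    · rw [sub_nonneg]; exact inv_le_one_of_one_le₀ hs1.le
    · rw [smul_zero, zero_add, smul_smul, inv_mul_cancel₀ (by linarith), one_smul]

theorem onSet_segment_eq_zero (hZ : IsValuation Z) (h1 : ∀ a, onSet Z {a} = 0)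
    (h2 : ∀ a, onSet Z (segment ℝ 0 a) = 0)
    (h3 : ∀ a b, 0 < cross a b → onSet Z (segment ℝ a b) = 0) (a b : E 2) :
    onSet Z (segment ℝ a b) = 0 := by
  rcases lt_trichotomy (cross a b) 0 with h | h | h
  · rw [segment_symm]
    exact h3 b a (by rw [cross_swap]; linarith)
  · rcases mem_segment_of_cross_eq_zero h with h0 | ha | hb
    · have := hZ.onSet_segment_add h0
      rwa [segment_symm ℝ a 0, h2, h2, h1, add_zero, add_zero, eq_comm] at this
    · have := hZ.onSet_segment_add ha
      rwa [h2, h2, h1, zero_add, add_zero] at this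
    · have := hZ.onSet_segment_add hb
      rwa [h2, h2, h1, zero_add, add_zero, segment_symm] at this
  · exact h3 a b h

theorem onSet_triangle_zero_eq_zero (hseg : ∀ a b, onSet Z (segment ℝ a b) = 0)
    (h4 : ∀ a b, 0 < cross a b → onSet Z (convexHull ℝ {0, a, b}) = 0) (a b : E 2) :
    onSet Z (convexHull ℝ {0, a, b}) = 0 := by
  rcases lt_trichotomy (cross a b) 0 with h | h | h
  · rw [Set.pair_comm]
    exact h4 b a (by rw [cross_swap]; linarith)
  · rcases mem_segment_of_cross_eq_zero h with h0 | ha | hb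
    · rw [Set.insert_comm, convexHull_triple_of_mem_segment h0, hseg]
    · rw [convexHull_triple_of_mem_segment ha, hseg]
    · rw [Set.pair_comm, convexHull_triple_of_mem_segment hb, hseg]
  · exact h4 a b h

/-- Triangles with an edge on a line through the origin: of the points `o`, `a`, `d` one lies
between the other two, and two of the three triangles with apex `b` over them have the vertex
`o`. -/
theorem onSet_triangle_of_cross_eq_zero (hZ : IsValuation Z)
    (hseg : ∀ a b, onSet Z (segment ℝ a b) = 0)
    (htri : ∀ a b, onSet Z (convexHull ℝ {0, a, b}) = 0) {a d : E 2} (h : cross a d = 0)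
    (b : E 2) : onSet Z (convexHull ℝ {b, a, d}) = 0 := by
  have htri' : ∀ x, onSet Z (convexHull ℝ {b, 0, x}) = 0 := fun x => by
    rw [Set.insert_comm, htri]
  rcases mem_segment_of_cross_eq_zero h with h0 | ha | hb
  · have := hZ.onSet_triangle_add b h0
    rwa [Set.pair_comm a 0, htri', htri', hseg, add_zero, add_zero, eq_comm] at this
  · have := hZ.onSet_triangle_add b ha
    rwa [htri', htri', hseg, zero_add, add_zero] at this
  · have := hZ.onSet_triangle_add b hb
    rwa [htri', htri', hseg, zero_add, add_zero, Set.pair_comm] at this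

theorem cross_add_smul (p q : ℝ) (a b c : E 2) :
    cross a (p • b + q • c) = p * cross a b + q * cross a c := by
  simp only [cross, PiLp.add_apply, PiLp.smul_apply, smul_eq_mul]
  ring

/-- If the line through `o` and `a` meets the edge `[b, c]`, it cuts the triangle into two triangles
with an edge on a line through the origin. -/
theorem onSet_triangle_of_cross_mul_nonneg (hZ : IsValuation Z)
    (hseg : ∀ a b, onSet Z (segment ℝ a b) = 0)
    (htri : ∀ a b, onSet Z (convexHull ℝ {0, a, b}) = 0) {a b c : E 2}
    (h : 0 ≤ cross a b * cross c a) : onSet Z (convexHull ℝ {a, b, c}) = 0 := by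
  set s := cross a b with hs
  set t := cross c a with ht
  have hL := fun {a d : E 2} (h : cross a d = 0) (b : E 2) =>
    onSet_triangle_of_cross_eq_zero hZ hseg htri h b
  by_cases hst : s + t = 0
  · have hs0 : s = 0 := by nlinarith
    have := hL (hs.symm.trans hs0) c
    rwa [Set.insert_comm, Set.pair_comm c b] at this
  · have hst2 : 0 < (s + t) ^ 2 := by positivity
    have hd : (t / (s + t)) • b + (s / (s + t)) • c ∈ segment ℝ b c := by
      refine ⟨_, _, ?_, ?_, ?_, rfl⟩
      · have : t / (s + t) = (t ^ 2 + s * t) / (s + t) ^ 2 := by field_simp; ring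
        rw [this]
        positivity
      · have : s / (s + t) = (s ^ 2 + s * t) / (s + t) ^ 2 := by field_simp
        rw [this]
        positivity
      · rw [← add_div, add_comm t s, div_self hst]
    set d := (t / (s + t)) • b + (s / (s + t)) • c with hd'
    have had : cross a d = 0 := by
      rw [hd', cross_add_smul, cross_swap c a, ← hs, ← ht]
      ring
    have h1 := hL had b
    have h2 := hL had c
    have := hZ.onSet_triangle_add a hd
    rw [Set.insert_comm] at h1
    rw [Set.insert_comm, Set.pair_comm] at h2
    rwa [h1, h2, hseg, add_zero, add_zero, eq_comm] at this

theorem onSet_triangle_eq_zero (hZ : IsValuation Z)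
    (hseg : ∀ a b, onSet Z (segment ℝ a b) = 0)
    (htri : ∀ a b, onSet Z (convexHull ℝ {0, a, b}) = 0) (a b c : E 2) :
    onSet Z (convexHull ℝ {a, b, c}) = 0 := by
  have hrot1 : ({a, b, c} : Set (E 2)) = {b, c, a} := by
    rw [Set.insert_comm, Set.pair_comm a c]
  have hrot2 : ({a, b, c} : Set (E 2)) = {c, a, b} := by
    rw [Set.pair_comm, Set.insert_comm]
  have key := fun {a b c : E 2} (h : 0 ≤ cross a b * cross c a) =>
    onSet_triangle_of_cross_mul_nonneg hZ hseg htri h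
  by_cases h1 : 0 ≤ cross a b * cross c a
  · exact key h1
  by_cases h2 : 0 ≤ cross b c * cross a b
  · rw [hrot1]; exact key h2
  rw [hrot2]
  refine key ?_
  -- among three signs two are equal
  push Not at h1 h2
  by_contra! h3
  have h12 := mul_pos_of_neg_of_neg h1 h2
  have : 0 ≤ (cross a b) ^ 2 := sq_nonneg _
  nlinarith

/-- A polygon is cut into two polygons with fewer vertices by a diagonal `[a, c]` that has
vertices on both sides. -/
theorem exists_cut {P : Set (E 2)} (hP : IsPolytope P) {a b c d : E 2}
    (ha : a ∈ P.extremePoints ℝ) (hc : c ∈ P.extremePoints ℝ) (hb : b ∈ P.extremePoints ℝ)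
    (hd : d ∈ P.extremePoints ℝ) (hneg : cross (c - a) (b - a) < 0)
    (hpos : 0 < cross (c - a) (d - a)) :
    ∃ P₁ P₂ : Set (E 2), IsPolytope P₁ ∧ IsPolytope P₂ ∧ P = P₁ ∪ P₂ ∧
      segment ℝ a c = P₁ ∩ P₂ ∧ (P₁.extremePoints ℝ).ncard < (P.extremePoints ℝ).ncard ∧
      (P₂.extremePoints ℝ).ncard < (P.extremePoints ℝ).ncard := by
  set X := P.extremePoints ℝ with hX
  have hXfin : X.Finite := hP.finite_extremePoints
  have hconv : convexHull ℝ X = P := hP.convexHull_extremePoints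
  set l : E 2 → ℝ := fun x => cross (c - a) (x - a) with hl
  have hcomb : ∀ (s t : ℝ) (x y : E 2), s + t = 1 → l (s • x + t • y) = s * l x + t * l y := by
    intro s t x y hst
    obtain rfl : s = 1 - t := by linarith
    simp only [hl, cross, PiLp.add_apply, PiLp.smul_apply, PiLp.sub_apply, smul_eq_mul]
    ring
  have hla : l a = 0 := by simp [hl]
  have hlc : l c = 0 := cross_self _
  have hac : a ≠ c := by
    rintro rfl
    simp at hneg
  set X₁ := {x ∈ X | l x ≤ 0} with hX₁
  set X₂ := {x ∈ X | 0 ≤ l x} with hX₂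
  have hne₁ : X₁.Nonempty := ⟨a, ha, hla.le⟩
  have hne₂ : X₂.Nonempty := ⟨a, ha, hla.ge⟩
  have hle₁ : ∀ x ∈ convexHull ℝ X₁, l x ≤ 0 := by
    intro x hx
    refine convexHull_min (t := {x | l x ≤ 0}) (fun x hx => hx.2) ?_ hx
    intro x hx y hy s t hs ht hst
    rw [Set.mem_ofPred_eq] at hx hy ⊢
    rw [hcomb s t x y hst]
    exact add_nonpos (mul_nonpos_of_nonneg_of_nonpos hs hx) (mul_nonpos_of_nonneg_of_nonpos ht hy)
  have hle₂ : ∀ x ∈ convexHull ℝ X₂, 0 ≤ l x := by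
    intro x hx
    refine convexHull_min (t := {x | 0 ≤ l x}) (fun x hx => hx.2) ?_ hx
    intro x hx y hy s t hs ht hst
    rw [Set.mem_ofPred_eq] at hx hy ⊢
    rw [hcomb s t x y hst]
    positivity
  have hsub₁ : convexHull ℝ X₁ ⊆ P := hconv ▸ convexHull_mono fun x hx => hx.1
  have hsub₂ : convexHull ℝ X₂ ⊆ P := hconv ▸ convexHull_mono fun x hx => hx.1
  have hseg₁ : segment ℝ a c ⊆ convexHull ℝ X₁ := (convex_convexHull ℝ X₁).segment_subset
    (subset_convexHull ℝ X₁ ⟨ha, hla.le⟩) (subset_convexHull ℝ X₁ ⟨hc, hlc.le⟩)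
  have hseg₂ : segment ℝ a c ⊆ convexHull ℝ X₂ := (convex_convexHull ℝ X₂).segment_subset
    (subset_convexHull ℝ X₂ ⟨ha, hla.ge⟩) (subset_convexHull ℝ X₂ ⟨hc, hlc.ge⟩)
  -- as `a` and `c` are vertices, the line through them meets `P` in the diagonal only
  have hline : ∀ z ∈ P, l z = 0 → z ∈ segment ℝ a c := by
    intro z hz hlz
    rcases mem_segment_of_cross_eq_zero hlz with h | h | h
    · have h' : a ∈ segment ℝ c z := by
        rw [← mem_segment_translate ℝ (-a)]
        simpa [neg_add_eq_sub] using h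
      rcases (mem_extremePoints_iff_forall_segment.1 ha).2 c hc.1 z hz h' with h | h
      · exact absurd h.symm hac
      · exact h ▸ left_mem_segment ℝ _ _
    · have h' : c ∈ segment ℝ a z := by
        rw [← mem_segment_translate ℝ (-a)]
        simpa [neg_add_eq_sub] using h
      rcases (mem_extremePoints_iff_forall_segment.1 hc).2 a ha.1 z hz h' with h | h
      · exact absurd h hac
      · exact h ▸ right_mem_segment ℝ _ _
    · rw [← mem_segment_translate ℝ (-a)]
      simpa [neg_add_eq_sub] using h
  have hunion : P = convexHull ℝ X₁ ∪ convexHull ℝ X₂ := by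
    apply Set.Subset.antisymm _ (Set.union_subset hsub₁ hsub₂)
    intro x hx
    have hXu : X = X₁ ∪ X₂ := by
      ext y
      constructor
      · intro hy
        rcases le_total (l y) 0 with h | h
        exacts [Or.inl ⟨hy, h⟩, Or.inr ⟨hy, h⟩]
      · rintro (hy | hy)
        exacts [hy.1, hy.1]
    have hx' := hx
    rw [← hconv, hXu, convexHull_union hne₁ hne₂, mem_convexJoin] at hx'
    obtain ⟨p, hp, q, hq, hxpq⟩ := hx'
    -- the segment `[p, q]` crosses the diagonal in a point `z`
    obtain ⟨z, hz, hlz⟩ : ∃ z ∈ segment ℝ p q, l z = 0 := by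
      have hlp := hle₁ p hp
      have hlq := hle₂ q hq
      rcases hlp.eq_or_lt with h | h
      · exact ⟨p, left_mem_segment ℝ _ _, h⟩
      · have hne : l q - l p ≠ 0 := by linarith
        have h1 : l q / (l q - l p) + -l p / (l q - l p) = 1 := by
          rw [← add_div, ← sub_eq_add_neg, div_self hne]
        refine ⟨_, ⟨l q / (l q - l p), -l p / (l q - l p), div_nonneg hlq (by linarith),
          div_nonneg (by linarith) (by linarith), h1, rfl⟩, ?_⟩
        rw [hcomb _ _ _ _ h1]
        field_simp
        ring
    have hzP : z ∈ P := hP.convex.segment_subset (hsub₁ hp) (hsub₂ hq) hz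
    have hzac := hline z hzP hlz
    obtain ⟨h1, -⟩ := segment_eq_union_and_inter hz
    rw [h1] at hxpq
    rcases hxpq with h | h
    · exact Or.inl ((convex_convexHull ℝ X₁).segment_subset hp (hseg₁ hzac) h)
    · exact Or.inr ((convex_convexHull ℝ X₂).segment_subset (hseg₂ hzac) hq h)
  have hcard : ∀ (Y : Set (E 2)) (y : E 2), Y ⊆ X → y ∈ X → y ∉ Y →
      ((convexHull ℝ Y).extremePoints ℝ).ncard < X.ncard := by
    intro Y y hYX hy hyY
    refine Set.ncard_lt_ncard ⟨extremePoints_convexHull_subset.trans hYX, fun h => hyY ?_⟩ hXfin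
    exact extremePoints_convexHull_subset (h hy)
  refine ⟨convexHull ℝ X₁, convexHull ℝ X₂,
    isPolytope_convexHull (hXfin.subset fun x hx => hx.1) hne₁,
    isPolytope_convexHull (hXfin.subset fun x hx => hx.1) hne₂, hunion, ?_,
    hcard X₁ d (fun x hx => hx.1) hd fun h => absurd h.2 (not_le.2 hpos),
    hcard X₂ b (fun x hx => hx.1) hb fun h => absurd h.2 (not_le.2 hneg)⟩
  apply Set.Subset.antisymm (Set.subset_inter hseg₁ hseg₂)
  rintro z ⟨hz1, hz2⟩
  exact hline z (hsub₁ hz1) (le_antisymm (hle₁ z hz1) (hle₂ z hz2))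

theorem cross_ne_zero_of_extremePoints {P : Set (E 2)} {a x y : E 2}
    (ha : a ∈ P.extremePoints ℝ) (hx : x ∈ P.extremePoints ℝ) (hy : y ∈ P.extremePoints ℝ)
    (hax : x ≠ a) (hay : y ≠ a) (hxy : x ≠ y) : cross (x - a) (y - a) ≠ 0 := by
  intro h
  rcases mem_segment_of_cross_eq_zero h with h | h | h
  · have h' : a ∈ segment ℝ x y := by
      rw [← mem_segment_translate ℝ (-a)]
      simpa [neg_add_eq_sub] using h
    rcases (mem_extremePoints_iff_forall_segment.1 ha).2 x hx.1 y hy.1 h' with h | h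
    exacts [hax h, hay h]
  · have h' : x ∈ segment ℝ a y := by
      rw [← mem_segment_translate ℝ (-a)]
      simpa [neg_add_eq_sub] using h
    rcases (mem_extremePoints_iff_forall_segment.1 hx).2 a ha.1 y hy.1 h' with h | h
    exacts [hax h.symm, hxy h.symm]
  · have h' : y ∈ segment ℝ a x := by
      rw [← mem_segment_translate ℝ (-a)]
      simpa [neg_add_eq_sub] using h
    rcases (mem_extremePoints_iff_forall_segment.1 hy).2 a ha.1 x hx.1 h' with h | h
    exacts [hay h.symm, hxy h]

theorem exists_diagonal {P : Set (E 2)} (h : 3 < (P.extremePoints ℝ).ncard) :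
    ∃ a ∈ P.extremePoints ℝ, ∃ c ∈ P.extremePoints ℝ, ∃ b ∈ P.extremePoints ℝ,
      ∃ d ∈ P.extremePoints ℝ, cross (c - a) (b - a) < 0 ∧ 0 < cross (c - a) (d - a) := by
  obtain ⟨a, ha⟩ : (P.extremePoints ℝ).Nonempty := Set.nonempty_of_ncard_ne_zero (by omega)
  have h3 : 2 < (P.extremePoints ℝ \ {a}).ncard := by
    have := Set.ncard_sdiff_singleton_add_one ha
      (Set.finite_of_ncard_ne_zero (by omega))
    omega
  obtain ⟨x, y, z, ⟨hx, hxa⟩, ⟨hy, hya⟩, ⟨hz, hza⟩, hxy, hxz, hyz⟩ :=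
    (Set.two_lt_ncard_iff (Set.finite_of_ncard_ne_zero (by omega))).1 h3
  have hne₁ := cross_ne_zero_of_extremePoints ha hx hy hxa hya hxy
  have hne₂ := cross_ne_zero_of_extremePoints ha hy hz hya hza hyz
  have hne₃ := cross_ne_zero_of_extremePoints ha hz hx hza hxa (Ne.symm hxz)
  have key : ∀ x y z : E 2, x ∈ P.extremePoints ℝ → y ∈ P.extremePoints ℝ →
      z ∈ P.extremePoints ℝ → 0 < cross (x - a) (y - a) * cross (z - a) (x - a) →
      ∃ a ∈ P.extremePoints ℝ, ∃ c ∈ P.extremePoints ℝ, ∃ b ∈ P.extremePoints ℝ,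
        ∃ d ∈ P.extremePoints ℝ, cross (c - a) (b - a) < 0 ∧ 0 < cross (c - a) (d - a) := by
    intro x y z hx hy hz hpos
    rcases pos_and_pos_or_neg_and_neg_of_mul_pos hpos with ⟨h1, h2⟩ | ⟨h1, h2⟩
    · exact ⟨a, ha, x, hx, z, hz, y, hy, by rw [cross_swap]; linarith, h1⟩
    · exact ⟨a, ha, x, hx, y, hy, z, hz, h1, by rw [cross_swap]; linarith⟩
  by_cases h1 : 0 < cross (x - a) (y - a) * cross (z - a) (x - a)
  · exact key x y z hx hy hz h1
  by_cases h2 : 0 < cross (y - a) (z - a) * cross (x - a) (y - a)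
  · exact key y z x hy hz hx h2
  refine key z x y hz hx hy ?_
  -- among three nonzero numbers two have the same sign
  have h1' := (not_lt.1 h1).lt_of_ne (mul_ne_zero hne₁ hne₃)
  have h2' := (not_lt.1 h2).lt_of_ne (mul_ne_zero hne₂ hne₁)
  have h12 := mul_pos_of_neg_of_neg h1' h2'
  have : 0 < (cross (x - a) (y - a)) ^ 2 := by positivity
  exact (pos_iff_pos_of_mul_pos (a := cross (x - a) (y - a) ^ 2) (by nlinarith)).1 this

/-- A valuation that vanishes on points, on the segments `[o, a]` and `[a, b]`, and on the triangles
`[o, a, b]` with `a`, `b` linearly independent vanishes on all polygons. -/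
theorem eq_zero_of_vanish (hZ : IsValuation Z) (h1 : ∀ a, onSet Z {a} = 0)
    (h2 : ∀ a, onSet Z (segment ℝ 0 a) = 0)
    (h3 : ∀ a b, 0 < cross a b → onSet Z (segment ℝ a b) = 0)
    (h4 : ∀ a b, 0 < cross a b → onSet Z (convexHull ℝ {0, a, b}) = 0) (P : Polytope 2) :
    Z P = 0 := by
  have hseg := onSet_segment_eq_zero hZ h1 h2 h3
  have htri := onSet_triangle_eq_zero hZ hseg (onSet_triangle_zero_eq_zero hseg h4)
  suffices h : ∀ (n : ℕ) (P : Set (E 2)), IsPolytope P → (P.extremePoints ℝ).ncard = n →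
      onSet Z P = 0 by
    rw [← onSet_coe Z P]
    exact h _ P.1 P.2 rfl
  intro n
  induction n using Nat.strong_induction_on with
  | _ n ih =>
    intro P hP hn
    by_cases hn3 : 3 < n
    · obtain ⟨a, ha, c, hc, b, hb, d, hd, hneg, hpos⟩ := exists_diagonal (hn ▸ hn3)
      obtain ⟨P₁, P₂, hP₁, hP₂, hU, hI, hlt₁, hlt₂⟩ := exists_cut hP ha hc hb hd hneg hpos
      have := hZ.onSet_add hP₁ hP₂ hP (isPolytope_segment a c) hU hI
      rwa [ih _ (hn ▸ hlt₁) P₁ hP₁ rfl, ih _ (hn ▸ hlt₂) P₂ hP₂ rfl, hseg, add_zero, add_zero,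
        eq_comm] at this
    · have hne : (P.extremePoints ℝ).Nonempty := hP.isCompact.extremePoints_nonempty hP.nonempty
      have hn0 : (P.extremePoints ℝ).ncard ≠ 0 := fun h =>
        hne.ne_empty ((Set.ncard_eq_zero hP.finite_extremePoints).1 h)
      rw [← hP.convexHull_extremePoints]
      rcases (by omega : (P.extremePoints ℝ).ncard = 1 ∨ (P.extremePoints ℝ).ncard = 2 ∨
        (P.extremePoints ℝ).ncard = 3) with h | h | h
      · obtain ⟨a, ha⟩ := Set.ncard_eq_one.1 h
        rw [ha, convexHull_singleton, h1]
      · obtain ⟨a, b, -, hab⟩ := Set.ncard_eq_two.1 h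
        rw [hab, convexHull_pair, hseg]
      · obtain ⟨a, b, c, -, -, -, habc⟩ := Set.ncard_eq_three.1 h
        rw [habc, htri]

end Uniqueness

/-! ### Equivariant vector functions and the functional equation -/

section FunctionalEquation

theorem exists_eq_smul_of_equivariant {T : E 2 → E 2}
    (hT : ∀ (φ : SL2) (a : E 2), T (act φ a) = act φ (T a)) : ∃ k : ℝ, ∀ a, T a = k • a := by
  -- the stabilizer of `(1, 0)` contains a shear
  have h1 : T !₂[1, 0] = (T !₂[1, 0] 0) • !₂[1, 0] := by
    let φ : SL2 := ⟨!![1, 1; 0, 1], by simp⟩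
    have hφ : act φ !₂[1, 0] = !₂[1, 0] := by
      apply E2_ext <;> simp [φ]
    have h := congrArg (fun x : E 2 => x 0) (hT φ !₂[1, 0])
    simp only [hφ, act_zero_apply] at h
    simp only [φ, Matrix.of_apply, Matrix.cons_val', Matrix.cons_val_zero, Matrix.cons_val_one,
      Matrix.cons_val_fin_one, one_mul] at h
    apply E2_ext
    · simp
    · simp
      linarith
  refine ⟨T !₂[1, 0] 0, fun a => ?_⟩
  by_cases ha : a = 0
  · subst ha
    let φ : SL2 := ⟨!![0, -1; 1, 0], by simp⟩
    have h := hT φ 0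
    rw [map_zero] at h
    have h0 := congrArg (fun x : E 2 => x 0) h
    have h1 := congrArg (fun x : E 2 => x 1) h
    simp only [act_zero_apply, act_one_apply] at h0 h1
    simp [φ] at h0 h1
    rw [smul_zero]
    apply E2_ext
    · simp only [PiLp.zero_apply]; linarith
    · simp only [PiLp.zero_apply]; linarith
  · have hpos : 0 < cross a (rot a) := by
      have := norm_pos_iff.2 ha
      have h2 : cross a (rot a) = ‖a‖ ^ 2 := by rw [norm_sq_E2]; simp [cross]; ring
      rw [h2]
      positivity
    obtain ⟨φ, hφ, -⟩ := exists_act_eq hpos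
    rw [← hφ, hT, h1, map_smul]
    simp

theorem cross_std (d : ℝ) : cross !₂[1, 0] !₂[0, d] = d := by simp [cross]

/-- If `X` is equivariant on pairs of positive determinant and additive, up to the term `κ c`,
under subdivision of the segment `[a, b]` at `c`, then its coefficients with respect to `a` and `b`
are determined by `κ`, by a constant and by a solution of Cauchy's functional equation.

Writing `X a b = F D • a + G D • b` with `D` the determinant, the `a`-coordinate of the
subdivision at the point that divides `D` into `p` and `q` says that `H = F + G - κ` and `K x = x
* F x` satisfy `K (p + q) = K p + K q + q * H p`. By symmetry in `p` and `q` the function `H` is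
linear, so that `K` is the sum of a quadratic function and an additive one. -/
theorem exists_cauchySolution {X : E 2 → E 2 → E 2} {κ : ℝ}
    (hcov : ∀ (φ : SL2) (a b : E 2), X (act φ a) (act φ b) = act φ (X a b))
    (hadd : ∀ a b c : E 2, c ∈ segment ℝ a b → X a c + X c b = X a b + κ • c) :
    ∃ (h : ℝ) (ζ : ℝ≥0 → ℝ), IsCauchySolution ζ ∧ ∀ a b : E 2, 0 < cross a b →
      X a b = κ • b + (h * cross a b / 2) • (a + b) +
        (ζ (cross a b).toNNReal / cross a b) • (a - b) := by
  set F : ℝ → ℝ := fun d => X !₂[1, 0] !₂[0, d] 0 with hF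
  set G : ℝ → ℝ := fun d => X !₂[1, 0] !₂[0, d] 1 / d with hG
  have hFG : ∀ a b : E 2, 0 < cross a b → X a b = F (cross a b) • a + G (cross a b) • b := by
    intro a b hab
    obtain ⟨φ, hφa, hφb⟩ := exists_act_eq hab
    set d := cross a b
    have h1 : X !₂[1, 0] !₂[0, d] = F d • !₂[1, 0] + G d • !₂[0, d] := by
      apply E2_ext
      · simp [hF]
      · simp [hG, hab.ne']
    have h2 := hcov φ !₂[1, 0] !₂[0, d]
    rw [hφa, hφb, h1, map_add, map_smul, map_smul, hφa, hφb] at h2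
    exact h2
  have heq : ∀ p q : ℝ, 0 < p → 0 < q →
      (p + q) * F p + q * (G p + F q - κ) = (p + q) * F (p + q) := by
    intro p q hp hq
    have hpq : 0 < p + q := add_pos hp hq
    have hc := hadd !₂[1, 0] !₂[0, p + q] !₂[q / (p + q), p] (by
      refine ⟨q / (p + q), p / (p + q), by positivity, by positivity, ?_, ?_⟩
      · rw [← add_div, add_comm q p, div_self hpq.ne']
      · apply E2_ext
        · simp
        · simp [hpq.ne'])
    have h1 : cross !₂[1, 0] !₂[q / (p + q), p] = p := by simp [cross]
    have h2 : cross !₂[q / (p + q), p] !₂[0, p + q] = q := by simp [cross, hpq.ne']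
    have h3 : cross !₂[1, 0] !₂[0, p + q] = p + q := cross_std _
    rw [hFG _ _ (by rwa [h1]), hFG _ _ (by rwa [h2]), hFG _ _ (by rwa [h3]), h1, h2, h3] at hc
    have hc0 := congrArg (fun x : E 2 => x 0) hc
    simp at hc0
    field_simp at hc0
    linarith
  set H : ℝ → ℝ := fun x => F x + G x - κ with hH
  have hK : ∀ p q : ℝ, 0 < p → 0 < q →
      (p + q) * F (p + q) = p * F p + q * F q + q * H p := by
    intro p q hp hq
    rw [hH]
    linarith [heq p q hp hq]
  have hHlin : ∀ p : ℝ, 0 < p → H p = H 1 * p := by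
    intro p hp
    have h1 := hK p 1 hp one_pos
    have h2 := hK 1 p one_pos hp
    rw [add_comm 1 p] at h2
    linarith
  refine ⟨H 1, fun x => x * F x - H 1 * x ^ 2 / 2, ?_, ?_⟩
  · intro x y
    rcases eq_or_ne x 0 with rfl | hx
    · simp
    rcases eq_or_ne y 0 with rfl | hy
    · simp
    have hx' : (0 : ℝ) < x := by positivity
    have hy' : (0 : ℝ) < y := by positivity
    have := hK x y hx' hy'
    rw [hHlin x hx'] at this
    push_cast
    rw [this]
    ring
  · intro a b hab
    have h1 := hHlin _ hab
    dsimp only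
    rw [hFG a b hab, Real.coe_toNNReal _ hab.le]
    set d := cross a b
    have hd : d ≠ 0 := hab.ne'
    have h2 : G d = κ + H 1 * d - F d := by
      rw [← h1, hH]; ring
    have h3 : (d * F d - H 1 * d ^ 2 / 2) / d = F d - H 1 * d / 2 := by
      field_simp
    rw [h2, h3]
    module

end FunctionalEquation

/-! ### Values on points, segments and triangles -/

section Values

open MeasureTheory

variable {ζ : ℝ≥0 → ℝ}

theorem momentVector_eq_zero {S : Set (E 2)} (h : volume S = 0) : momentVector S = 0 :=
  setIntegral_measure_zero _ h

theorem volume_segment (a b : E 2) : volume (segment ℝ a b) = 0 := by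
  obtain ⟨u, hu, hab⟩ := exists_unit_orthogonal (b - a)
  rw [inner_sub_left, sub_eq_zero] at hab
  have h := fun x (hx : x ∈ affineSpan ℝ (segment ℝ a b)) =>
    inner_eq_of_mem_affineSpan (u := u) (h := inner ℝ a u) (by
      rintro _ ⟨s, t, -, -, hst, rfl⟩
      rw [inner_add_left, inner_smul_left, inner_smul_left, hab]
      simp only [conj_trivial]
      rw [← add_mul, hst, one_mul]) hx
  refine measure_mono_null (subset_affineSpan ℝ _)
    (Measure.addHaar_affineSubspace volume _ fun htop => ?_)
  have := h (a + u) (htop ▸ AffineSubspace.mem_top ℝ _ _)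
  rw [inner_add_left, real_inner_self_eq_norm_sq, hu] at this
  linarith

theorem convO_segment (a b : E 2) : convO (segment ℝ a b) = convexHull ℝ {0, a, b} :=
  convexHull_insert_segment 0 a b

theorem convO_singleton (a : E 2) : convO {a} = segment ℝ 0 a := convexHull_pair 0 a

theorem mem_segment_image {a b x : E 2} : x ∈ segment ℝ a b ↔
    ∃ s : ℝ, 0 ≤ s ∧ s ≤ 1 ∧ x = (1 - s) • a + s • b := by
  constructor
  · rintro ⟨r, s, hr, hs, hrs, rfl⟩
    exact ⟨s, hs, by linarith, by rw [← hrs, add_sub_cancel_right]⟩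
  · rintro ⟨s, h0, h1, rfl⟩
    exact ⟨1 - s, s, by linarith, h0, by ring, rfl⟩

theorem mem_visibleVertices_segment {a b : E 2} (h : cross a b ≠ 0) :
    a ∈ visibleVertices (segment ℝ a b) := by
  have ha0 : a ≠ 0 := by rintro rfl; simp at h
  have hcr : ∀ s : ℝ, cross a ((1 - s) • a + s • b) = s * cross a b := fun s => by
    rw [cross_add_smul, cross_self, mul_zero, zero_add]
  refine ⟨⟨left_mem_segment ℝ a b, ?_⟩, ?_⟩
  · rintro x hx y hy ⟨l, m, hl, hm, hlm, hxy⟩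
    obtain ⟨s, hs0, -, rfl⟩ := mem_segment_image.1 hx
    obtain ⟨t, ht0, -, rfl⟩ := mem_segment_image.1 hy
    have h1 : (l * s + m * t) * cross a b = 0 := by
      have := cross_add_smul l m a ((1 - s) • a + s • b) ((1 - t) • a + t • b)
      rw [hxy, cross_self, hcr, hcr] at this
      linarith
    have h2 := (mul_eq_zero.1 h1).resolve_right h
    have h3 : s = 0 := by nlinarith [mul_nonneg hl.le hs0, mul_nonneg hm.le ht0]
    rw [h3]; simp
  · refine Set.eq_empty_of_forall_notMem ?_
    rintro x ⟨hx, l, m, hl, hm, hlm, rfl⟩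
    obtain ⟨s, hs0, -, hs⟩ := mem_segment_image.1 hx
    have h1 := hcr s
    rw [← hs, cross_add_smul, cross_zero_right, cross_self, mul_zero, mul_zero, add_zero] at h1
    have h2 := (mul_eq_zero.1 h1.symm).resolve_right h
    rw [h2, smul_zero, zero_add, sub_zero, one_smul, zero_smul, add_zero] at hs
    have h3 : (m - 1) • a = 0 := by rw [sub_smul, hs, one_smul, sub_self]
    have h4 := (smul_eq_zero.1 h3).resolve_right ha0
    linarith

theorem visibleVertices_segment {a b : E 2} (h : cross a b ≠ 0) :
    visibleVertices (segment ℝ a b) = {a, b} := by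
  apply Set.Subset.antisymm
  · rintro x ⟨hx, -⟩
    rw [← convexHull_pair] at hx
    exact extremePoints_convexHull_subset hx
  · rintro x (rfl | rfl)
    · exact mem_visibleVertices_segment h
    · rw [segment_symm]
      exact mem_visibleVertices_segment (by rw [cross_swap]; exact neg_ne_zero.2 h)

theorem visibleVertices_singleton {a : E 2} (h : a ≠ 0) : visibleVertices {a} = {a} := by
  apply Set.Subset.antisymm (visibleVertices_subset _)
  rintro _ rfl
  refine ⟨by simp, Set.eq_empty_of_forall_notMem ?_⟩
  rintro x ⟨rfl, l, m, hl, hm, hlm, hx⟩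
  rw [smul_zero, zero_add] at hx
  have h3 : (m - 1) • x = 0 := by rw [sub_smul, hx, one_smul, sub_self]
  have h4 := (smul_eq_zero.1 h3).resolve_right h
  linarith

theorem eVector_segment_zero (a : E 2) : eVector (segment ℝ 0 a) = (2 : ℝ) • a := by
  rw [eVector_eq_edgeSum (isPolytope_segment 0 a) (left_mem_segment ℝ 0 a),
    edgeSum_of_segment (left_mem_segment ℝ 0 a), zero_add]

theorem eVector_convO_empty : eVector (convO ∅) = 0 := by
  have : convO (∅ : Set (E 2)) = segment ℝ 0 0 := by simp [convO]
  rw [this, eVector_segment_zero, smul_zero]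

theorem eVector_visibleVertices_singleton (a : E 2) :
    eVector (convO (visibleVertices {a})) = (2 : ℝ) • a := by
  by_cases ha : a = 0
  · rw [visibleVertices_eq_empty (convex_singleton a) (by rw [ha]; rfl), eVector_convO_empty, ha,
      smul_zero]
  · rw [visibleVertices_singleton ha, convO_singleton, eVector_segment_zero]

theorem isEdge_triangle {a b : E 2} (h : cross a b ≠ 0) :
    IsEdge (convexHull ℝ {0, a, b}) (segment ℝ 0 a) := by
  have hT := isPolytope_triangle 0 a b
  have ha0 : (0 : E 2) ≠ a := by rintro rfl; simp at h
  have hmem : ∀ x ∈ convexHull ℝ {0, a, b}, ∃ s t : ℝ, 0 ≤ s ∧ 0 ≤ t ∧ t ≤ 1 ∧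
      x = t • ((1 - s) • a + s • b) := by
    intro x hx
    rw [← convO_segment] at hx
    obtain ⟨p, hp, t, h0, h1, rfl⟩ := (mem_convO_iff (convex_segment a b)
      ⟨a, left_mem_segment ℝ a b⟩).1 hx
    obtain ⟨s, hs0, -, rfl⟩ := mem_segment_image.1 hp
    exact ⟨s, t, hs0, h0, h1, rfl⟩
  have hin : ∀ s t : ℝ, inner ℝ (t • ((1 - s) • a + s • b)) (-cross a b • rot a) =
      -(t * s * cross a b ^ 2) := by
    intro s t
    rw [inner_smul_right, inner_smul_left, ← cross_eq_inner_rot, cross_add_smul, cross_self,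
      conj_trivial]
    ring
  have h0T : (0 : E 2) ∈ convexHull ℝ {0, a, b} := subset_convexHull ℝ _ (by simp)
  have hs : supportFun (convexHull ℝ {0, a, b}) (-cross a b • rot a) = 0 := by
    rw [supportFun_eq_zero_iff hT.isCompact h0T]
    intro x hx
    obtain ⟨s, t, hs, ht, -, rfl⟩ := hmem x hx
    rw [hin, neg_nonpos]
    positivity
  refine isEdge_of_face hT.isCompact (u := -cross a b • rot a) ?_ ha0
  apply Set.Subset.antisymm
  · rintro x ⟨hx, hxu⟩
    obtain ⟨s, t, hs0, ht, ht1, rfl⟩ := hmem x hx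
    rw [hin, hs, neg_eq_zero, mul_eq_zero, or_iff_left (pow_ne_zero 2 h)] at hxu
    rcases mul_eq_zero.1 hxu with rfl | rfl
    · rw [zero_smul]; exact left_mem_segment ℝ _ _
    · exact ⟨1 - t, t, by linarith, ht, by ring, by simp⟩
  · refine (face_convex hT.convex _).segment_subset ⟨h0T, by rw [hs, inner_zero_left]⟩
      ⟨subset_convexHull ℝ _ (by simp), ?_⟩
    rw [hs, inner_smul_right, inner_rot_self, mul_zero]

theorem dim_triangle {a b : E 2} (h : cross a b ≠ 0) : dim (convexHull ℝ {0, a, b}) = 2 := by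
  have htop : vectorSpan ℝ (convexHull ℝ {0, a, b}) = ⊤ := by
    rw [eq_top_iff]
    intro x _
    have h0 : (0 : E 2) ∈ convexHull ℝ {0, a, b} := subset_convexHull ℝ _ (by simp)
    have hmem : ∀ y ∈ convexHull ℝ {0, a, b}, y ∈ vectorSpan ℝ (convexHull ℝ {0, a, b}) :=
      fun y hy => by simpa using vsub_mem_vectorSpan ℝ hy h0
    rw [eq_cross_smul_add h x]
    exact Submodule.add_mem _ (Submodule.smul_mem _ _ (hmem a (subset_convexHull ℝ _ (by simp))))
      (Submodule.smul_mem _ _ (hmem b (subset_convexHull ℝ _ (by simp))))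
  rw [dim, htop, finrank_top]
  simp

theorem eVector_triangle {a b : E 2} (h : cross a b ≠ 0) :
    eVector (convexHull ℝ {0, a, b}) = a + b := by
  have hT := isPolytope_triangle 0 a b
  have h0 : (0 : E 2) ∈ convexHull ℝ {0, a, b} := subset_convexHull ℝ _ (by simp)
  have hb := isEdge_triangle (a := b) (b := a) (by rw [cross_swap]; exact neg_ne_zero.2 h)
  rw [Set.pair_comm] at hb
  have hab : a ≠ b := by
    rintro rfl
    exact h (cross_self a)
  rw [eVector_eq_edgeSum hT h0,
    edgeSum_of_two_edges hT.isCompact h0 (dim_triangle h) hab (isEdge_triangle h) hb]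

end Values

section TriangleValues

open MeasureTheory

variable {ζ : ℝ≥0 → ℝ}

/-- The standard triangle `[o, e₁, e₂]`. -/
def stdTriangle : Set (E 2) := convexHull ℝ {0, !₂[1, 0], !₂[0, 1]}

theorem isPolytope_stdTriangle : IsPolytope stdTriangle := isPolytope_triangle _ _ _

/-- The linear map with columns `a` and `b`. -/
def columns (a b : E 2) : E 2 →ₗ[ℝ] E 2 := Matrix.toEuclideanLin !![a 0, b 0; a 1, b 1]

theorem det_columns (a b : E 2) : LinearMap.det (columns a b) = cross a b := by
  rw [columns, Matrix.toEuclideanLin_eq_toLin_orthonormal, LinearMap.det_toLin,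
    Matrix.det_fin_two_of, cross]
  ring

theorem columns_apply (a b x : E 2) : columns a b x = x 0 • a + x 1 • b := by
  apply E2_ext <;> simp [columns, Matrix.vecHead, Matrix.vecTail] <;> ring

theorem image_stdTriangle (a b : E 2) :
    columns a b '' stdTriangle = convexHull ℝ {0, a, b} := by
  rw [stdTriangle, LinearMap.image_convexHull]
  simp [Set.image_insert_eq, columns_apply]

theorem isOpen_subset_stdTriangle :
    IsOpen {x : E 2 | 0 < x 0 ∧ 0 < x 1 ∧ x 0 + x 1 < 1} ∧
      {x : E 2 | 0 < x 0 ∧ 0 < x 1 ∧ x 0 + x 1 < 1} ⊆ stdTriangle ∧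
      {x : E 2 | 0 < x 0 ∧ 0 < x 1 ∧ x 0 + x 1 < 1}.Nonempty := by
  refine ⟨?_, ?_, ⟨!₂[1 / 4, 1 / 4], ?_⟩⟩
  · have h0 : IsOpen {x : E 2 | 0 < x 0} := isOpen_lt (by fun_prop) (by fun_prop)
    have h1 : IsOpen {x : E 2 | 0 < x 1} := isOpen_lt (by fun_prop) (by fun_prop)
    have h2 : IsOpen {x : E 2 | x 0 + x 1 < 1} := isOpen_lt (by fun_prop) (by fun_prop)
    exact h0.inter (h1.inter h2)
  · rintro x ⟨h0, h1, h2⟩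
    have ht : 0 < x 0 + x 1 := add_pos h0 h1
    rw [stdTriangle, ← convO_segment,
      mem_convO_iff (convex_segment _ _) ⟨_, left_mem_segment ℝ _ _⟩]
    refine ⟨_, ⟨x 0 / (x 0 + x 1), x 1 / (x 0 + x 1), by positivity, by positivity, ?_, rfl⟩,
      x 0 + x 1, ht.le, h2.le, ?_⟩
    · rw [← add_div, div_self ht.ne']
    · apply E2_ext <;> simp <;> field_simp
  · simp; norm_num

theorem volume_stdTriangle_pos : 0 < (volume stdTriangle).toNNReal := by
  obtain ⟨ho, hsub, hne⟩ := isOpen_subset_stdTriangle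
  exact ENNReal.toNNReal_pos ((ho.measure_pos volume hne).trans_le (measure_mono hsub)).ne'
    isPolytope_stdTriangle.isCompact.measure_lt_top.ne

theorem volume_triangle {a b : E 2} (h : 0 < cross a b) :
    (volume (convexHull ℝ {0, a, b})).toNNReal =
      (cross a b).toNNReal * (volume stdTriangle).toNNReal := by
  rw [← image_stdTriangle, Measure.addHaar_image_linearMap, det_columns, abs_of_pos h,
    ENNReal.toNNReal_mul, ENNReal.ofReal, ENNReal.toNNReal_coe]

theorem momentVector_apply {S : Set (E 2)} (hS : IsCompact S) (i : Fin 2) :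
    momentVector S i = ∫ x in S, x i :=
  ((EuclideanSpace.proj (𝕜 := ℝ) i : E 2 →L[ℝ] ℝ).integral_comp_comm (integrableOn_id hS)).symm

theorem nonneg_of_mem_stdTriangle {x : E 2} (hx : x ∈ stdTriangle) : 0 ≤ x 0 := by
  refine convexHull_min (t := {x : E 2 | 0 ≤ x 0}) ?_ ?_ hx
  · rintro y (rfl | rfl | rfl) <;> simp
  · intro y hy z hz s t hs ht _
    simp only [Set.mem_ofPred_eq, PiLp.add_apply, PiLp.smul_apply, smul_eq_mul] at hy hz ⊢
    positivity

theorem momentVector_stdTriangle_pos : 0 < momentVector stdTriangle 0 := by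
  have hK := isPolytope_stdTriangle.isCompact
  obtain ⟨ho, hsub, hne⟩ := isOpen_subset_stdTriangle
  rw [momentVector_apply hK, setIntegral_pos_iff_support_of_nonneg_ae]
  · refine (ho.measure_pos volume hne).trans_le (measure_mono fun x hx => ⟨?_, hsub hx⟩)
    exact hx.1.ne'
  · rw [Filter.EventuallyLE, ae_restrict_iff' hK.measurableSet]
    exact Filter.Eventually.of_forall fun x hx => nonneg_of_mem_stdTriangle hx
  · exact (Continuous.continuousOn (by fun_prop)).integrableOn_compact hK

theorem momentVector_stdTriangle : momentVector stdTriangle 1 = momentVector stdTriangle 0 := by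
  -- the standard triangle is invariant under exchanging the coordinates
  have hc : cross !₂[0, 1] !₂[1, 0] = -1 := by simp [cross]
  have h1 : columns !₂[0, 1] !₂[1, 0] '' stdTriangle = stdTriangle := by
    rw [image_stdTriangle, Set.pair_comm, stdTriangle]
  have h2 := momentVector_image (columns !₂[0, 1] !₂[1, 0]) (by rw [det_columns, hc]; simp)
    isPolytope_stdTriangle.isCompact
  rw [h1, det_columns, hc, abs_neg, abs_one, one_smul, columns_apply] at h2
  have := congrArg (fun x : E 2 => x 0) h2
  simp at this
  exact this.symm

theorem momentVector_triangle {a b : E 2} (h : 0 < cross a b) :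
    momentVector (convexHull ℝ {0, a, b}) =
      (cross a b * momentVector stdTriangle 0) • (a + b) := by
  rw [← image_stdTriangle, momentVector_image _ (by rw [det_columns]; exact h.ne')
    isPolytope_stdTriangle.isCompact, det_columns, abs_of_pos h, columns_apply,
    momentVector_stdTriangle, ← smul_add, smul_smul]

theorem inner_rot_sub (a b : E 2) :
    inner ℝ a (rot (a - b)) = cross a b ∧ inner ℝ b (rot (a - b)) = cross a b := by
  constructor
  · rw [inner_E2]; simp [cross]; ring
  · rw [inner_E2]; simp [cross]; ring

theorem inner_mem_segment {a b u x : E 2} {h : ℝ} (ha : inner ℝ a u = h) (hb : inner ℝ b u = h)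
    (hx : x ∈ segment ℝ a b) : inner ℝ x u = h := by
  obtain ⟨s, t, -, -, hst, rfl⟩ := hx
  rw [inner_add_left, inner_smul_left, inner_smul_left, ha, hb]
  simp only [conj_trivial]
  rw [← add_mul, hst, one_mul]

theorem supportFun_and_face_triangle {a b : E 2} (h : 0 < cross a b) :
    supportFun (convexHull ℝ {0, a, b}) (rot (a - b)) = cross a b ∧
      face (convexHull ℝ {0, a, b}) (rot (a - b)) = segment ℝ a b := by
  obtain ⟨ha, hb⟩ := inner_rot_sub a b
  rw [← convO_segment]
  have hmem := fun {x : E 2} => mem_convO_iff (x := x) (convex_segment a b)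
    ⟨a, left_mem_segment ℝ a b⟩
  have hs : supportFun (convO (segment ℝ a b)) (rot (a - b)) = cross a b := by
    rw [supportFun_eq (subset_convO _ (left_mem_segment ℝ a b)), ha]
    intro y hy
    obtain ⟨p, hp, t, h0, h1, rfl⟩ := hmem.1 hy
    rw [inner_smul_left, inner_mem_segment ha hb hp, ha, conj_trivial]
    nlinarith
  refine ⟨hs, Set.Subset.antisymm ?_ fun x hx => ⟨subset_convO _ hx, ?_⟩⟩
  · rintro x ⟨hx, hxu⟩
    obtain ⟨p, hp, t, h0, h1, rfl⟩ := hmem.1 hx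
    rw [hs, inner_smul_left, inner_mem_segment ha hb hp, conj_trivial] at hxu
    have ht : t = 1 := mul_right_cancel₀ h.ne' (hxu.trans (one_mul _).symm)
    rwa [ht, one_smul]
  · rw [hs, inner_mem_segment ha hb hx]

/-- The only edge of `[o, a, b]` that contributes to the facet vector is `[a, b]`. -/
theorem facetVector_triangle (hζ : IsCauchySolution ζ) {a b : E 2} (h : 0 < cross a b) :
    facetVector ζ (convexHull ℝ {0, a, b}) =
      (ζ (volume (convexHull ℝ {0, a, b})).toNNReal / cross a b) • rot (a - b) := by
  obtain ⟨hs, hF⟩ := supportFun_and_face_triangle h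
  obtain ⟨ha, hb⟩ := inner_rot_sub a b
  have hT := isPolytope_triangle 0 a b
  set w := rot (a - b) with hw
  have hw0 : w ≠ 0 := by
    intro h0
    rw [h0, inner_zero_right] at ha
    exact h.ne ha
  have hpos : 0 < ‖w‖⁻¹ := inv_pos.2 (norm_pos_iff.2 hw0)
  rw [facetVector_eq_sphereSum hζ, sphereSum_eq_single (norm_unit hw0)]
  · rw [facetTerm, coneVolume, unit, face_smul _ hpos, hF, convO_segment,
      supportFun_smul _ hpos.le, hs, smul_smul, abs_of_pos (mul_pos hpos h)]
    congr 1
    field_simp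
  · intro v hv hne
    by_contra hv0
    obtain ⟨x, hx, y, hy, hxy, hxv, hyv⟩ := exists_pair_of_facetTerm_ne_zero hζ hT hv0
    set t := supportFun (convexHull ℝ {0, a, b}) v with ht
    have ht0 : t ≠ 0 := by
      intro ht0
      rw [facetTerm, ← ht, ht0, abs_zero, div_zero, zero_smul] at hv0
      exact hv0 rfl
    have htpos : 0 < t := by
      refine lt_of_le_of_ne ?_ ht0.symm
      have := inner_le_supportFun hT.isCompact (subset_convexHull ℝ _ (by simp) :
        (0 : E 2) ∈ convexHull ℝ {0, a, b}) v
      rwa [inner_zero_left] at this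
    have hx0 : x ≠ 0 := by
      rintro rfl
      rw [inner_zero_left] at hxv
      exact ht0 hxv.symm
    have hy0 : y ≠ 0 := by
      rintro rfl
      rw [inner_zero_left] at hyv
      exact ht0 hyv.symm
    have hab : inner ℝ a v = t ∧ inner ℝ b v = t := by
      rcases extremePoints_convexHull_subset hx with rfl | rfl | rfl
      · exact absurd rfl hx0
      · rcases extremePoints_convexHull_subset hy with rfl | rfl | rfl
        exacts [absurd rfl hy0, absurd rfl hxy, ⟨hxv, hyv⟩]
      · rcases extremePoints_convexHull_subset hy with rfl | rfl | rfl
        exacts [absurd rfl hy0, ⟨hyv, hxv⟩, absurd rfl hxy]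
    -- both `v` and `rot (a - b)` are orthogonal to `a - b`
    have hdet : cross (unit w) v = 0 := by
      rw [cross_eq_inner_rot, unit, rot_smul, hw, rot_rot, inner_smul_right, inner_neg_right,
        real_inner_comm, inner_sub_left, hab.1, hab.2, sub_self, neg_zero, mul_zero]
    rcases eq_or_eq_neg_of_cross_eq_zero (norm_unit hw0) hv hdet with h1 | h1
    · exact hne h1
    · have := hab.1
      rw [h1, inner_neg_right, unit, inner_smul_right, ha] at this
      have := mul_pos hpos h
      linarith

/-- The two unit normals of a segment give opposite contributions. -/
theorem facetVector_segment (hζ : IsCauchySolution ζ) (a b : E 2) :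
    facetVector ζ (segment ℝ a b) = 0 := by
  have hS := isPolytope_segment a b
  have hmem : ∀ x ∈ (segment ℝ a b).extremePoints ℝ, x = a ∨ x = b := fun x hx => by
    rw [← convexHull_pair] at hx
    have hx' : x ∈ ({a, b} : Set (E 2)) := extremePoints_convexHull_subset hx
    exact hx'
  have hzero : ∀ u, inner ℝ a u ≠ (inner ℝ b u : ℝ) → facetTerm ζ (segment ℝ a b) u = 0 := by
    intro u hu
    by_contra h
    obtain ⟨x, hx, y, hy, hxy, hxu, hyu⟩ := exists_pair_of_facetTerm_ne_zero hζ hS h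
    rcases hmem x hx with rfl | rfl <;> rcases hmem y hy with rfl | rfl
    exacts [hxy rfl, hu (hxu.trans hyu.symm), hu (hyu.trans hxu.symm), hxy rfl]
  have hface : ∀ u, inner ℝ a u = (inner ℝ b u : ℝ) →
      supportFun (segment ℝ a b) u = inner ℝ b u ∧ face (segment ℝ a b) u = segment ℝ a b := by
    intro u hu
    have hs : supportFun (segment ℝ a b) u = inner ℝ b u := by
      rw [supportFun_segment, hu, max_self]
    refine ⟨hs, Set.Subset.antisymm (face_subset _ _) fun x hx => ⟨hx, ?_⟩⟩
    rw [hs, inner_mem_segment hu rfl hx]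
  have hneg : ∀ u, facetTerm ζ (segment ℝ a b) (-u) = -facetTerm ζ (segment ℝ a b) u := by
    intro u
    by_cases hu : inner ℝ a u = (inner ℝ b u : ℝ)
    · obtain ⟨h1, h2⟩ := hface u hu
      obtain ⟨h3, h4⟩ := hface (-u) (by rw [inner_neg_right, inner_neg_right, hu])
      rw [facetTerm, facetTerm, coneVolume, coneVolume, h1, h2, h3, h4, inner_neg_right, abs_neg,
        smul_neg]
    · rw [hzero u hu, hzero (-u) (by rwa [inner_neg_right, inner_neg_right, ne_eq, neg_inj]),
        neg_zero]
  have hbij : Set.BijOn (fun u : E 2 => -u) {u | ‖u‖ = 1} {u | ‖u‖ = 1} := by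
    have hm : Set.MapsTo (fun u : E 2 => -u) {u | ‖u‖ = 1} {u | ‖u‖ = 1} := fun u hu => by
      rwa [Set.mem_ofPred_eq, norm_neg]
    exact Set.InvOn.bijOn (f' := fun u => -u) ⟨fun u _ => neg_neg u, fun u _ => neg_neg u⟩ hm hm
  have h1 : sphereSum (fun u => -facetTerm ζ (segment ℝ a b) u) =
      sphereSum (facetTerm ζ (segment ℝ a b)) :=
    finsum_mem_eq_of_bijOn _ hbij fun u _ => (hneg u).symm
  have h2 := sphereSum_map (-LinearMap.id) (finite_support_facetTerm hζ hS)
  simp only [LinearMap.neg_apply, LinearMap.id_apply] at h2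
  rw [h1] at h2
  rw [facetVector_eq_sphereSum hζ]
  by_contra h
  exact unit_ne_neg (norm_unit h) (by rw [unit, ← smul_neg, ← h2])

end TriangleValues

/-! ### The classification -/

section Classification

variable {Z : Polytope 2 → E 2}

theorem onSet_add_smul (Z Z' : Polytope 2 → E 2) (r : ℝ) (S : Set (E 2)) :
    onSet (fun P => Z P + r • Z' P) S = onSet Z S + r • onSet Z' S := by
  by_cases hS : IsPolytope S
  · simp only [onSet, dif_pos hS]
  · simp only [onSet, dif_neg hS, smul_zero, add_zero]

theorem onSet_image_act (hZ : IsSLContravariant Z) (φ : SL2) {S : Set (E 2)} (hS : IsPolytope S) :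
    onSet Z (act φ '' S) = coact φ (onSet Z S) := by
  rw [onSet_of_isPolytope Z hS, onSet_of_isPolytope Z (hS.image (act φ))]
  exact hZ φ ⟨S, hS⟩

theorem neg_rot_onSet_image_act (hZ : IsSLContravariant Z) (φ : SL2) {S : Set (E 2)}
    (hS : IsPolytope S) : -rot (onSet Z (act φ '' S)) = act φ (-rot (onSet Z S)) := by
  apply rot_injective
  rw [← coact_rot, onSet_image_act hZ φ hS, rot_neg, rot_neg, rot_rot, rot_rot, neg_neg, neg_neg]

theorem onSet_eq_rot {S : Set (E 2)} : onSet Z S = rot (-rot (onSet Z S)) := by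
  rw [rot_neg, rot_rot, neg_neg]

theorem image_segment_act (φ : SL2) (a b : E 2) :
    act φ '' segment ℝ a b = segment ℝ (act φ a) (act φ b) :=
  image_segment ℝ (act φ).toAffineMap a b

/-- The values of a contravariant valuation on points, segments and triangles with a vertex at the
origin. -/
theorem exists_values (hZ : IsValuation Z) (hZ' : IsSLContravariant Z) :
    ∃ (k α h h' : ℝ) (ζ ζ' : ℝ≥0 → ℝ), IsCauchySolution ζ ∧ IsCauchySolution ζ' ∧
      (∀ a, onSet Z {a} = rot (k • a)) ∧ (∀ a, onSet Z (segment ℝ 0 a) = rot (α • a)) ∧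
      (∀ a b, 0 < cross a b → onSet Z (segment ℝ a b) =
        rot (k • b + (h * cross a b / 2) • (a + b) +
          (ζ (cross a b).toNNReal / cross a b) • (a - b))) ∧
      (∀ a b, 0 < cross a b → onSet Z (convexHull ℝ {0, a, b}) =
        rot (α • b + (h' * cross a b / 2) • (a + b) +
          (ζ' (cross a b).toNNReal / cross a b) • (a - b))) := by
  obtain ⟨k, hk⟩ := exists_eq_smul_of_equivariant (T := fun a => -rot (onSet Z {a})) fun φ a => by
    rw [← neg_rot_onSet_image_act hZ' φ (isPolytope_singleton a), Set.image_singleton]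
  obtain ⟨α, hα⟩ := exists_eq_smul_of_equivariant
    (T := fun a => -rot (onSet Z (segment ℝ 0 a))) fun φ a => by
      rw [← neg_rot_onSet_image_act hZ' φ (isPolytope_segment 0 a), image_segment_act, map_zero]
  have hlin : ∀ x y z w : E 2, x + y = z + w → -rot x + -rot y = -rot z + -rot w := by
    intro x y z w h
    rw [← neg_add, ← neg_add, ← rot_add, ← rot_add, h]
  obtain ⟨h, ζ, hζ, hX⟩ := exists_cauchySolution (κ := k)
    (X := fun a b => -rot (onSet Z (segment ℝ a b)))
    (fun φ a b => by
      rw [← neg_rot_onSet_image_act hZ' φ (isPolytope_segment a b), image_segment_act])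
    (fun a b c hc => by
      rw [← hk c]
      exact hlin _ _ _ _ (hZ.onSet_segment_add hc))
  obtain ⟨h', ζ', hζ', hX'⟩ := exists_cauchySolution (κ := α)
    (X := fun a b => -rot (onSet Z (convexHull ℝ {0, a, b})))
    (fun φ a b => by
      rw [← neg_rot_onSet_image_act hZ' φ (isPolytope_triangle 0 a b),
        LinearMap.image_convexHull]
      simp only [Set.image_insert_eq, Set.image_singleton, map_zero])
    (fun a b c hc => by
      rw [← hα c]
      exact hlin _ _ _ _ (hZ.onSet_triangle_add 0 hc))
  refine ⟨k, α, h, h', ζ, ζ', hζ, hζ', fun a => ?_, fun a => ?_, fun a b hab => ?_,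
    fun a b hab => ?_⟩
  · rw [← hk, ← onSet_eq_rot]
  · rw [← hα, ← onSet_eq_rot]
  · rw [← hX a b hab, ← onSet_eq_rot]
  · rw [← hX' a b hab, ← onSet_eq_rot]

variable (c₁ c₂ d₁ d₂ : ℝ) {ζ₁ ζ₂ : ℝ≥0 → ℝ}

theorem onSet_candidate (ζ₁ ζ₂ : ℝ≥0 → ℝ) {S : Set (E 2)} (hS : IsPolytope S) :
    onSet (candidate c₁ c₂ d₁ d₂ ζ₁ ζ₂) S =
      facetVector ζ₁ S + facetVector ζ₂ (convO S) + c₁ • rot (momentVector S)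
        + d₁ • rot (momentVector (convO S)) + c₂ • rot (eVector (convO S))
        + d₂ • rot (eVector (convO (visibleVertices S))) :=
  dif_pos hS

theorem candidate_segment_zero (h₁ : IsCauchySolution ζ₁) (h₂ : IsCauchySolution ζ₂) (a : E 2) :
    onSet (candidate c₁ c₂ d₁ d₂ ζ₁ ζ₂) (segment ℝ 0 a) = rot ((2 * c₂) • a) := by
  have h0 := left_mem_segment ℝ 0 a
  rw [onSet_candidate _ _ _ _ _ _ (isPolytope_segment 0 a)]
  rw [convO_eq_self (convex_segment 0 a) h0, visibleVertices_eq_empty (convex_segment 0 a) h0,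
    eVector_convO_empty, facetVector_segment h₁, facetVector_segment h₂,
    momentVector_eq_zero (volume_segment 0 a), eVector_segment_zero, rot_smul, rot_smul]
  simp only [rot_zero, smul_zero, add_zero, zero_add, smul_smul]
  rw [mul_comm]

theorem candidate_singleton (h₁ : IsCauchySolution ζ₁) (h₂ : IsCauchySolution ζ₂) (a : E 2) :
    onSet (candidate c₁ c₂ d₁ d₂ ζ₁ ζ₂) {a} = rot ((2 * (c₂ + d₂)) • a) := by
  have hm : momentVector ({a} : Set (E 2)) = 0 := by
    rw [← segment_same ℝ a]
    exact momentVector_eq_zero (volume_segment a a)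
  have hf : facetVector ζ₁ ({a} : Set (E 2)) = 0 := by
    rw [← segment_same ℝ a]
    exact facetVector_segment h₁ a a
  rw [onSet_candidate _ _ _ _ _ _ (isPolytope_singleton a)]
  rw [eVector_visibleVertices_singleton, convO_singleton, hf, facetVector_segment h₂, hm,
    momentVector_eq_zero (volume_segment 0 a), eVector_segment_zero, rot_smul, rot_smul, rot_zero]
  module

theorem candidate_segment (h₁ : IsCauchySolution ζ₁) (h₂ : IsCauchySolution ζ₂) {a b : E 2}
    (h : 0 < cross a b) :
    onSet (candidate c₁ c₂ d₁ d₂ ζ₁ ζ₂) (segment ℝ a b) =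
      rot ((ζ₂ (MeasureTheory.volume (convexHull ℝ {0, a, b})).toNNReal / cross a b) • (a - b) +
        (d₁ * (cross a b * momentVector stdTriangle 0) + c₂ + d₂) • (a + b)) := by
  have hvis : convO (visibleVertices (segment ℝ a b)) = convexHull ℝ {0, a, b} := by
    rw [visibleVertices_segment h.ne', convO]
  rw [onSet_candidate _ _ _ _ _ _ (isPolytope_segment a b)]
  rw [hvis, convO_segment, facetVector_segment h₁, facetVector_triangle h₂ h,
    momentVector_eq_zero (volume_segment a b), momentVector_triangle h, eVector_triangle h.ne']
  simp only [rot_add, rot_sub, rot_smul, rot_zero]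
  module

theorem candidate_triangle (h₁ : IsCauchySolution ζ₁) (h₂ : IsCauchySolution ζ₂) {a b : E 2}
    (h : 0 < cross a b) :
    onSet (candidate c₁ c₂ d₁ d₂ ζ₁ ζ₂) (convexHull ℝ {0, a, b}) =
      rot (((ζ₁ (MeasureTheory.volume (convexHull ℝ {0, a, b})).toNNReal +
        ζ₂ (MeasureTheory.volume (convexHull ℝ {0, a, b})).toNNReal) / cross a b) • (a - b) +
        ((c₁ + d₁) * (cross a b * momentVector stdTriangle 0) + c₂) • (a + b)) := by
  have hT := isPolytope_triangle 0 a b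
  have h0 : (0 : E 2) ∈ convexHull ℝ {0, a, b} := subset_convexHull ℝ _ (by simp)
  rw [onSet_candidate _ _ _ _ _ _ hT]
  rw [convO_eq_self hT.convex h0, visibleVertices_eq_empty hT.convex h0, eVector_convO_empty,
    facetVector_triangle h₁ h, facetVector_triangle h₂ h, momentVector_triangle h,
    eVector_triangle h.ne']
  simp only [rot_add, rot_sub, rot_smul, rot_zero]
  module

theorem isCauchySolution_smul {ζ : ℝ≥0 → ℝ} (hζ : IsCauchySolution ζ) (c : ℝ≥0) (r : ℝ) :
    IsCauchySolution fun x => ζ (x / c) - r * x := by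
  intro x y
  dsimp only
  rw [add_div, hζ]
  push_cast
  ring

/-- Every contravariant valuation agrees with a member of the family on the polygons of
`eq_zero_of_vanish`, and hence everywhere. -/
theorem exists_eq_candidate (hZ : IsValuation Z) (hZ' : IsSLContravariant Z) :
    ∃ (c₁ c₂ d₁ d₂ : ℝ) (ζ₁ ζ₂ : ℝ≥0 → ℝ), IsCauchySolution ζ₁ ∧ IsCauchySolution ζ₂ ∧
      ∀ P, Z P = candidate c₁ c₂ d₁ d₂ ζ₁ ζ₂ P := by
  obtain ⟨k, α, h, h', ζ, ζ', hζ, hζ', hpt, hseg0, hseg, htri⟩ := exists_values hZ hZ'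
  set c : ℝ≥0 := (MeasureTheory.volume stdTriangle).toNNReal with hc
  set μ : ℝ := momentVector stdTriangle 0 with hμ
  have hc0 : 0 < c := volume_stdTriangle_pos
  have hcR : (0 : ℝ) < c := hc0
  have hμ0 : 0 < μ := momentVector_stdTriangle_pos
  -- `ζ₂` and `d₁` are found from the segments, then `ζ₁` and `c₁` from the triangles
  set ζ₂ : ℝ≥0 → ℝ := fun x => ζ (x / c) - k / (2 * c) * x with hζ₂
  set ζ₁ : ℝ≥0 → ℝ := fun x => ζ' (x / c) - α / (2 * c) * x - ζ₂ x with hζ₁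
  have hC₂ : IsCauchySolution ζ₂ := isCauchySolution_smul hζ c _
  have hC₁ : IsCauchySolution ζ₁ := by
    intro x y
    have h1 := isCauchySolution_smul hζ' c (α / (2 * c)) x y
    simp only [hζ₁] at h1 ⊢
    rw [h1, hC₂ x y]
    ring
  set d₁ : ℝ := h / (2 * μ) with hd₁
  set c₁ : ℝ := h' / (2 * μ) - d₁ with hc₁
  refine ⟨c₁, α / 2, d₁, (k - α) / 2, ζ₁, ζ₂, hC₁, hC₂, fun P => ?_⟩
  set C := candidate c₁ (α / 2) d₁ ((k - α) / 2) ζ₁ ζ₂ with hCdef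
  have hW : IsValuation fun P => Z P + (-1 : ℝ) • C P :=
    hZ.add ((candidate_isValuation _ _ _ _ hC₁ hC₂).smul (-1))
  have hon : ∀ {S : Set (E 2)}, IsPolytope S → onSet Z S = onSet C S →
      onSet (fun P => Z P + (-1 : ℝ) • C P) S = 0 := by
    intro S hS hSe
    rw [onSet_add_smul, hSe]
    module
  have key := eq_zero_of_vanish hW
    (fun a => hon (isPolytope_singleton a) (by
      rw [hpt, hCdef, candidate_singleton _ _ _ _ hC₁ hC₂]
      congr 2
      ring))
    (fun a => hon (isPolytope_segment 0 a) (by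
      rw [hseg0, hCdef, candidate_segment_zero _ _ _ _ hC₁ hC₂]
      congr 2
      ring))
    (fun a b hab => hon (isPolytope_segment a b) (by
      rw [hseg a b hab, hCdef, candidate_segment _ _ _ _ hC₁ hC₂ hab, volume_triangle hab, ← hc,
        ← hμ]
      congr 1
      simp only [hζ₂, mul_div_cancel_right₀ _ hc0.ne', hd₁]
      push_cast
      rw [Real.coe_toNNReal _ hab.le]
      set D := cross a b
      have hD : D ≠ 0 := hab.ne'
      have h1 : (ζ D.toNNReal - k / (2 * c) * (D * c)) / D = ζ D.toNNReal / D - k / 2 := by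
        field_simp
      have h2 : h / (2 * μ) * (D * μ) = h * D / 2 := by field_simp
      rw [h1, h2]
      module))
    (fun a b hab => hon (isPolytope_triangle 0 a b) (by
      rw [htri a b hab, hCdef, candidate_triangle _ _ _ _ hC₁ hC₂ hab, volume_triangle hab, ← hc,
        ← hμ]
      congr 1
      simp only [hζ₁, sub_add_cancel, mul_div_cancel_right₀ _ hc0.ne', hc₁]
      push_cast
      rw [Real.coe_toNNReal _ hab.le]
      set D := cross a b
      have hD : D ≠ 0 := hab.ne'
      have h1 : (ζ' D.toNNReal - α / (2 * c) * (D * c)) / D = ζ' D.toNNReal / D - α / 2 := by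
        field_simp
      have h2 : h' / (2 * μ) * (D * μ) = h' * D / 2 := by field_simp
      rw [h1, h2]
      module)) P
  rw [neg_one_smul, add_neg_eq_zero] at key
  exact key

end Classification

end SLVal
end

theorem theorem1p4 (Z : SLVal.Polytope 2 → SLVal.E 2) :
    (SLVal.IsValuation Z ∧ SLVal.IsSLContravariant Z) ↔
      ∃ (c₁ c₂ d₁ d₂ : ℝ) (ζ₁ ζ₂ : ℝ≥0 → ℝ),
        SLVal.IsCauchySolution ζ₁ ∧ SLVal.IsCauchySolution ζ₂ ∧
        ∀ P : SLVal.Polytope 2,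
          Z P = SLVal.facetVector ζ₁ (P : Set (SLVal.E 2))
            + SLVal.facetVector ζ₂ (SLVal.convO (P : Set (SLVal.E 2)))
            + c₁ • SLVal.rot (SLVal.momentVector (P : Set (SLVal.E 2)))
            + d₁ • SLVal.rot (SLVal.momentVector (SLVal.convO (P : Set (SLVal.E 2))))
            + c₂ • SLVal.rot (SLVal.eVector (SLVal.convO (P : Set (SLVal.E 2))))
            + d₂ • SLVal.rot
                (SLVal.eVector (SLVal.convO (SLVal.visibleVertices (P : Set (SLVal.E 2))))) := by
  constructor
  · rintro ⟨hZ, hZ'⟩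
    exact SLVal.exists_eq_candidate hZ hZ'
  · rintro ⟨c₁, c₂, d₁, d₂, ζ₁, ζ₂, h₁, h₂, hZ⟩
    have : Z = SLVal.candidate c₁ c₂ d₁ d₂ ζ₁ ζ₂ := funext hZ
    rw [this]
    exact ⟨SLVal.candidate_isValuation c₁ c₂ d₁ d₂ h₁ h₂,
      SLVal.candidate_isSLContravariant c₁ c₂ d₁ d₂ h₁ h₂⟩
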